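/- Fix an integer $p\ge 3$, put $\lambda=2\cos(\pi/p)$, $S=\begin{pmatrix}1&\lambda\\0&1\end{pmatrix}$, $T=\begin{pmatrix}0&-1\\1&0\end{pmatrix}$, $U=ST$, and let $G_p=\langle S,T\rangle/\{\pm I\}$ be the Hecke group, acting by Möbius transformations. A real number is a hyperbolic point if it is fixed by some $M\in G_p$ with $|\operatorname{tr}M|>2$; its Hecke-conjugate $\alpha'$ is the other fixed point of the elements of its stabilizer in $G_p$. A set $R$ of hyperbolic points is Hecke-symmetric if $R=R'=\{x':x\in R\}$. For a hyperbolic point $\alpha$ let $M_\alpha=\begin{pmatrix}a&b\\c&d\end{pmatrix}$ be the primitive hyperbolic element of $G_p$ with positive trace that has $\alpha$ as attracting fixed point, and put $Q_\alpha=[c,d-a,-b]$, i.e. $Q_\alpha(z,1)=cz^2+(d-a)z-b$. The group $G_p$ acts on indefinite binary quadratic forms over $\mathbb Z[\lambda]$ by $(Q\circ M)(x,y)=Q(ax+by,cx+dy)$; a class (orbit) $\mathcal A$ is hyperbolic if it contains some $Q_\alpha$. Put $-\mathcal A=\{-Q:Q\in\mathcal A\}$, and let $Z_{\mathcal A}$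 be the set of hyperbolic points $\alpha$ such that $Q_\alpha=[A,B,C]\in\mathcal A$ and $A>0>C$. A rational period function (RPF) of weight $2k$ on $G_p$ is a rational function $q$ over $\mathbb C$ with $q+q|T=0$ and $\sum_{t=0}^{p-1}q|U^t=0$, where $(q|M)(z)=(cz+d)^{-2k}q(Mz)$. Its irreducible systems of (nonzero) poles (ISPs) are the sets $P_{\mathcal A}=Z_{\mathcal A}\cup TZ_{\mathcal A}$, $\mathcal A$ a hyperbolic class, that consist of poles of $q$. Let $q_{k,0}$ denote any function $a_0(1-z^{-2k})$ if $k\ne 1$, and $a_0(1-z^{-2})+b_1z^{-1}$ if $k=1$, with $a_0,b_1\in\mathbb C$. Theorem 2 (corrected). Let $k$ be an odd positive integer and $p\ge3$. Each set $Z_{\mathcal A}$, $\mathcal A$ a hyperbolic class, is finite. If $q$ is an RPF of weight $2k$ on $G_p$ all of whose ISPs are Hecke-symmetric, then $$q(z)=\sum_{\ell=1}^{L}d_\ell\sum_{\alpha\in Z_{\mathcal A_\ell}}Q_\alpha(z,1)^{-k}+c_0\,q_{k,0}(z)\qquad(*)$$ for some $L\ge 0$, constants $d_\ell,c_0\in\mathbb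 C$, a function $q_{k,0}$ as above, and hyperbolic classes $\mathcal A_\ell$ with $-\mathcal A_\ell=\mathcal A_\ell$. Conversely, every function of the form $(*)$ with hyperbolic classes satisfying $-\mathcal A_\ell=\mathcal A_\ell$ is an RPF of weight $2k$ on $G_p$ whose whole set of nonzero poles is Hecke-symmetric. Moreover, a Hecke-symmetric set of nonzero poles does not imply Hecke-symmetric ISPs: for every odd $k$ there are $p\ge3$ and a hyperbolic class $\mathcal A$, with $-\mathcal A$ hyperbolic, such that $\sum_{\alpha\in Z_{\mathcal A}}Q_\alpha(z,1)^{-k}+\sum_{\alpha\in Z_{-\mathcal A}}Q_\alpha(z,1)^{-k}$ is an RPF of weight $2k$ on $G_p$ whose set of nonzero poles is Hecke-symmetric, but which has an ISP that is not Hecke-symmetric. -/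

import Mathlib

noncomputable section

open scoped MatrixGroups

/-! ### The Hecke group `G_p`

It is handled through its preimage in `SL(2, ℝ)`; the quotient by `±I` is recorded by
identifying `M` with `-M` wherever it matters. -/

/-- `λ_p = 2 cos(π / p)`. -/
def heckeLambda (p : ℕ) : ℝ := 2 * Real.cos (Real.pi / p)

/-- `S = (1 λ; 0 1)`. -/
def heckeS (p : ℕ) : SL(2, ℝ) :=
  ⟨!![1, heckeLambda p; 0, 1], by simp [Matrix.det_fin_two]⟩

/-- `T = (0 -1; 1 0)`. -/
def heckeT : SL(2, ℝ) :=
  ⟨!![0, -1; 1, 0], by simp [Matrix.det_fin_two]⟩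

/-- `U = S T`. -/
def heckeU (p : ℕ) : SL(2, ℝ) := heckeS p * heckeT

/-- The Hecke group, as the subgroup of `SL(2, ℝ)` generated by `S` and `T`. -/
def heckeGroup (p : ℕ) : Subgroup SL(2, ℝ) := Subgroup.closure {heckeS p, heckeT}

/-- The trace of a matrix in `SL(2, ℝ)`. -/
def slTrace (M : SL(2, ℝ)) : ℝ := M 0 0 + M 1 1

/-- The real number `x` is fixed by the Möbius transformation of `M`. -/
def Fixes (M : SL(2, ℝ)) (x : ℝ) : Prop :=
  M 0 0 * x + M 0 1 = x * (M 1 0 * x + M 1 1)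

/-- `x` is an attracting fixed point of `M`: the derivative `(c x + d)⁻²` of the Möbius
transformation at the fixed point `x` is less than `1`. -/
def IsAttracting (M : SL(2, ℝ)) (x : ℝ) : Prop :=
  Fixes M x ∧ 1 < |M 1 0 * x + M 1 1|

/-- `x` is a hyperbolic fixed point of `G_p`. -/
def IsHyperbolicPoint (p : ℕ) (x : ℝ) : Prop :=
  ∃ M ∈ heckeGroup p, 2 < |slTrace M| ∧ Fixes M x

/-- `y` is the Hecke-conjugate of the hyperbolic fixed point `x`: the other fixed point of the
elements of the stabilizer of `x` in `G_p`. -/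
def IsHeckeConj (p : ℕ) (x y : ℝ) : Prop :=
  IsHyperbolicPoint p x ∧ y ≠ x ∧ ∀ M ∈ heckeGroup p, Fixes M x → Fixes M y

/-- `R' = {x' : x ∈ R}`, for a set `R` of hyperbolic fixed points inside `ℂ`. -/
def heckeConjSet (p : ℕ) (R : Set ℂ) : Set ℂ :=
  {w | ∃ x y : ℝ, (x : ℂ) ∈ R ∧ IsHeckeConj p x y ∧ w = (y : ℂ)}

/-- A set `R` is Hecke-symmetric if it consists of hyperbolic fixed points of `G_p` and
`R = R'`. (The first condition also follows from the second.) -/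
def HeckeSymmetric (p : ℕ) (R : Set ℂ) : Prop :=
  (∀ w ∈ R, ∃ x : ℝ, IsHyperbolicPoint p x ∧ w = (x : ℂ)) ∧ R = heckeConjSet p R

/-! ### Binary quadratic forms -/

/-- A binary quadratic form `[A, B, C]`, i.e. `A x² + B x y + C y²`, with real coefficients. -/
@[ext]
structure BQF where
  A : ℝ
  B : ℝ
  C : ℝ

namespace BQF

/-- `-Q`. -/
def neg (Q : BQF) : BQF := ⟨-Q.A, -Q.B, -Q.C⟩

/-- The discriminant. -/
def disc (Q : BQF) : ℝ := Q.B ^ 2 - 4 * Q.A * Q.C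

/-- `(Q ∘ M)(x, y) = Q(a x + b y, c x + d y)`. -/
def act (Q : BQF) (M : SL(2, ℝ)) : BQF :=
  ⟨Q.A * M 0 0 ^ 2 + Q.B * M 0 0 * M 1 0 + Q.C * M 1 0 ^ 2,
   2 * Q.A * M 0 0 * M 0 1 + Q.B * (M 0 0 * M 1 1 + M 0 1 * M 1 0) + 2 * Q.C * M 1 0 * M 1 1,
   Q.A * M 0 1 ^ 2 + Q.B * M 0 1 * M 1 1 + Q.C * M 1 1 ^ 2⟩

/-- The rational function `Q(z, 1)`. -/
def toRatFunc (Q : BQF) : RatFunc ℂ :=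
  RatFunc.C (Q.A : ℂ) * RatFunc.X ^ 2 + RatFunc.C (Q.B : ℂ) * RatFunc.X + RatFunc.C (Q.C : ℂ)

/-- The form `[c, d - a, -b]`, whose roots are the fixed points of `M = (a b; c d)`. -/
def ofMatrix (M : SL(2, ℝ)) : BQF := ⟨M 1 0, M 1 1 - M 0 0, -M 0 1⟩

/-- An indefinite form with coefficients in `ℤ[λ_p]`. -/
def IsLambda (p : ℕ) (Q : BQF) : Prop :=
  Q.A ∈ Algebra.adjoin ℤ {heckeLambda p} ∧ Q.B ∈ Algebra.adjoin ℤ {heckeLambda p} ∧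
    Q.C ∈ Algebra.adjoin ℤ {heckeLambda p} ∧ 0 < Q.disc

end BQF

/-- `M` is primitive in `G_p`: in `G_p = heckeGroup p / ±I` it is not a proper power. -/
def IsPrimitiveElt (p : ℕ) (M : SL(2, ℝ)) : Prop :=
  ∀ N ∈ heckeGroup p, ∀ n : ℕ, 2 ≤ n → M ≠ N ^ n ∧ M ≠ -N ^ n

/-- `M = M_α`: the primitive hyperbolic element of `G_p` with positive trace that has `α` as
attracting fixed point. -/
def IsGeneratorAt (p : ℕ) (α : ℝ) (M : SL(2, ℝ)) : Prop :=
  M ∈ heckeGroup p ∧ 2 < slTrace M ∧ IsPrimitiveElt p M ∧ IsAttracting M α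

open Classical in
/-- `M_α`, for a hyperbolic fixed point `α` (the identity for all other `α`). -/
def hyperbolicElt (p : ℕ) (α : ℝ) : SL(2, ℝ) :=
  if h : ∃ M, IsGeneratorAt p α M then h.choose else 1

/-- The form `Q_α` attached to a hyperbolic fixed point `α`. -/
def hyperbolicForm (p : ℕ) (α : ℝ) : BQF := BQF.ofMatrix (hyperbolicElt p α)

/-- A `G_p`-equivalence class of indefinite forms with coefficients in `ℤ[λ_p]`. -/
def IsFormClass (p : ℕ) (𝒜 : Set BQF) : Prop :=
  ∃ Q : BQF, Q.IsLambda p ∧ 𝒜 = {R | ∃ M ∈ heckeGroup p, R = Q.act M}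

/-- A hyperbolic class: one that contains the form of a hyperbolic fixed point. -/
def IsHyperbolicClass (p : ℕ) (𝒜 : Set BQF) : Prop :=
  IsFormClass p 𝒜 ∧ ∃ α : ℝ, IsHyperbolicPoint p α ∧ hyperbolicForm p α ∈ 𝒜

/-- `-𝒜 = {-Q : Q ∈ 𝒜}`. -/
def negClass (𝒜 : Set BQF) : Set BQF := BQF.neg '' 𝒜

/-- `Z_𝒜`: the hyperbolic fixed points `x` for which `Q_x = [A, B, C]` lies in `𝒜` and is simple,
i.e. `A > 0 > C`. -/
def simpleNumbers (p : ℕ) (𝒜 : Set BQF) : Set ℝ :=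
  {x | IsHyperbolicPoint p x ∧ hyperbolicForm p x ∈ 𝒜 ∧
    0 < (hyperbolicForm p x).A ∧ (hyperbolicForm p x).C < 0}

/-- The irreducible system of poles `P_𝒜 = Z_𝒜 ∪ T Z_𝒜` (with `T x = -1 / x`). -/
def poleSystem (p : ℕ) (𝒜 : Set BQF) : Set ℂ :=
  {w | ∃ x ∈ simpleNumbers p 𝒜, w = (x : ℂ) ∨ w = ((-1 / x : ℝ) : ℂ)}

/-! ### Rational period functions -/

/-- The weight `2k` slash operator `(q ∣ M)(z) = (c z + d)^(-2k) q((a z + b) / (c z + d))`. -/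
def slash (k : ℕ) (q : RatFunc ℂ) (M : SL(2, ℝ)) : RatFunc ℂ :=
  let num : RatFunc ℂ := RatFunc.C ((M 0 0 : ℝ) : ℂ) * RatFunc.X + RatFunc.C ((M 0 1 : ℝ) : ℂ)
  let den : RatFunc ℂ := RatFunc.C ((M 1 0 : ℝ) : ℂ) * RatFunc.X + RatFunc.C ((M 1 1 : ℝ) : ℂ)
  (den ^ (2 * k))⁻¹ * RatFunc.eval RatFunc.C (num / den) q

/-- A rational period function of weight `2k` for `G_p`. -/
def IsRPF (p k : ℕ) (q : RatFunc ℂ) : Prop :=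
  q + slash k q heckeT = 0 ∧ ∑ t ∈ Finset.range p, slash k q (heckeU p ^ t) = 0

/-- The nonzero (finite) poles of a rational function. -/
def nonzeroPoles (q : RatFunc ℂ) : Set ℂ := {w | w ≠ 0 ∧ q.denom.IsRoot w}

/-- `P` is one of the (nonzero) irreducible systems of poles of `q`. -/
def IsISPOf (p : ℕ) (q : RatFunc ℂ) (P : Set ℂ) : Prop :=
  ∃ 𝒜, IsHyperbolicClass p 𝒜 ∧ P = poleSystem p 𝒜 ∧ P ⊆ nonzeroPoles q

/-- `r` is one of the functions `q_{k,0}`: `a₀ (1 - z^(-2k))`, plus a term `b₁ z⁻¹` if `2k = 2`. -/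
def IsZeroPoleRPF (k : ℕ) (r : RatFunc ℂ) : Prop :=
  ∃ a₀ b₁ : ℂ, r = RatFunc.C a₀ * (1 - (RatFunc.X ^ (2 * k))⁻¹) +
    if k = 1 then RatFunc.C b₁ * RatFunc.X⁻¹ else 0

/-- `∑_{α ∈ Z_𝒜} Q_α(z, 1)^(-k)`. -/
def classSum (p k : ℕ) (𝒜 : Set BQF) : RatFunc ℂ :=
  ∑ᶠ α ∈ simpleNumbers p 𝒜, ((hyperbolicForm p α).toRatFunc ^ k)⁻¹

/-- `q = ∑_ℓ d_ℓ ∑_{α ∈ Z_{𝒜_ℓ}} Q_α(z, 1)^(-k) + c₀ q_{k,0}` with `-𝒜_ℓ = 𝒜_ℓ` for all `ℓ`. -/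
def HasSymmetricForm (p k : ℕ) (q : RatFunc ℂ) : Prop :=
  ∃ (L : ℕ) (d : Fin L → ℂ) (𝒜 : Fin L → Set BQF) (c₀ : ℂ) (r : RatFunc ℂ),
    (∀ l, IsHyperbolicClass p (𝒜 l) ∧ negClass (𝒜 l) = 𝒜 l) ∧ IsZeroPoleRPF k r ∧
      q = ∑ l, RatFunc.C (d l) * classSum p k (𝒜 l) + RatFunc.C c₀ * r

end

noncomputable section

open scoped MatrixGroups

/-! ### Matrices in `SL(2, ℝ)` and Möbius transformations -/

namespace SLTwo

/-! The engine is a coding of hyperbolic points by words in the letters V_t = U^t T⁻¹, 1 ≤ t < p.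
These matrices have nonnegative entries, map the right half plane (with imaginary axis, without 0)
into itself with pairwise disjoint images, and their images of [0, ∞) cover [0, ∞). Hence a word can
be read off from its values (`wordProd_prefix`), and every element of the group is, up to sign,
P₁P₂⁻¹ or TP₁P₂⁻¹ for words P₁, P₂ adapted to a given x ≥ 0 (`wordForm_of_mem`). It follows that
stabilizers of hyperbolic points are cyclic modulo ±I, so M_α is well defined; that the points with
A > 0 > C, equivalently α > 0 > α', are exactly the positive points fixed by a nonempty word; and
that Z_𝒜 is a single cycle of such points under rotation of the word, hence finite
(`simpleNumbers_finite`).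

For an RPF the two relations combine into q = ∑ q|V_t over 1 ≤ t < p (`IsRPF.eq_sum_heckeV`). A pole
w in the right half plane must come from a pole V_t w; disjointness of the images and finiteness of
the pole set turn this into a permutation of the poles, so w is fixed by a word W with q - q|W
regular at w (`IsRPF.exists_word_fixing_pole`). Thus w is a simple point, the poles contain the
whole system P_𝒜 of its class, and comparing leading coefficients under the hyperbolic W shows that
the polar part is a multiple of that of Q_w^(-k) (`polar_part_of_invariant`).

The involution x ↦ Tx' exchanges Z_𝒜 and Z_{-𝒜}, because Q_x ∘ T = -Q_{Tx'}. So a Hecke-symmetric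
P_𝒜 forces -𝒜 = 𝒜. For odd k the same sign makes ∑ Q_x^(-k) an RPF whenever the index set is closed
under the involution and under one step of the coding (`isRPF_formSum`). Subtracting multiples of
such sums removes poles until only 0 can be one, and there a local computation leaves q_{k,0}
(`IsRPF.isZeroPoleRPF`).

For the last claim take p = 3 and the class of √3. It is not its own negative because m² - 3n² = -1
has no integer solution, while Z_𝒜 ∪ Z_{-𝒜} is closed under the involution. -/

lemma mul_zero_zero (M N : SL(2, ℝ)) : (M * N) 0 0 = M 0 0 * N 0 0 + M 0 1 * N 1 0 := by
  simp [Matrix.mul_apply, Fin.sum_univ_two]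
lemma mul_zero_one (M N : SL(2, ℝ)) : (M * N) 0 1 = M 0 0 * N 0 1 + M 0 1 * N 1 1 := by
  simp [Matrix.mul_apply, Fin.sum_univ_two]
lemma mul_one_zero (M N : SL(2, ℝ)) : (M * N) 1 0 = M 1 0 * N 0 0 + M 1 1 * N 1 0 := by
  simp [Matrix.mul_apply, Fin.sum_univ_two]
lemma mul_one_one (M N : SL(2, ℝ)) : (M * N) 1 1 = M 1 0 * N 0 1 + M 1 1 * N 1 1 := by
  simp [Matrix.mul_apply, Fin.sum_univ_two]
lemma inv_zero_zero (M : SL(2, ℝ)) : M⁻¹ 0 0 = M 1 1 := by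
  rw [Matrix.SpecialLinearGroup.SL2_inv_expl]; rfl
lemma inv_zero_one (M : SL(2, ℝ)) : M⁻¹ 0 1 = -M 0 1 := by
  rw [Matrix.SpecialLinearGroup.SL2_inv_expl]; rfl
lemma inv_one_zero (M : SL(2, ℝ)) : M⁻¹ 1 0 = -M 1 0 := by
  rw [Matrix.SpecialLinearGroup.SL2_inv_expl]; rfl
lemma inv_one_one (M : SL(2, ℝ)) : M⁻¹ 1 1 = M 0 0 := by
  rw [Matrix.SpecialLinearGroup.SL2_inv_expl]; rfl
lemma neg_entry (M : SL(2, ℝ)) (i j : Fin 2) : (-M) i j = -(M i j) := by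
  simp
lemma one_entries : (1 : SL(2, ℝ)) 0 0 = 1 ∧ (1 : SL(2, ℝ)) 0 1 = 0 ∧
    (1 : SL(2, ℝ)) 1 0 = 0 ∧ (1 : SL(2, ℝ)) 1 1 = 1 := by
  simp
lemma det_eq (M : SL(2, ℝ)) : M 0 0 * M 1 1 - M 0 1 * M 1 0 = 1 := by
  have := M.det_coe
  rwa [Matrix.det_fin_two] at this
lemma ext_entries {M N : SL(2, ℝ)} (h00 : M 0 0 = N 0 0) (h01 : M 0 1 = N 0 1)
    (h10 : M 1 0 = N 1 0) (h11 : M 1 1 = N 1 1) : M = N := by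
  ext i j
  fin_cases i <;> fin_cases j <;> assumption

end SLTwo

open SLTwo

lemma heckeT_entries : heckeT 0 0 = 0 ∧ heckeT 0 1 = -1 ∧ heckeT 1 0 = 1 ∧ heckeT 1 1 = 0 := by
  simp [heckeT]

lemma heckeS_entries (p : ℕ) : heckeS p 0 0 = 1 ∧ heckeS p 0 1 = heckeLambda p ∧
    heckeS p 1 0 = 0 ∧ heckeS p 1 1 = 1 := by
  simp [heckeS]

lemma heckeT_mul_self : heckeT * heckeT = -1 := by
  obtain ⟨a, b, c, d⟩ := heckeT_entries
  obtain ⟨e, f, g, h⟩ := one_entries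
  apply ext_entries <;>
    simp only [mul_zero_zero, mul_zero_one, mul_one_zero, mul_one_one, neg_entry, a, b, c, d,
      e, f, g, h] <;> norm_num

lemma heckeT_inv : heckeT⁻¹ = -heckeT := by
  rw [inv_eq_iff_mul_eq_one, mul_neg, heckeT_mul_self, neg_neg]

/-- Equality in `SL(2, ℝ) / ±I`. -/
def SignEq (M N : SL(2, ℝ)) : Prop := M = N ∨ M = -N

namespace SignEq

variable {M N P M' N' : SL(2, ℝ)}

lemma refl (M : SL(2, ℝ)) : SignEq M M := Or.inl rfl

lemma neg_self (M : SL(2, ℝ)) : SignEq (-M) M := Or.inr rfl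

lemma symm (h : SignEq M N) : SignEq N M := by
  rcases h with h | h
  · exact Or.inl h.symm
  · exact Or.inr (by rw [h, neg_neg])

lemma trans (h : SignEq M N) (h' : SignEq N P) : SignEq M P := by
  rcases h with rfl | rfl <;> rcases h' with rfl | rfl
  · exact Or.inl rfl
  · exact Or.inr rfl
  · exact Or.inr rfl
  · exact Or.inl (neg_neg _)

lemma mul (h : SignEq M N) (h' : SignEq M' N') : SignEq (M * M') (N * N') := by
  rcases h with rfl | rfl <;> rcases h' with rfl | rfl
  · exact Or.inl rfl
  · exact Or.inr (by simp)
  · exact Or.inr (by simp)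
  · exact Or.inl (by simp)

end SignEq

/-! ### Möbius transformations over an extension field of ℝ, used over ℝ for the dynamics and over ℂ
for the poles. -/

section Moebius

variable {K : Type*} [Field K] [Algebra ℝ K]

/-- The numerator `a x + b` of the Möbius transformation of `M` at `x`. -/
def mobNum (M : SL(2, ℝ)) (x : K) : K := algebraMap ℝ K (M 0 0) * x + algebraMap ℝ K (M 0 1)

/-- The denominator `c x + d` of the Möbius transformation of `M` at `x`. -/
def mobDen (M : SL(2, ℝ)) (x : K) : K := algebraMap ℝ K (M 1 0) * x + algebraMap ℝ K (M 1 1)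

/-- The Möbius transformation of `M` at `x`. -/
def mob (M : SL(2, ℝ)) (x : K) : K := mobNum M x / mobDen M x

lemma algebraMap_det (M : SL(2, ℝ)) :
    algebraMap ℝ K (M 0 0) * algebraMap ℝ K (M 1 1) -
      algebraMap ℝ K (M 0 1) * algebraMap ℝ K (M 1 0) = 1 := by
  rw [← map_mul, ← map_mul, ← map_sub, det_eq, map_one]

/-- The cocycle relation of the automorphy factor. -/
lemma mobDen_mul (M N : SL(2, ℝ)) {x : K} (h : mobDen N x ≠ 0) :
    mobDen (M * N) x = mobDen M (mob N x) * mobDen N x := by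
  simp only [mob, mobDen, mobNum, mul_one_zero, mul_one_one, map_add, map_mul] at h ⊢
  field_simp
  ring

lemma mobNum_mul (M N : SL(2, ℝ)) {x : K} (h : mobDen N x ≠ 0) :
    mobNum (M * N) x = mobNum M (mob N x) * mobDen N x := by
  simp only [mob, mobDen, mobNum, mul_zero_zero, mul_zero_one, map_add, map_mul] at h ⊢
  field_simp
  ring

lemma mob_mul (M N : SL(2, ℝ)) {x : K} (h : mobDen N x ≠ 0) :
    mob (M * N) x = mob M (mob N x) := by
  rw [mob, mobDen_mul M N h, mobNum_mul M N h, mul_div_mul_right _ _ h]; rfl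

@[simp] lemma mobDen_one (x : K) : mobDen 1 x = 1 := by simp [mobDen]
@[simp] lemma mobNum_one (x : K) : mobNum 1 x = x := by simp [mobNum]
@[simp] lemma mob_one (x : K) : mob 1 x = x := by simp [mob]
lemma mobDen_neg (M : SL(2, ℝ)) (x : K) : mobDen (-M) x = -mobDen M x := by
  simp only [mobDen, neg_entry, map_neg]; ring
lemma mobNum_neg (M : SL(2, ℝ)) (x : K) : mobNum (-M) x = -mobNum M x := by
  simp only [mobNum, neg_entry, map_neg]; ring
@[simp] lemma mob_neg (M : SL(2, ℝ)) (x : K) : mob (-M) x = mob M x := by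
  simp [mob, mobDen_neg, mobNum_neg, neg_div_neg_eq]

lemma SignEq.mob_eq {M N : SL(2, ℝ)} (h : SignEq M N) (x : K) : mob M x = mob N x := by
  rcases h with rfl | rfl <;> simp

lemma mobDen_inv_mob (M : SL(2, ℝ)) {x : K} (h : mobDen M x ≠ 0) :
    mobDen M⁻¹ (mob M x) * mobDen M x = 1 := by
  rw [← mobDen_mul _ _ h, inv_mul_cancel, mobDen_one]

lemma mobDen_inv_mob_ne (M : SL(2, ℝ)) {x : K} (h : mobDen M x ≠ 0) :
    mobDen M⁻¹ (mob M x) ≠ 0 :=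
  left_ne_zero_of_mul_eq_one (mobDen_inv_mob M h)

lemma mob_inv_mob (M : SL(2, ℝ)) {x : K} (h : mobDen M x ≠ 0) : mob M⁻¹ (mob M x) = x := by
  rw [← mob_mul _ _ h, inv_mul_cancel, mob_one]

lemma mob_injective (M : SL(2, ℝ)) {x y : K} (hx : mobDen M x ≠ 0) (hy : mobDen M y ≠ 0)
    (h : mob M x = mob M y) : x = y := by
  rw [← mob_inv_mob M hx, h, mob_inv_mob M hy]

lemma mob_heckeT (x : K) : mob heckeT x = -1 / x := by
  obtain ⟨a, b, c, d⟩ := heckeT_entries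
  simp [mob, mobDen, mobNum, a, b, c, d]

lemma mobDen_heckeT (x : K) : mobDen heckeT x = x := by
  obtain ⟨a, b, c, d⟩ := heckeT_entries
  simp [mobDen, c, d]

end Moebius

/-! ### Fixed points, conjugation and traces. -/

lemma mobDen_ofReal (M : SL(2, ℝ)) (x : ℝ) : mobDen M (x : ℂ) = ((mobDen M x : ℝ) : ℂ) := by
  simp [mobDen]

lemma mob_ofReal (M : SL(2, ℝ)) (x : ℝ) : mob M (x : ℂ) = ((mob M x : ℝ) : ℂ) := by
  simp [mob, mobNum, mobDen]

lemma mobDen_real (M : SL(2, ℝ)) (x : ℝ) : mobDen M x = M 1 0 * x + M 1 1 := rfl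
lemma mobNum_real (M : SL(2, ℝ)) (x : ℝ) : mobNum M x = M 0 0 * x + M 0 1 := rfl

/-- If cx + d = 0, the fixed point equation also gives ax + b = 0, and the determinant vanishes. So
the division-free `Fixes` describes genuine Möbius fixed points. -/
lemma Fixes.mobDen_ne {M : SL(2, ℝ)} {x : ℝ} (h : Fixes M x) : mobDen M x ≠ 0 := by
  intro h0
  rw [mobDen_real] at h0
  rw [Fixes, h0] at h
  have := det_eq M
  have h1 : M 1 1 = -M 1 0 * x := by linarith
  have h2 : M 0 1 = -M 0 0 * x := by linarith
  rw [h1, h2] at this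
  exact zero_ne_one (by linear_combination this)

lemma Fixes.mob_eq {M : SL(2, ℝ)} {x : ℝ} (h : Fixes M x) : mob M x = x := by
  rw [mob, div_eq_iff h.mobDen_ne, mobNum_real, mobDen_real]; exact h

lemma fixes_of_mob_eq {M : SL(2, ℝ)} {x : ℝ} (hd : mobDen M x ≠ 0) (h : mob M x = x) :
    Fixes M x := by
  rwa [mob, div_eq_iff hd, mobNum_real, mobDen_real] at h

/-- The stabilizer of a real number in `SL(2, ℝ)`. -/
def fixer (x : ℝ) : Subgroup SL(2, ℝ) where
  carrier := {M | Fixes M x}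
  one_mem' := by simp [Fixes]
  mul_mem' {M N} hM hN := by
    refine fixes_of_mob_eq ?_ ?_
    · rw [mobDen_mul _ _ (Fixes.mobDen_ne hN), Fixes.mob_eq hN]
      exact mul_ne_zero (Fixes.mobDen_ne hM) (Fixes.mobDen_ne hN)
    · rw [mob_mul _ _ (Fixes.mobDen_ne hN), Fixes.mob_eq hN, Fixes.mob_eq hM]
  inv_mem' {M} hM := by
    have h := mobDen_inv_mob_ne M (Fixes.mobDen_ne hM)
    have h' := mob_inv_mob M (Fixes.mobDen_ne hM)
    rw [Fixes.mob_eq hM] at h h'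
    exact fixes_of_mob_eq h h'

lemma SignEq.fixes {M N : SL(2, ℝ)} {x : ℝ} (h : SignEq M N) (hN : Fixes N x) : Fixes M x := by
  rcases h with rfl | rfl
  · exact hN
  · simp only [Fixes, neg_entry] at hN ⊢
    linear_combination -hN

lemma Fixes.conj {M N : SL(2, ℝ)} {x : ℝ} (h : Fixes M x) (hN : mobDen N x ≠ 0) :
    Fixes (N * M * N⁻¹) (mob N x) := by
  have h1 := mobDen_inv_mob_ne N hN
  have h2 := mob_inv_mob N hN
  have h3 : mobDen (N * M) x ≠ 0 := by
    rw [mobDen_mul _ _ h.mobDen_ne, h.mob_eq]; exact mul_ne_zero hN h.mobDen_ne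
  refine fixes_of_mob_eq ?_ ?_
  · rw [mobDen_mul _ _ h1, h2]; exact mul_ne_zero h3 h1
  · rw [mob_mul _ _ h1, h2, mob_mul _ _ h.mobDen_ne, h.mob_eq]

lemma slTrace_conj (M N : SL(2, ℝ)) : slTrace (N * M * N⁻¹) = slTrace M := by
  simp only [slTrace, mul_zero_zero, mul_zero_one, mul_one_zero, mul_one_one, inv_zero_zero,
    inv_zero_one, inv_one_zero, inv_one_one]
  linear_combination (M 0 0 + M 1 1) * det_eq N

lemma slTrace_neg (M : SL(2, ℝ)) : slTrace (-M) = -slTrace M := by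
  simp only [slTrace, neg_entry]; ring

lemma SignEq.abs_slTrace {M N : SL(2, ℝ)} (h : SignEq M N) : |slTrace M| = |slTrace N| := by
  rcases h with rfl | rfl
  · rfl
  · rw [slTrace_neg, abs_neg]

lemma slTrace_inv (M : SL(2, ℝ)) : slTrace M⁻¹ = slTrace M := by
  simp only [slTrace, inv_zero_zero, inv_one_one]; ring

end

noncomputable section

open scoped MatrixGroups

open SLTwo

/-! ### Powers of `U` and the positive words of the Hecke group -/

/-- `sin (t π / p) / sin (π / p)`. -/
def sinRatio (p : ℕ) (t : ℝ) : ℝ := Real.sin (t * (Real.pi / p)) / Real.sin (Real.pi / p)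

section

variable {p : ℕ}

lemma sin_pi_div_pos (hp : 3 ≤ p) : 0 < Real.sin (Real.pi / p) := by
  have hp' : (3 : ℝ) ≤ p := by exact_mod_cast hp
  refine Real.sin_pos_of_pos_of_lt_pi (by positivity) ?_
  rw [div_lt_iff₀ (by linarith)]
  nlinarith [Real.pi_pos]

lemma heckeLambda_pos (hp : 3 ≤ p) : 0 < heckeLambda p := by
  have hp' : (3 : ℝ) ≤ p := by exact_mod_cast hp
  refine mul_pos two_pos (Real.cos_pos_of_mem_Ioo ⟨?_, ?_⟩)
  · have : 0 < Real.pi / p := by positivity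
    linarith [Real.pi_pos]
  · rw [div_lt_div_iff₀ (by linarith) two_pos]
    nlinarith [Real.pi_pos]

lemma sinRatio_pos (hp : 3 ≤ p) {t : ℝ} (h0 : 0 < t) (h1 : t < p) : 0 < sinRatio p t := by
  have hp' : (3 : ℝ) ≤ p := by exact_mod_cast hp
  refine div_pos (Real.sin_pos_of_pos_of_lt_pi (by positivity) ?_) (sin_pi_div_pos hp)
  rw [← mul_div_assoc, div_lt_iff₀ (by linarith)]
  nlinarith [Real.pi_pos]

@[simp] lemma sinRatio_zero : sinRatio p 0 = 0 := by simp [sinRatio]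

lemma sinRatio_one (hp : 3 ≤ p) : sinRatio p 1 = 1 := by
  simp [sinRatio, (sin_pi_div_pos hp).ne']

lemma sinRatio_self (hp : 3 ≤ p) : sinRatio p p = 0 := by
  have : (p : ℝ) ≠ 0 := by positivity
  simp [sinRatio, mul_div_cancel₀, this]

lemma sinRatio_sub_one (hp : 3 ≤ p) : sinRatio p (p - 1) = 1 := by
  have : (p : ℝ) ≠ 0 := by positivity
  rw [sinRatio, sub_mul, mul_div_cancel₀ _ this, one_mul, Real.sin_pi_sub,
    div_self (sin_pi_div_pos hp).ne']

lemma sinRatio_neg_one (hp : 3 ≤ p) : sinRatio p (-1) = -1 := by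
  rw [sinRatio, neg_one_mul, Real.sin_neg, neg_div, div_self (sin_pi_div_pos hp).ne']

/-- The Chebyshev recurrence, which matches multiplication by U. -/
lemma sinRatio_add_one (t : ℝ) :
    sinRatio p (t + 1) = heckeLambda p * sinRatio p t - sinRatio p (t - 1) := by
  simp only [sinRatio, heckeLambda, add_mul, sub_mul, one_mul, Real.sin_add, Real.sin_sub]
  ring

lemma sinRatio_nonneg (hp : 3 ≤ p) {t : ℝ} (h0 : 0 ≤ t) (h1 : t ≤ p) : 0 ≤ sinRatio p t := by
  rcases h0.eq_or_lt with rfl | h0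
  · simp
  rcases h1.eq_or_lt with rfl | h1
  · rw [sinRatio_self hp]
  exact (sinRatio_pos hp h0 h1).le

lemma heckeU_entries (p : ℕ) : heckeU p 0 0 = heckeLambda p ∧ heckeU p 0 1 = -1 ∧
    heckeU p 1 0 = 1 ∧ heckeU p 1 1 = 0 := by
  obtain ⟨a, b, c, d⟩ := heckeT_entries
  obtain ⟨e, f, g, h⟩ := heckeS_entries p
  simp only [heckeU, mul_zero_zero, mul_zero_one, mul_one_zero, mul_one_one, a, b, c, d, e, f, g, h]
  norm_num

/-- The argument t - 1 is real, not truncated: at t = 0 the value `sinRatio p (-1) = -1` produces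
the lower right entry 1. -/
lemma heckeU_pow_entries (hp : 3 ≤ p) (t : ℕ) :
    (heckeU p ^ t) 0 0 = sinRatio p (t + 1) ∧ (heckeU p ^ t) 0 1 = -sinRatio p t ∧
    (heckeU p ^ t) 1 0 = sinRatio p t ∧ (heckeU p ^ t) 1 1 = -sinRatio p (t - 1) := by
  obtain ⟨e, f, g, h⟩ := heckeU_entries p
  induction t with
  | zero =>
    simp [sinRatio_one hp, sinRatio_neg_one hp]
  | succ t ih =>
    obtain ⟨i, j, k, l⟩ := ih
    have h1 := sinRatio_add_one (p := p) t
    have h2 := sinRatio_add_one (p := p) (t + 1)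
    rw [add_sub_cancel_right] at h2
    rw [pow_succ]
    simp only [mul_zero_zero, mul_zero_one, mul_one_zero, mul_one_one, e, f, g, h, i, j, k, l]
    push_cast
    rw [h2, add_sub_cancel_right]
    refine ⟨by ring, by ring, by rw [h1]; ring, by ring⟩

lemma heckeU_pow_self (hp : 3 ≤ p) : heckeU p ^ p = -1 := by
  obtain ⟨a, b, c, d⟩ := heckeU_pow_entries hp p
  have h := sinRatio_add_one (p := p) p
  rw [sinRatio_self hp, sinRatio_sub_one hp] at h
  rw [sinRatio_self hp] at b c
  rw [sinRatio_sub_one hp] at d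
  apply ext_entries <;> rw [neg_entry] <;> simp [*]

/-- `V_t = U^t T⁻¹`. -/
def heckeV (p t : ℕ) : SL(2, ℝ) := heckeU p ^ t * heckeT⁻¹

lemma heckeV_entries (hp : 3 ≤ p) (t : ℕ) :
    heckeV p t 0 0 = sinRatio p t ∧ heckeV p t 0 1 = sinRatio p (t + 1) ∧
    heckeV p t 1 0 = sinRatio p (t - 1) ∧ heckeV p t 1 1 = sinRatio p t := by
  obtain ⟨a, b, c, d⟩ := heckeU_pow_entries hp t
  obtain ⟨e, f, g, h⟩ := heckeT_entries
  simp only [heckeV, mul_zero_zero, mul_zero_one, mul_one_zero, mul_one_one, inv_zero_zero,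
    inv_zero_one, inv_one_zero, inv_one_one, a, b, c, d, e, f, g, h]
  norm_num

lemma heckeU_pow_mul_heckeV (p t j : ℕ) : heckeU p ^ t * heckeV p j = heckeV p (t + j) := by
  rw [heckeV, heckeV, pow_add, mul_assoc]

/-- The product `V_{t₁} ⋯ V_{tₙ}`. -/
def wordProd (p : ℕ) (l : List ℕ) : SL(2, ℝ) := (l.map (heckeV p)).prod

@[simp] lemma wordProd_nil : wordProd p [] = 1 := rfl

@[simp] lemma wordProd_cons (t : ℕ) (l : List ℕ) :
    wordProd p (t :: l) = heckeV p t * wordProd p l := by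
  simp [wordProd]

lemma wordProd_append (l l' : List ℕ) :
    wordProd p (l ++ l') = wordProd p l * wordProd p l' := by
  simp [wordProd]

/-- The letters of the word are between `1` and `p - 1`. -/
def Admissible (p : ℕ) (l : List ℕ) : Prop := ∀ t ∈ l, 1 ≤ t ∧ t < p

lemma admissible_nil : Admissible p [] := by simp [Admissible]

lemma admissible_cons {t : ℕ} {l : List ℕ} :
    Admissible p (t :: l) ↔ (1 ≤ t ∧ t < p) ∧ Admissible p l := by
  simp [Admissible]

lemma admissible_append {l l' : List ℕ} :
    Admissible p (l ++ l') ↔ Admissible p l ∧ Admissible p l' := by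
  simp only [Admissible, List.mem_append, or_imp, forall_and]
  tauto

lemma heckeT_mem : heckeT ∈ heckeGroup p := Subgroup.subset_closure (by simp)

lemma heckeS_mem : heckeS p ∈ heckeGroup p := Subgroup.subset_closure (by simp)

lemma heckeU_mem : heckeU p ∈ heckeGroup p := mul_mem heckeS_mem heckeT_mem

lemma heckeV_mem (t : ℕ) : heckeV p t ∈ heckeGroup p :=
  mul_mem (pow_mem heckeU_mem _) (inv_mem heckeT_mem)

lemma wordProd_mem (l : List ℕ) : wordProd p l ∈ heckeGroup p := by
  induction l with
  | nil => exact one_mem _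
  | cons t l ih => rw [wordProd_cons]; exact mul_mem (heckeV_mem t) ih

/-- The only letters with a zero entry are V_1, upper triangular, and V_{p-1}, lower triangular.
They are distinct because p ≥ 3. -/
lemma heckeV_entry_bounds (hp : 3 ≤ p) {t : ℕ} (ht : 1 ≤ t ∧ t < p) :
    0 < sinRatio p t ∧ 0 ≤ sinRatio p (t + 1) ∧ 0 ≤ sinRatio p (t - 1) ∧
      (0 < sinRatio p (t + 1) ∨ t + 1 = p) ∧ (0 < sinRatio p (t - 1) ∨ t = 1) := by
  have h1 : (1 : ℝ) ≤ t := by exact_mod_cast ht.1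
  have h2 : (t : ℝ) + 1 ≤ p := by exact_mod_cast ht.2
  refine ⟨sinRatio_pos hp (by linarith) (by linarith),
    sinRatio_nonneg hp (by linarith) (by linarith),
    sinRatio_nonneg hp (by linarith) (by linarith), ?_, ?_⟩
  · rcases h2.eq_or_lt with h | h
    · exact Or.inr (by exact_mod_cast h)
    · exact Or.inl (sinRatio_pos hp (by linarith) h)
  · rcases h1.eq_or_lt with h | h
    · exact Or.inr (by exact_mod_cast h.symm)
    · exact Or.inl (sinRatio_pos hp (by linarith) (by linarith))

lemma sinRatio_det (hp : 3 ≤ p) (t : ℕ) :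
    sinRatio p t * sinRatio p t - sinRatio p (t + 1) * sinRatio p (t - 1) = 1 := by
  obtain ⟨a, b, c, d⟩ := heckeV_entries hp t
  have := det_eq (heckeV p t)
  rwa [a, b, c, d] at this

lemma wordProd_entries (hp : 3 ≤ p) {l : List ℕ} (hl : Admissible p l) :
    0 < wordProd p l 0 0 ∧ 0 < wordProd p l 1 1 ∧ 0 ≤ wordProd p l 0 1 ∧
      0 ≤ wordProd p l 1 0 := by
  induction l with
  | nil => simp
  | cons t l ih =>
    rw [admissible_cons] at hl
    obtain ⟨h1, h2, h3, h4⟩ := ih hl.2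
    obtain ⟨a, b, c, d⟩ := heckeV_entries hp t
    obtain ⟨e, f, g, -⟩ := heckeV_entry_bounds hp hl.1
    rw [wordProd_cons]
    simp only [mul_zero_zero, mul_zero_one, mul_one_zero, mul_one_one, a, b, c, d]
    refine ⟨?_, ?_, ?_, ?_⟩ <;> positivity

/-- Only a power of the parabolic letter V_1 = S can have lower left entry 0; any other letter makes
that entry positive, and it stays positive. -/
lemma wordProd_lower (hp : 3 ≤ p) {l : List ℕ} (hl : Admissible p l) (hne : l ≠ []) :
    0 < wordProd p l 1 0 ∨
      (wordProd p l 0 0 = 1 ∧ wordProd p l 1 1 = 1 ∧ wordProd p l 1 0 = 0 ∧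
        0 < wordProd p l 0 1) := by
  induction l with
  | nil => exact absurd rfl hne
  | cons t l ih =>
    rw [admissible_cons] at hl
    obtain ⟨h1, h2, h3, h4⟩ := wordProd_entries hp hl.2
    obtain ⟨a, b, c, d⟩ := heckeV_entries hp t
    obtain ⟨e, f, g, -, h⟩ := heckeV_entry_bounds hp hl.1
    rw [wordProd_cons]
    simp only [mul_zero_zero, mul_zero_one, mul_one_zero, mul_one_one, a, b, c, d]
    rcases h with h | rfl
    · left; positivity
    have s2 := sinRatio_add_one (p := p) 1
    simp only [Nat.cast_one, sub_self, sinRatio_zero, sinRatio_one hp] at s2 ⊢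
    rw [s2]
    have hlam := heckeLambda_pos hp
    rcases eq_or_ne l [] with rfl | hl'
    · right; simpa using hlam
    · rcases ih hl.2 hl' with h | ⟨h5, h6, h7, h8⟩
      · left; linarith
      · right; rw [h5, h6, h7]; refine ⟨by ring, by ring, by ring, by linarith⟩

/-- The mirror image of `wordProd_lower`, with V_{p-1} as the exceptional letter. -/
lemma wordProd_upper (hp : 3 ≤ p) {l : List ℕ} (hl : Admissible p l) (hne : l ≠ []) :
    0 < wordProd p l 0 1 ∨
      (wordProd p l 0 0 = 1 ∧ wordProd p l 1 1 = 1 ∧ wordProd p l 0 1 = 0 ∧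
        0 < wordProd p l 1 0) := by
  induction l with
  | nil => exact absurd rfl hne
  | cons t l ih =>
    rw [admissible_cons] at hl
    obtain ⟨h1, h2, h3, h4⟩ := wordProd_entries hp hl.2
    obtain ⟨a, b, c, d⟩ := heckeV_entries hp t
    obtain ⟨e, f, g, h, -⟩ := heckeV_entry_bounds hp hl.1
    rw [wordProd_cons]
    simp only [mul_zero_zero, mul_zero_one, mul_one_zero, mul_one_one, a, b, c, d]
    rcases h with h | h
    · left; positivity
    have ht : (t : ℝ) = p - 1 := by rw [← h]; push_cast; ring
    have s2 := sinRatio_add_one (p := p) (p - 1)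
    simp only [ht, sub_add_cancel, sinRatio_self hp, sinRatio_sub_one hp] at s2 ⊢
    have s3 : sinRatio p (p - 1 - 1) = heckeLambda p := by linarith
    rw [s3]
    have hlam := heckeLambda_pos hp
    rcases eq_or_ne l [] with rfl | hl'
    · right; simpa using hlam
    · rcases ih hl.2 hl' with h | ⟨h5, h6, h7, h8⟩
      · left; linarith
      · right; rw [h5, h6, h7]; refine ⟨by ring, by ring, by ring, by linarith⟩

/-! ### Action on the closed right half plane -/

/-- The closed right half plane without `0`. -/
def RightHalf (x : ℂ) : Prop := 0 ≤ x.re ∧ x ≠ 0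

lemma rightHalf_ofReal {x : ℝ} : RightHalf (x : ℂ) ↔ 0 < x := by
  simp only [RightHalf, Complex.ofReal_re, ne_eq, Complex.ofReal_eq_zero]
  rw [lt_iff_le_and_ne, ne_comm]

lemma mobDen_wordProd_ne (hp : 3 ≤ p) {l : List ℕ} (hl : Admissible p l) {x : ℂ}
    (hx : 0 ≤ x.re) : mobDen (wordProd p l) x ≠ 0 := by
  obtain ⟨h1, h2, h3, h4⟩ := wordProd_entries hp hl
  intro h
  have := congrArg Complex.re h
  simp [mobDen] at this
  have := mul_nonneg h4 hx
  linarith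

lemma wordProd_singleton (t : ℕ) : wordProd p [t] = heckeV p t := by simp

lemma admissible_singleton {t : ℕ} : Admissible p [t] ↔ 1 ≤ t ∧ t < p := by simp [Admissible]

lemma mobDen_heckeV_ne (hp : 3 ≤ p) {t : ℕ} (ht : 1 ≤ t ∧ t < p) {x : ℂ}
    (hx : 0 ≤ x.re) : mobDen (heckeV p t) x ≠ 0 := by
  rw [← wordProd_singleton]; exact mobDen_wordProd_ne hp (admissible_singleton.mpr ht) hx

lemma mob_heckeV_re_pos (hp : 3 ≤ p) {t : ℕ} (ht : 1 ≤ t ∧ t < p) {x : ℂ} (hx : RightHalf x) :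
    0 < (mob (heckeV p t) x).re := by
  have hd := mobDen_heckeV_ne hp ht hx.1
  obtain ⟨a, b, c, d⟩ := heckeV_entries hp t
  obtain ⟨e, f, g, h1, h2⟩ := heckeV_entry_bounds hp ht
  have hn : 0 < x.re * x.re + x.im * x.im := Complex.normSq_pos.mpr hx.2
  have hr := hx.1
  rw [mob, Complex.div_re, ← add_div]
  refine div_pos ?_ (Complex.normSq_pos.mpr hd)
  simp only [mobNum, mobDen, a, b, c, d, Complex.coe_algebraMap, Complex.add_re, Complex.add_im,
    Complex.mul_re, Complex.mul_im, Complex.ofReal_re, Complex.ofReal_im, zero_mul, sub_zero,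
    add_zero]
  -- With V_t = (a b; c d), Re(V_t x) |cx + d|² = ac|x|² + bd + (ad + bc) Re x. The first two terms
  -- must already be positive, since Re x may be 0; b and c vanish together only if t = 1 = p - 1.
  have key : 0 < sinRatio p t * sinRatio p (t - 1) * (x.re * x.re + x.im * x.im) +
      sinRatio p t * sinRatio p (t + 1) := by
    rcases h1 with h1 | h1
    · positivity
    rcases h2 with h2 | h2
    · positivity
    omega
  have k2 : 0 ≤ sinRatio p t * sinRatio p t * x.re +
      sinRatio p (t + 1) * sinRatio p (t - 1) * x.re := by positivity
  nlinarith

lemma RightHalf.mob_heckeV (hp : 3 ≤ p) {t : ℕ} (ht : 1 ≤ t ∧ t < p) {x : ℂ}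
    (hx : RightHalf x) : RightHalf (mob (heckeV p t) x) := by
  have := mob_heckeV_re_pos hp ht hx
  refine ⟨this.le, ?_⟩
  rintro h
  simp [h] at this

lemma mob_heckeT_inv {K : Type*} [Field K] [Algebra ℝ K] (x : K) : mob heckeT⁻¹ x = -1 / x := by
  rw [heckeT_inv, mob_neg, mob_heckeT]

lemma mobDen_heckeT_inv {K : Type*} [Field K] [Algebra ℝ K] (x : K) :
    mobDen heckeT⁻¹ x = -x := by
  rw [heckeT_inv, mobDen_neg, mobDen_heckeT]

/-- Cancelling U^s from V_s x = V_t y leaves T⁻¹x = V_{t-s} y. The left side has real part at most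
0, the right side has positive real part. -/
lemma mob_heckeV_ne_of_lt (hp : 3 ≤ p) {s t : ℕ} (hs : 1 ≤ s ∧ s < p)
    (hst : s < t) (ht : t < p) {x y : ℂ} (hx : RightHalf x) (hy : RightHalf y) :
    mob (heckeV p s) x ≠ mob (heckeV p t) y := by
  intro h
  obtain ⟨j, rfl⟩ := Nat.exists_eq_add_of_lt hst
  have hj : 1 ≤ j + 1 ∧ j + 1 < p := by omega
  have hTx : mobDen heckeT⁻¹ x ≠ 0 := by rw [mobDen_heckeT_inv]; exact neg_ne_zero.mpr hx.2
  have hVy := mobDen_heckeV_ne hp hj hy.1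
  have hds : mobDen (heckeV p s) x ≠ 0 := mobDen_heckeV_ne hp hs hx.1
  have hdt : mobDen (heckeV p (s + j + 1)) y ≠ 0 :=
    mobDen_heckeV_ne hp ⟨by omega, ht⟩ hy.1
  rw [add_assoc, ← heckeU_pow_mul_heckeV] at h hdt
  rw [heckeV] at hds
  rw [mobDen_mul _ _ hTx] at hds
  rw [mobDen_mul _ _ hVy] at hdt
  rw [mob_mul _ _ hVy, heckeV, mob_mul _ _ hTx] at h
  have h' := mob_injective _ (left_ne_zero_of_mul hds) (left_ne_zero_of_mul hdt) h
  have := mob_heckeV_re_pos hp hj hy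
  rw [← h', mob_heckeT_inv, Complex.div_re] at this
  simp [neg_div] at this
  have h2 : 0 ≤ x.re / Complex.normSq x := div_nonneg hx.1 (Complex.normSq_nonneg x)
  linarith

lemma heckeV_unique (hp : 3 ≤ p) {s t : ℕ} (hs : 1 ≤ s ∧ s < p) (ht : 1 ≤ t ∧ t < p)
    {x y : ℂ} (hx : RightHalf x) (hy : RightHalf y)
    (h : mob (heckeV p s) x = mob (heckeV p t) y) : s = t ∧ x = y := by
  rcases lt_trichotomy s t with hst | rfl | hst
  · exact absurd h (mob_heckeV_ne_of_lt hp hs hst ht.2 hx hy)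
  · exact ⟨rfl, mob_injective _ (mobDen_heckeV_ne hp hs hx.1) (mobDen_heckeV_ne hp ht hy.1) h⟩
  · exact absurd h.symm (mob_heckeV_ne_of_lt hp ht hst hs.2 hy hx)

/-- A triangular word fixes only 0 and ∞, so both off-diagonal entries are positive. The roots of
cx² + (d - a)x - b then have product -b/c < 0, whereas a nonreal conjugate pair has positive
product. -/
lemma fixed_wordProd_real (hp : 3 ≤ p) {l : List ℕ} (hl : Admissible p l) (hne : l ≠ [])
    {x : ℂ} (hx : RightHalf x) (h : mob (wordProd p l) x = x) :
    0 < wordProd p l 0 1 ∧ 0 < wordProd p l 1 0 ∧ ∃ r : ℝ, 0 < r ∧ x = r := by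
  have hd := mobDen_wordProd_ne hp hl hx.1
  rw [mob, div_eq_iff hd] at h
  simp only [mobNum, mobDen, Complex.coe_algebraMap] at h
  have hb : 0 < wordProd p l 0 1 := by
    rcases wordProd_upper hp hl hne with h1 | ⟨h1, h2, h3, h4⟩
    · exact h1
    · rw [h1, h2, h3] at h
      have : (wordProd p l 1 0 : ℂ) * (x * x) = 0 := by
        push_cast at h; linear_combination -h
      rw [mul_eq_zero, mul_self_eq_zero, Complex.ofReal_eq_zero] at this
      exact (this.elim h4.ne' hx.2).elim
  have hc : 0 < wordProd p l 1 0 := by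
    rcases wordProd_lower hp hl hne with h1 | ⟨h1, h2, h3, h4⟩
    · exact h1
    · rw [h1, h2, h3] at h
      have : (wordProd p l 0 1 : ℂ) = 0 := by
        push_cast at h; linear_combination h
      rw [Complex.ofReal_eq_zero] at this
      exact (h4.ne' this).elim
  refine ⟨hb, hc, ?_⟩
  have him : x.im = 0 := by
    by_contra him
    have h1 := congrArg Complex.im h
    have h2 := congrArg Complex.re h
    simp at h1 h2
    have h3 : x.im * (wordProd p l 0 0 - 2 * wordProd p l 1 0 * x.re - wordProd p l 1 1) = 0 := by
      linear_combination h1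
    have h4 := (mul_eq_zero.mp h3).resolve_left him
    have h5 : wordProd p l 0 1 + wordProd p l 1 0 * (x.re * x.re + x.im * x.im) = 0 := by
      linear_combination h2 - x.re * h4
    have : 0 ≤ wordProd p l 1 0 * (x.re * x.re + x.im * x.im) :=
      mul_nonneg hc.le (add_nonneg (mul_self_nonneg _) (mul_self_nonneg _))
    linarith
  have hxr : x = (x.re : ℂ) := by
    apply Complex.ext <;> simp [him]
  refine ⟨x.re, ?_, hxr⟩
  rw [hxr] at hx
  exact rightHalf_ofReal.mp hx

/-! ### Action on the real line -/

lemma mobDen_wordProd_pos (hp : 3 ≤ p) {l : List ℕ} (hl : Admissible p l) {x : ℝ}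
    (hx : 0 ≤ x) : 0 < mobDen (wordProd p l) x := by
  obtain ⟨h1, h2, h3, h4⟩ := wordProd_entries hp hl
  rw [mobDen_real]; positivity

lemma mob_wordProd_nonneg (hp : 3 ≤ p) {l : List ℕ} (hl : Admissible p l) {x : ℝ}
    (hx : 0 ≤ x) : 0 ≤ mob (wordProd p l) x := by
  obtain ⟨h1, h2, h3, h4⟩ := wordProd_entries hp hl
  refine div_nonneg ?_ (mobDen_wordProd_pos hp hl hx).le
  rw [mobNum_real]; positivity

lemma mob_wordProd_pos (hp : 3 ≤ p) {l : List ℕ} (hl : Admissible p l) {x : ℝ}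
    (hx : 0 < x) : 0 < mob (wordProd p l) x := by
  obtain ⟨h1, h2, h3, h4⟩ := wordProd_entries hp hl
  refine div_pos ?_ (mobDen_wordProd_pos hp hl hx.le)
  rw [mobNum_real]; positivity

lemma mob_wordProd_cons (hp : 3 ≤ p) {t : ℕ} {l : List ℕ} (hl : Admissible p l) {x : ℝ}
    (hx : 0 ≤ x) :
    mob (wordProd p (t :: l)) x = mob (heckeV p t) (mob (wordProd p l) x) := by
  rw [wordProd_cons, mob_mul _ _ (mobDen_wordProd_pos hp hl hx).ne']

lemma mob_wordProd_append (hp : 3 ≤ p) {l l' : List ℕ} (hl' : Admissible p l') {x : ℝ}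
    (hx : 0 ≤ x) :
    mob (wordProd p (l ++ l')) x = mob (wordProd p l) (mob (wordProd p l') x) := by
  rw [wordProd_append, mob_mul _ _ (mobDen_wordProd_pos hp hl' hx).ne']

lemma heckeV_unique_real (hp : 3 ≤ p) {s t : ℕ} (hs : 1 ≤ s ∧ s < p) (ht : 1 ≤ t ∧ t < p)
    {x y : ℝ} (hx : 0 < x) (hy : 0 < y)
    (h : mob (heckeV p s) x = mob (heckeV p t) y) : s = t ∧ x = y := by
  have := heckeV_unique hp hs ht (rightHalf_ofReal.mpr hx) (rightHalf_ofReal.mpr hy)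
    (by rw [mob_ofReal, mob_ofReal, h])
  exact ⟨this.1, by exact_mod_cast this.2⟩

/-- Words are determined by their values: of two words with equal values at positive numbers,
the shorter one is a prefix of the longer one. -/
lemma wordProd_prefix (hp : 3 ≤ p) {l l' : List ℕ} (hl : Admissible p l)
    (hl' : Admissible p l') {x y : ℝ} (hx : 0 < x) (hy : 0 < y)
    (h : mob (wordProd p l) x = mob (wordProd p l') y) (hlen : l.length ≤ l'.length) :
    ∃ r, Admissible p r ∧ l' = l ++ r ∧ x = mob (wordProd p r) y := by
  induction l generalizing l' with
  | nil => exact ⟨l', hl', rfl, by simpa using h⟩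
  | cons t l ih =>
    cases l' with
    | nil => simp at hlen
    | cons s l' =>
      rw [admissible_cons] at hl hl'
      rw [mob_wordProd_cons hp hl.2 hx.le, mob_wordProd_cons hp hl'.2 hy.le] at h
      obtain ⟨rfl, h'⟩ := heckeV_unique_real hp hl.1 hl'.1 (mob_wordProd_pos hp hl.2 hx)
        (mob_wordProd_pos hp hl'.2 hy) h
      obtain ⟨r, hr, rfl, hxy⟩ := ih hl.2 hl'.2 h' (by simpa using hlen)
      exact ⟨r, hr, rfl, hxy⟩

/-- The intervals `V_t [0, ∞)` cover `[0, ∞)`. -/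
lemma exists_heckeV_preimage (hp : 3 ≤ p) {x : ℝ} (hx : 0 ≤ x) :
    ∃ t, (1 ≤ t ∧ t < p) ∧ ∃ z : ℝ, 0 ≤ z ∧ x = mob (heckeV p t) z := by
  classical
  -- The condition says V_t 0 ≤ x. Take the least such t: minimality gives x < V_t ∞, so V_t⁻¹ x is
  -- nonnegative and finite. The index p - 1 always qualifies because V_{p-1} 0 = 0.
  have hex : ∃ t : ℕ, 1 ≤ t ∧ 0 ≤ sinRatio p t * x - sinRatio p (t + 1) := by
    refine ⟨p - 1, by omega, ?_⟩
    rw [Nat.cast_sub (by omega), Nat.cast_one, sub_add_cancel, sinRatio_self hp,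
      sinRatio_sub_one hp]
    linarith
  have hlt : Nat.find hex < p := by
    refine lt_of_le_of_lt (Nat.find_min' hex (m := p - 1) ⟨by omega, ?_⟩) (by omega)
    rw [Nat.cast_sub (by omega), Nat.cast_one, sub_add_cancel, sinRatio_self hp,
      sinRatio_sub_one hp]
    linarith
  obtain ⟨h1, h2⟩ := Nat.find_spec hex
  have h3 : sinRatio p (Nat.find hex - 1) * x - sinRatio p (Nat.find hex) < 0 := by
    rcases h1.eq_or_lt with h | h
    · rw [← h]
      simp [sinRatio_one hp]
    · have := Nat.find_min hex (m := Nat.find hex - 1) (by omega)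
      rw [not_and, not_le, Nat.cast_sub h1, Nat.cast_one, sub_add_cancel] at this
      exact this (by omega)
  generalize Nat.find hex = t at *
  refine ⟨t, ⟨h1, hlt⟩, (sinRatio p t * x - sinRatio p (t + 1)) /
    (sinRatio p t - sinRatio p (t - 1) * x), div_nonneg h2 (by linarith), ?_⟩
  obtain ⟨a, b, c, d⟩ := heckeV_entries hp t
  have h4 : sinRatio p t - sinRatio p (t - 1) * x ≠ 0 := by linarith
  have hdet := sinRatio_det hp t
  have e1 : sinRatio p (t - 1) * (sinRatio p t * x - sinRatio p (t + 1)) +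
      sinRatio p t * (sinRatio p t - sinRatio p (t - 1) * x) = 1 := by
    linear_combination hdet
  have e2 : sinRatio p t * (sinRatio p t * x - sinRatio p (t + 1)) +
      sinRatio p (t + 1) * (sinRatio p t - sinRatio p (t - 1) * x) = x := by
    linear_combination x * hdet
  rw [mob, mobNum_real, mobDen_real, a, b, c, d, mul_div_assoc', mul_div_assoc',
    div_add' _ _ _ h4, div_add' _ _ _ h4, e1, e2, div_div_div_cancel_right₀ h4, div_one]

/-- V_t⁻¹ = (d -b; -c a) with a, d > 0 and b, c ≥ 0, so at x < 0 the denominator is positive and the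
numerator negative. This is the backward dynamics, needed for conjugates. -/
lemma mob_heckeV_inv_neg (hp : 3 ≤ p) {t : ℕ} (ht : 1 ≤ t ∧ t < p) {x : ℝ} (hx : x < 0) :
    mobDen (heckeV p t)⁻¹ x ≠ 0 ∧ mob (heckeV p t)⁻¹ x < 0 := by
  obtain ⟨a, b, c, d⟩ := heckeV_entries hp t
  obtain ⟨e, f, g, -⟩ := heckeV_entry_bounds hp ht
  have h1 : 0 < mobDen (heckeV p t)⁻¹ x := by
    rw [mobDen_real, inv_one_zero, inv_one_one, a, c]
    nlinarith
  refine ⟨h1.ne', div_neg_of_neg_of_pos ?_ h1⟩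
  rw [mobNum_real, inv_zero_zero, inv_zero_one, b, d]
  nlinarith

lemma mob_wordProd_inv_neg (hp : 3 ≤ p) {l : List ℕ} (hl : Admissible p l) {x : ℝ}
    (hx : x < 0) : mobDen (wordProd p l)⁻¹ x ≠ 0 ∧ mob (wordProd p l)⁻¹ x < 0 := by
  induction l generalizing x with
  | nil => simpa using hx
  | cons t l ih =>
    rw [admissible_cons] at hl
    obtain ⟨h1, h2⟩ := mob_heckeV_inv_neg hp hl.1 hx
    obtain ⟨h3, h4⟩ := ih hl.2 h2
    rw [wordProd_cons, mul_inv_rev, mobDen_mul _ _ h1, mob_mul _ _ h1]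
    exact ⟨mul_ne_zero h3 h1, h4⟩

/-- From V_t = V_{t-s} T V_s: if V_s x is negative, T makes it positive and V_{t-s} keeps it so. -/
lemma heckeV_neg_not_lt (hp : 3 ≤ p) {s t : ℕ} (hst : s < t) (ht : t < p) {x : ℝ}
    (h : mob (heckeV p s) x < 0) (h' : mob (heckeV p t) x < 0) : False := by
  obtain ⟨j, rfl⟩ := Nat.exists_eq_add_of_lt hst
  have hj : 1 ≤ j + 1 ∧ j + 1 < p := by omega
  have hd : mobDen (heckeV p s) x ≠ 0 := by
    intro h0; simp [mob, h0] at h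
  have hT : mobDen heckeT (mob (heckeV p s) x) ≠ 0 := by rw [mobDen_heckeT]; exact h.ne
  have hpos : 0 < mob heckeT (mob (heckeV p s) x) := by
    rw [mob_heckeT]; exact div_pos_of_neg_of_neg (by norm_num) h
  have heq : heckeV p (s + j + 1) = heckeV p (j + 1) * heckeT * heckeV p s := by
    rw [heckeV, heckeV, heckeV, mul_assoc _ _ heckeT, inv_mul_cancel, mul_one, ← mul_assoc,
      ← pow_add]
    congr 2; omega
  have hp2 := mob_wordProd_pos hp (admissible_singleton.mpr hj) hpos
  rw [wordProd_singleton, ← mob_mul _ _ hT, ← mob_mul _ _ hd, ← heq] at hp2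
  exact lt_asymm hp2 h'

lemma heckeV_unique_neg (hp : 3 ≤ p) {s t : ℕ} (hs : s < p) (ht : t < p) {x : ℝ}
    (h : mob (heckeV p s) x < 0) (h' : mob (heckeV p t) x < 0) : s = t := by
  rcases lt_trichotomy s t with hst | hst | hst
  · exact (heckeV_neg_not_lt hp hst ht h h').elim
  · exact hst
  · exact (heckeV_neg_not_lt hp hst hs h' h).elim

end

end

noncomputable section

open scoped MatrixGroups

open SLTwo

section

variable {p : ℕ}

/-! ### Elements of the Hecke group in terms of words -/

/-- `M = ± P₁ P₂⁻¹` or `M = ± T P₁ P₂⁻¹` with words `P₁`, `P₂` such that `P₂⁻¹ x` is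
nonnegative. -/
def WordForm (p : ℕ) (x : ℝ) (M : SL(2, ℝ)) : Prop :=
  ∃ l₁ l₂ : List ℕ, ∃ z : ℝ, Admissible p l₁ ∧ Admissible p l₂ ∧ 0 ≤ z ∧
    x = mob (wordProd p l₂) z ∧
    (SignEq M (wordProd p l₁ * (wordProd p l₂)⁻¹) ∨
      SignEq M (heckeT * (wordProd p l₁ * (wordProd p l₂)⁻¹)))

namespace WordForm

lemma one {x : ℝ} (hx : 0 ≤ x) : WordForm p x 1 :=
  ⟨[], [], x, admissible_nil, admissible_nil, hx, by simp, Or.inl (by simpa using .refl 1)⟩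

lemma of_signEq {x : ℝ} {M N : SL(2, ℝ)} (h : WordForm p x M) (hN : SignEq N M) :
    WordForm p x N := by
  obtain ⟨l₁, l₂, z, h₁, h₂, hz, hx, h | h⟩ := h
  · exact ⟨l₁, l₂, z, h₁, h₂, hz, hx, Or.inl (hN.trans h)⟩
  · exact ⟨l₁, l₂, z, h₁, h₂, hz, hx, Or.inr (hN.trans h)⟩

lemma heckeT_mul {x : ℝ} {M : SL(2, ℝ)} (h : WordForm p x M) : WordForm p x (heckeT * M) := by
  obtain ⟨l₁, l₂, z, h₁, h₂, hz, hx, h | h⟩ := h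
  · exact ⟨l₁, l₂, z, h₁, h₂, hz, hx, Or.inr ((SignEq.refl _).mul h)⟩
  · refine ⟨l₁, l₂, z, h₁, h₂, hz, hx, Or.inl (((SignEq.refl _).mul h).trans ?_)⟩
    rw [← mul_assoc, heckeT_mul_self, neg_one_mul]
    exact SignEq.neg_self _

/-- U V_t = V_{t+1} raises the first letter. At the end of the alphabet V_p = U^p T⁻¹ = T, and the
first shape of a `WordForm` becomes the second. -/
lemma heckeU_mul_of_cons (hp : 3 ≤ p) {x z : ℝ} {M : SL(2, ℝ)} {t : ℕ} {l₁ l₂ : List ℕ}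
    (h₁ : Admissible p (t :: l₁)) (h₂ : Admissible p l₂) (hz : 0 ≤ z)
    (hx : x = mob (wordProd p l₂) z)
    (h : SignEq M (wordProd p (t :: l₁) * (wordProd p l₂)⁻¹)) :
    WordForm p x (heckeU p * M) := by
  rw [admissible_cons] at h₁
  have e : heckeU p * (wordProd p (t :: l₁) * (wordProd p l₂)⁻¹) =
      heckeV p (1 + t) * (wordProd p l₁ * (wordProd p l₂)⁻¹) := by
    rw [← heckeU_pow_mul_heckeV, wordProd_cons, pow_one]; simp only [mul_assoc]
  have h' := (SignEq.refl (heckeU p)).mul h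
  rw [e] at h'
  by_cases ht : 1 + t < p
  · refine ⟨(1 + t) :: l₁, l₂, z, admissible_cons.mpr ⟨⟨by omega, ht⟩, h₁.2⟩, h₂, hz, hx,
      Or.inl ?_⟩
    rw [wordProd_cons, mul_assoc]; exact h'
  · have ht' : 1 + t = p := by omega
    refine ⟨l₁, l₂, z, h₁.2, h₂, hz, hx, Or.inr ?_⟩
    rwa [ht', heckeV, heckeU_pow_self hp, heckeT_inv, neg_mul_neg, one_mul] at h'

lemma heckeU_mul (hp : 3 ≤ p) {x : ℝ} {M : SL(2, ℝ)} (h : WordForm p x M) :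
    WordForm p x (heckeU p * M) := by
  obtain ⟨l₁, l₂, z, h₁, h₂, hz, hx, h | h⟩ := h
  · cases l₁ with
    | cons t l₁ => exact heckeU_mul_of_cons hp h₁ h₂ hz hx h
    | nil =>
      -- With no first letter to raise, one is created: if z = V_t y, then P₂⁻¹ = V_t (P₂V_t)⁻¹.
      -- This is where the point x steers the choice of words.
      obtain ⟨t, ht, y, hy, rfl⟩ := exists_heckeV_preimage hp hz
      have hsing := admissible_singleton.mpr ht
      refine heckeU_mul_of_cons hp (l₁ := []) (l₂ := l₂ ++ [t]) (z := y) hsing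
        (admissible_append.mpr ⟨h₂, hsing⟩) hy ?_ ?_
      · rw [mob_wordProd_append hp hsing hy, wordProd_singleton, hx]
      · rw [wordProd_append, mul_inv_rev, mul_inv_cancel_left]
        simpa using h
  · refine ⟨1 :: l₁, l₂, z, admissible_cons.mpr ⟨⟨le_rfl, by omega⟩, h₁⟩, h₂, hz, hx,
      Or.inl (((SignEq.refl _).mul h).trans ?_)⟩
    rw [wordProd_cons, heckeV, heckeT_inv, pow_one, mul_neg, neg_mul, neg_mul]
    simp only [mul_assoc]
    exact (SignEq.neg_self _).symm

end WordForm

/-- Up to sign, S and its inverse are UT and TU^(p-1), so closure under left multiplication by T and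
U is enough. -/
lemma wordForm_of_mem (hp : 3 ≤ p) {x : ℝ} (hx : 0 ≤ x) {M : SL(2, ℝ)}
    (hM : M ∈ heckeGroup p) : WordForm p x M := by
  have hpow : ∀ (n : ℕ) (N : SL(2, ℝ)), WordForm p x N → WordForm p x (heckeU p ^ n * N) := by
    intro n
    induction n with
    | zero => intro N h; simpa using h
    | succ n ih => intro N h; rw [pow_succ, mul_assoc]; exact ih _ (h.heckeU_mul hp)
  have hUinv : (heckeU p)⁻¹ = -heckeU p ^ (p - 1) := by
    rw [inv_eq_iff_mul_eq_one, mul_neg, ← pow_succ', Nat.sub_add_cancel (by omega),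
      heckeU_pow_self hp, neg_neg]
  have hS : heckeS p = -(heckeU p * heckeT) := by
    rw [heckeU, mul_assoc, heckeT_mul_self, mul_neg_one, neg_neg]
  have hSinv : (heckeS p)⁻¹ = -(heckeT * heckeU p ^ (p - 1)) := by
    rw [hS, inv_neg, mul_inv_rev, hUinv, heckeT_inv]; simp
  induction hM using Subgroup.closure_induction_left with
  | one => exact WordForm.one hx
  | mul_left A hA B hB ih =>
    rcases hA with rfl | rfl
    · refine (ih.heckeT_mul.heckeU_mul hp).of_signEq ?_
      rw [hS, neg_mul, mul_assoc]; exact SignEq.neg_self _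
    · exact ih.heckeT_mul
  | inv_mul_cancel A hA B hB ih =>
    rcases hA with rfl | rfl
    · refine (hpow (p - 1) _ ih).heckeT_mul.of_signEq ?_
      rw [hSinv, neg_mul, mul_assoc]; exact SignEq.neg_self _
    · refine ih.heckeT_mul.of_signEq ?_
      rw [heckeT_inv, neg_mul]; exact SignEq.neg_self _

/-! ### Hyperbolic elements and hyperbolic points -/

/-- The point 0 is a cusp. In the word form at x = 0, P₂ sends a nonnegative number to 0, so P₂ is
lower unitriangular. The upper right entry of P₁P₂⁻¹ is then that of P₁, so P₁ is unitriangular too;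
that of TP₁P₂⁻¹ cannot vanish. -/
lemma abs_slTrace_of_upper_eq_zero (hp : 3 ≤ p) {M : SL(2, ℝ)} (hM : M ∈ heckeGroup p)
    (h0 : M 0 1 = 0) : |slTrace M| = 2 := by
  have hword : ∀ l : List ℕ, Admissible p l → wordProd p l 0 1 = 0 →
      wordProd p l 0 0 = 1 ∧ wordProd p l 1 1 = 1 := by
    intro l hl h
    rcases eq_or_ne l [] with rfl | hne
    · simp
    rcases wordProd_upper hp hl hne with h' | ⟨h1, h2, -⟩
    · exact absurd h h'.ne'
    · exact ⟨h1, h2⟩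
  obtain ⟨l₁, l₂, z, h₁, h₂, hz, hx, h⟩ := wordForm_of_mem hp le_rfl hM
  have hb₂ : wordProd p l₂ 0 1 = 0 := by
    obtain ⟨e1, e2, e3, e4⟩ := wordProd_entries hp h₂
    rw [mob, eq_comm, div_eq_zero_iff,
      or_iff_left (mobDen_wordProd_pos hp h₂ hz).ne', mobNum_real] at hx
    have := mul_nonneg e1.le hz
    linarith
  obtain ⟨ha₂, hd₂⟩ := hword l₂ h₂ hb₂
  obtain ⟨e1, e2, e3, e4⟩ := wordProd_entries hp h₁
  obtain ⟨a, b, c, d⟩ := heckeT_entries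
  rcases h with h | h
  · rw [h.abs_slTrace]
    have h01 : (wordProd p l₁ * (wordProd p l₂)⁻¹) 0 1 = 0 := by
      rcases h with h | h
      · rw [← h, h0]
      · rw [h, neg_entry] at h0; linarith
    rw [mul_zero_one, inv_zero_one, inv_one_one, hb₂, ha₂] at h01
    obtain ⟨ha₁, hd₁⟩ := hword l₁ h₁ (by linarith)
    have hb₁ : wordProd p l₁ 0 1 = 0 := by linarith
    rw [slTrace, mul_zero_zero, mul_one_one, inv_zero_zero, inv_zero_one, inv_one_zero,
      inv_one_one, ha₁, hd₁, ha₂, hd₂, hb₁, hb₂]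
    norm_num
  · have h01 : (heckeT * (wordProd p l₁ * (wordProd p l₂)⁻¹)) 0 1 = 0 := by
      rcases h with h | h
      · rw [← h, h0]
      · rw [h, neg_entry] at h0; linarith
    rw [mul_zero_one, mul_zero_one, mul_one_one, inv_zero_one, inv_one_one, hb₂, ha₂, a, b] at h01
    linarith

lemma upper_ne_zero (hp : 3 ≤ p) {M : SL(2, ℝ)} (hM : M ∈ heckeGroup p)
    (h : 2 < |slTrace M|) : M 0 1 ≠ 0 := fun h0 ↦
  h.ne' (abs_slTrace_of_upper_eq_zero hp hM h0)

lemma lower_ne_zero (hp : 3 ≤ p) {M : SL(2, ℝ)} (hM : M ∈ heckeGroup p)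
    (h : 2 < |slTrace M|) : M 1 0 ≠ 0 := by
  intro h0
  refine upper_ne_zero hp (mul_mem (mul_mem heckeT_mem hM) (inv_mem heckeT_mem))
    (by rwa [slTrace_conj]) ?_
  obtain ⟨a, b, c, d⟩ := heckeT_entries
  simp only [mul_zero_zero, mul_zero_one, inv_zero_one, inv_one_one, a, b, h0]
  ring

namespace IsHyperbolicPoint

/-- If N sent x to ∞, the conjugate NMN⁻¹ of a hyperbolic M fixing x would have lower left entry 0.
-/
lemma mobDen_ne (hp : 3 ≤ p) {x : ℝ} (hx : IsHyperbolicPoint p x) {N : SL(2, ℝ)}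
    (hN : N ∈ heckeGroup p) : mobDen N x ≠ 0 := by
  obtain ⟨M, hM, htr, hfix⟩ := hx
  intro h0
  refine lower_ne_zero hp (mul_mem (mul_mem hN hM) (inv_mem hN)) (by rwa [slTrace_conj]) ?_
  rw [mobDen_real] at h0
  rw [Fixes] at hfix
  simp only [mul_one_zero, mul_one_one, inv_zero_zero, inv_one_zero]
  have h1 : N 1 1 = -N 1 0 * x := by linarith
  rw [h1]
  linear_combination -N 1 0 ^ 2 * hfix

lemma mob (hp : 3 ≤ p) {x : ℝ} (hx : IsHyperbolicPoint p x) {N : SL(2, ℝ)}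
    (hN : N ∈ heckeGroup p) : IsHyperbolicPoint p (mob N x) := by
  have hd := hx.mobDen_ne hp hN
  obtain ⟨M, hM, htr, hfix⟩ := hx
  exact ⟨_, mul_mem (mul_mem hN hM) (inv_mem hN), by rwa [slTrace_conj], hfix.conj hd⟩

lemma ne_zero (hp : 3 ≤ p) {x : ℝ} (hx : IsHyperbolicPoint p x) : x ≠ 0 := by
  rintro rfl
  obtain ⟨M, hM, htr, hfix⟩ := hx
  exact upper_ne_zero hp hM htr (by simpa [Fixes] using hfix)

end IsHyperbolicPoint

/-- A positive number fixed by a nonempty word. -/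
def IsPeriodic (p : ℕ) (x : ℝ) : Prop :=
  0 < x ∧ ∃ l, Admissible p l ∧ l ≠ [] ∧ mob (wordProd p l) x = x

lemma fixed_wordProd_entries (hp : 3 ≤ p) {l : List ℕ} (hl : Admissible p l) (hne : l ≠ [])
    {x : ℝ} (hx : 0 < x) (h : mob (wordProd p l) x = x) :
    0 < wordProd p l 0 1 ∧ 0 < wordProd p l 1 0 := by
  obtain ⟨h1, h2, -⟩ := fixed_wordProd_real hp hl hne (rightHalf_ofReal.mpr hx)
    (by rw [mob_ofReal, h])
  exact ⟨h1, h2⟩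

lemma two_lt_slTrace_wordProd (hp : 3 ≤ p) {l : List ℕ} (hl : Admissible p l) (hne : l ≠ [])
    {x : ℝ} (hx : 0 < x) (h : mob (wordProd p l) x = x) : 2 < slTrace (wordProd p l) := by
  obtain ⟨hb, hc⟩ := fixed_wordProd_entries hp hl hne hx h
  obtain ⟨ha, hd, -⟩ := wordProd_entries hp hl
  have hdet := det_eq (wordProd p l)
  have hbc := mul_pos hb hc
  rw [slTrace]
  nlinarith [sq_nonneg (wordProd p l 0 0 - wordProd p l 1 1)]

/-- Suppose cx + d ≤ 1. Then d < 1, and a ≥ 1 would give ax + b > x ≥ x(cx + d), against the fixed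
point equation; hence a < 1 as well, contradicting ad = 1 + bc > 1. -/
lemma isAttracting_wordProd (hp : 3 ≤ p) {l : List ℕ} (hl : Admissible p l) (hne : l ≠ [])
    {x : ℝ} (hx : 0 < x) (h : mob (wordProd p l) x = x) : IsAttracting (wordProd p l) x := by
  have hfix := fixes_of_mob_eq (mobDen_wordProd_pos hp hl hx.le).ne' h
  refine ⟨hfix, lt_of_lt_of_le ?_ (le_abs_self _)⟩
  obtain ⟨hb, hc⟩ := fixed_wordProd_entries hp hl hne hx h
  obtain ⟨ha, hd, -⟩ := wordProd_entries hp hl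
  have hdet := det_eq (wordProd p l)
  have hbc := mul_pos hb hc
  by_contra! hle
  rw [Fixes] at hfix
  have hcx := mul_pos hc hx
  have hd1 : wordProd p l 1 1 < 1 := by linarith
  have ha1 : wordProd p l 0 0 < 1 := by
    by_contra! hge
    nlinarith
  nlinarith

lemma IsPeriodic.isHyperbolicPoint (hp : 3 ≤ p) {x : ℝ} (h : IsPeriodic p x) :
    IsHyperbolicPoint p x := by
  obtain ⟨hx, l, hl, hne, h⟩ := h
  exact ⟨_, wordProd_mem l, (two_lt_slTrace_wordProd hp hl hne hx h).trans_le (le_abs_self _),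
    (isAttracting_wordProd hp hl hne hx h).1⟩

/-- Every positive hyperbolic point is the image of a periodic point under a word. -/
lemma exists_periodic_of_pos (hp : 3 ≤ p) {x : ℝ} (hx : IsHyperbolicPoint p x) (h0 : 0 < x) :
    ∃ l z, Admissible p l ∧ IsPeriodic p z ∧ x = mob (wordProd p l) z := by
  have hx' := hx
  obtain ⟨M, hM, htr, hfix⟩ := hx
  obtain ⟨l₁, l₂, z, h₁, h₂, hz, rfl, h⟩ := wordForm_of_mem hp h0.le hM
  have hd₂ := (mobDen_wordProd_pos hp h₂ hz).ne'
  have hd₁ := (mobDen_wordProd_pos hp h₁ hz).ne'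
  have hzh : IsHyperbolicPoint p z := by
    have := hx'.mob hp (inv_mem (wordProd_mem l₂))
    rwa [mob_inv_mob _ hd₂] at this
  have hz : 0 < z := lt_of_le_of_ne hz (hzh.ne_zero hp).symm
  have hval : mob (wordProd p l₁ * (wordProd p l₂)⁻¹) (mob (wordProd p l₂) z) =
      mob (wordProd p l₁) z := by
    rw [mob_mul _ _ (mobDen_inv_mob_ne _ hd₂), mob_inv_mob _ hd₂]
  have hM1 := hfix.mob_eq
  refine ⟨l₂, z, h₂, ?_, rfl⟩
  -- Mx = x now reads P₁z = P₂z, so one word is a prefix of the other and the remaining letters fix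
  -- z. If none remained, M would be ±I. In the second shape Mx would be negative.
  rcases h with h | h
  · rw [h.mob_eq, hval] at hM1
    rcases le_total l₁.length l₂.length with hlen | hlen
    · obtain ⟨r, hr, rfl, hzr⟩ := wordProd_prefix hp h₁ h₂ hz hz hM1 hlen
      refine ⟨hz, r, hr, ?_, hzr.symm⟩
      rintro rfl
      rw [List.append_nil, mul_inv_cancel] at h
      rw [h.abs_slTrace] at htr
      norm_num [slTrace] at htr
    · obtain ⟨r, hr, rfl, hzr⟩ := wordProd_prefix hp h₂ h₁ hz hz hM1.symm hlen
      refine ⟨hz, r, hr, ?_, hzr.symm⟩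
      rintro rfl
      rw [List.append_nil, mul_inv_cancel] at h
      rw [h.abs_slTrace] at htr
      norm_num [slTrace] at htr
  · rw [h.mob_eq, mob_mul, hval, mob_heckeT] at hM1
    · have : -1 / mob (wordProd p l₁) z < 0 :=
        div_neg_of_neg_of_pos (by norm_num) (mob_wordProd_pos hp h₁ hz)
      linarith
    · exact hx'.mobDen_ne hp (mul_mem (wordProd_mem _) (inv_mem (wordProd_mem _)))

lemma neg_one_div_neg_one_div (x : ℝ) : -1 / (-1 / x) = x := by
  rw [neg_div, neg_div, one_div, one_div, inv_neg, inv_inv, neg_neg]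

lemma exists_periodic (hp : 3 ≤ p) {x : ℝ} (hx : IsHyperbolicPoint p x) :
    ∃ N ∈ heckeGroup p, ∃ z, IsPeriodic p z ∧ x = mob N z := by
  rcases lt_or_gt_of_ne (hx.ne_zero hp) with h | h
  · have hT := hx.mob hp heckeT_mem
    rw [mob_heckeT] at hT
    obtain ⟨l, z, hl, hz, hxz⟩ := exists_periodic_of_pos hp hT
      (div_pos_of_neg_of_neg (by norm_num) h)
    refine ⟨heckeT * wordProd p l, mul_mem heckeT_mem (wordProd_mem l), z, hz, ?_⟩
    rw [mob_mul _ _ (mobDen_wordProd_pos hp hl hz.1.le).ne', ← hxz, mob_heckeT,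
      neg_one_div_neg_one_div]
  · obtain ⟨l, z, hl, hz, hxz⟩ := exists_periodic_of_pos hp hx h
    exact ⟨_, wordProd_mem l, z, hz, hxz⟩

/-! ### Stabilizers -/

lemma wordProd_replicate (l : List ℕ) (n : ℕ) :
    wordProd p (List.replicate n l).flatten = wordProd p l ^ n := by
  induction n with
  | zero => simp
  | succ n ih => rw [List.replicate_succ, List.flatten_cons, wordProd_append, ih, pow_succ']

lemma admissible_replicate {l : List ℕ} (hl : Admissible p l) (n : ℕ) :
    Admissible p (List.replicate n l).flatten := by
  induction n with
  | zero => simpa using admissible_nil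
  | succ n ih =>
    rw [List.replicate_succ, List.flatten_cons]; exact admissible_append.mpr ⟨hl, ih⟩

lemma mob_pow_of_fixed {M : SL(2, ℝ)} {x : ℝ} (h : Fixes M x) (n : ℕ) :
    Fixes (M ^ n) x := (fixer x).pow_mem h n

/-- By unique readability every nonempty word fixing x begins with the shortest one, g. Removing
that prefix leaves a shorter word that again fixes x. -/
lemma exists_shortest_word (hp : 3 ≤ p) {x : ℝ} (h : IsPeriodic p x) :
    ∃ g, Admissible p g ∧ g ≠ [] ∧ mob (wordProd p g) x = x ∧
      ∀ l, Admissible p l → mob (wordProd p l) x = x →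
        ∃ n : ℕ, wordProd p l = wordProd p g ^ n := by
  classical
  obtain ⟨hx, hex⟩ := h
  have hex' : ∃ n : ℕ, ∃ l, Admissible p l ∧ l ≠ [] ∧ mob (wordProd p l) x = x ∧ l.length = n := by
    obtain ⟨l, h1, h2, h3⟩ := hex
    exact ⟨_, l, h1, h2, h3, rfl⟩
  obtain ⟨g, hg, hne, hfix, hlen⟩ := Nat.find_spec hex'
  refine ⟨g, hg, hne, hfix, fun l ↦ ?_⟩
  induction hn : l.length using Nat.strong_induction_on generalizing l with
  | _ n ih =>
    intro hl hlx
    rcases eq_or_ne l [] with rfl | hl0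
    · exact ⟨0, by simp⟩
    have hle : g.length ≤ l.length := by
      rw [hlen]; exact Nat.find_min' hex' ⟨l, hl, hl0, hlx, rfl⟩
    obtain ⟨r, hr, rfl, hxr⟩ := wordProd_prefix hp hg hl hx hx (hfix.trans hlx.symm) hle
    have hgl : 0 < g.length := List.length_pos_iff.mpr hne
    rw [List.length_append] at hn
    obtain ⟨n, hn⟩ := ih r.length (by omega) r rfl hr hxr.symm
    exact ⟨n + 1, by rw [wordProd_append, hn, pow_succ']⟩

/-- With M = ±P₁P₂⁻¹ one has P₁z = P₂z = x. Completing P₂ by a word r to a power of g makes P₁r fix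
x as well, so it is a power of g too, and M = ±(P₁r)(P₂r)⁻¹. -/
lemma stabilizer_of_periodic (hp : 3 ≤ p) {x : ℝ} (hx : 0 < x) {g : List ℕ}
    (hg : Admissible p g) (hne : g ≠ []) (hfix : mob (wordProd p g) x = x)
    (hgen : ∀ l, Admissible p l → mob (wordProd p l) x = x →
        ∃ n : ℕ, wordProd p l = wordProd p g ^ n)
    {M : SL(2, ℝ)} (hM : M ∈ heckeGroup p) (hMx : Fixes M x) :
    ∃ j : ℤ, SignEq M (wordProd p g ^ j) := by
  have hxh : IsHyperbolicPoint p x := IsPeriodic.isHyperbolicPoint hp ⟨hx, g, hg, hne, hfix⟩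
  have hgx : Fixes (wordProd p g) x := (isAttracting_wordProd hp hg hne hx hfix).1
  obtain ⟨l₁, l₂, z, h₁, h₂, hz, hxz, h⟩ := wordForm_of_mem hp hx.le hM
  have hd₂ := (mobDen_wordProd_pos hp h₂ hz).ne'
  have hd₁ := (mobDen_wordProd_pos hp h₁ hz).ne'
  have hzh : IsHyperbolicPoint p z := by
    have := hxh.mob hp (inv_mem (wordProd_mem l₂))
    rwa [hxz, mob_inv_mob _ hd₂] at this
  have hz : 0 < z := lt_of_le_of_ne hz (hzh.ne_zero hp).symm
  have hval : mob (wordProd p l₁ * (wordProd p l₂)⁻¹) x = mob (wordProd p l₁) z := by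
    rw [hxz, mob_mul _ _ (mobDen_inv_mob_ne _ hd₂), mob_inv_mob _ hd₂]
  have hM1 := hMx.mob_eq
  rcases h with h | h
  swap
  · rw [h.mob_eq, mob_mul, hval, mob_heckeT] at hM1
    · have : -1 / mob (wordProd p l₁) z < 0 :=
        div_neg_of_neg_of_pos (by norm_num) (mob_wordProd_pos hp h₁ hz)
      linarith
    · exact hxh.mobDen_ne hp (mul_mem (wordProd_mem _) (inv_mem (wordProd_mem _)))
  rw [h.mob_eq, hval] at hM1
  -- As g has at least one letter, |l₂| copies of it are at least as long as l₂.
  obtain ⟨r, hr, hrep, hzr⟩ : ∃ r, Admissible p r ∧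
      (List.replicate l₂.length g).flatten = l₂ ++ r ∧ z = mob (wordProd p r) x := by
    refine wordProd_prefix hp h₂ (admissible_replicate hg _) hz hx ?_ ?_
    · rw [← hxz, wordProd_replicate, (mob_pow_of_fixed hgx _).mob_eq]
    · have : 1 ≤ g.length := List.length_pos_iff.mpr hne
      simp only [List.length_flatten, List.map_replicate, List.sum_replicate, smul_eq_mul]
      exact Nat.le_mul_of_pos_right _ this
  obtain ⟨n, hn⟩ := hgen (l₁ ++ r) (admissible_append.mpr ⟨h₁, hr⟩) (by
    rw [mob_wordProd_append hp hr hx.le, ← hzr, hM1])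
  refine ⟨n - l₂.length, h.trans (Or.inl ?_)⟩
  have e2 : wordProd p l₂ * wordProd p r = wordProd p g ^ l₂.length := by
    rw [← wordProd_append, ← hrep, wordProd_replicate]
  rw [wordProd_append] at hn
  rw [zpow_sub, zpow_natCast, zpow_natCast, ← hn, ← e2]
  group

lemma mobDen_mul_of_fixes {M N : SL(2, ℝ)} {x : ℝ} (hN : Fixes N x) :
    mobDen (M * N) x = mobDen M x * mobDen N x := by
  rw [mobDen_mul _ _ hN.mobDen_ne, hN.mob_eq]

lemma mobDen_pow_of_fixes {M : SL(2, ℝ)} {x : ℝ} (hM : Fixes M x) (n : ℕ) :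
    mobDen (M ^ n) x = mobDen M x ^ n := by
  induction n with
  | zero => simp
  | succ n ih => rw [pow_succ, mobDen_mul_of_fixes hM, ih, pow_succ]

lemma mobDen_inv_of_fixes {M : SL(2, ℝ)} {x : ℝ} (hM : Fixes M x) :
    mobDen M⁻¹ x = (mobDen M x)⁻¹ := by
  have := mobDen_inv_mob M hM.mobDen_ne
  rw [hM.mob_eq] at this
  exact eq_inv_of_mul_eq_one_left this

lemma mobDen_zpow_of_fixes {M : SL(2, ℝ)} {x : ℝ} (hM : Fixes M x) (j : ℤ) :
    mobDen (M ^ j) x = mobDen M x ^ j := by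
  cases j with
  | ofNat n => simpa using mobDen_pow_of_fixes hM n
  | negSucc n =>
    rw [zpow_negSucc, mobDen_inv_of_fixes (mob_pow_of_fixed hM _), mobDen_pow_of_fixes hM,
      zpow_negSucc]

lemma SignEq.abs_mobDen {M N : SL(2, ℝ)} (h : SignEq M N) (x : ℝ) :
    |mobDen M x| = |mobDen N x| := by
  rcases h with rfl | rfl
  · rfl
  · rw [mobDen_neg, abs_neg]

lemma IsAttracting.one_lt {M : SL(2, ℝ)} {x : ℝ} (h : IsAttracting M x) : 1 < |mobDen M x| :=
  h.2

/-- Commuting makes the form of N proportional to that of M; c ≠ 0 allows this factor to be divided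
out. -/
lemma fixes_of_commute {M N : SL(2, ℝ)} {x : ℝ} (hM : Fixes M x) (hc : M 1 0 ≠ 0)
    (h : M * N = N * M) : Fixes N x := by
  have h00 := congrArg (fun A : SL(2, ℝ) ↦ A 0 0) h
  have h10 := congrArg (fun A : SL(2, ℝ) ↦ A 1 0) h
  simp only [mul_zero_zero, mul_one_zero] at h00 h10
  rw [Fixes] at hM ⊢
  apply mul_left_cancel₀ hc
  linear_combination N 1 0 * hM + x * h10 - h00

lemma eq_of_signEq_of_slTrace {M N : SL(2, ℝ)} (h : SignEq M N) (hM : 2 < slTrace M)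
    (hN : 2 < slTrace N) : M = N := by
  rcases h with h | h
  · exact h
  · rw [h, slTrace_neg] at hM
    linarith

/-- Primitivity of the shortest word g: if g = ±N^n, then N commutes with g, hence fixes x and
equals ±g^j. Since |cx + d| is multiplicative on the stabilizer and exceeds 1 at g, jn = 1. -/
lemma exists_generator_of_periodic (hp : 3 ≤ p) {x : ℝ} (h : IsPeriodic p x) :
    ∃ l, Admissible p l ∧ l ≠ [] ∧ IsGeneratorAt p x (wordProd p l) ∧
      ∀ N ∈ heckeGroup p, Fixes N x → ∃ j : ℤ, SignEq N (wordProd p l ^ j) := by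
  obtain ⟨g, hg, hne, hfix, hgen⟩ := exists_shortest_word hp h
  have hx := h.1
  have hatt := isAttracting_wordProd hp hg hne hx hfix
  have hstab : ∀ N ∈ heckeGroup p, Fixes N x → ∃ j : ℤ, SignEq N (wordProd p g ^ j) :=
    fun N hN hNx ↦ stabilizer_of_periodic hp hx hg hne hfix hgen hN hNx
  refine ⟨g, hg, hne, ⟨wordProd_mem g, two_lt_slTrace_wordProd hp hg hne hx hfix, ?_, hatt⟩,
    hstab⟩
  have key : ∀ N ∈ heckeGroup p, ∀ n : ℕ, 2 ≤ n → ¬ SignEq (wordProd p g) (N ^ n) := by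
    intro N hN n hn hs
    have hcomm : wordProd p g * N = N * wordProd p g := by
      rcases hs with hs | hs <;> rw [hs]
      · exact (Commute.refl N).pow_left n
      · rw [neg_mul, mul_neg, ((Commute.refl N).pow_left n).eq]
    obtain ⟨j, hj⟩ := hstab N hN
      (fixes_of_commute hatt.1 (fixed_wordProd_entries hp hg hne hx hfix).2.ne' hcomm)
    have hNx : Fixes N x := hj.fixes ((fixer x).zpow_mem hatt.1 j)
    have h1 := hs.abs_mobDen x
    rw [mobDen_pow_of_fixes hNx, abs_pow, hj.abs_mobDen, mobDen_zpow_of_fixes hatt.1,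
      abs_zpow, ← zpow_natCast, ← zpow_mul] at h1
    have h2 : (1 : ℤ) = j * n :=
      zpow_right_injective₀ (zero_lt_one.trans hatt.one_lt) hatt.one_lt.ne' (by simpa using h1)
    have h3 : (n : ℤ) ∣ 1 := ⟨j, by rw [h2, mul_comm]⟩
    have := Int.le_of_dvd one_pos h3
    omega
  exact fun N hN n hn ↦ ⟨fun h' ↦ key N hN n hn (Or.inl h'), fun h' ↦ key N hN n hn (Or.inr h')⟩

lemma IsGeneratorAt.isHyperbolicPoint {x : ℝ} {M : SL(2, ℝ)} (h : IsGeneratorAt p x M) :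
    IsHyperbolicPoint p x :=
  ⟨M, h.1, h.2.1.trans_le (le_abs_self _), h.2.2.2.1⟩

lemma IsGeneratorAt.conj (hp : 3 ≤ p) {x : ℝ} {M N : SL(2, ℝ)} (h : IsGeneratorAt p x M)
    (hN : N ∈ heckeGroup p) : IsGeneratorAt p (mob N x) (N * M * N⁻¹) := by
  have hd := h.isHyperbolicPoint.mobDen_ne hp hN
  obtain ⟨hM, htr, hprim, hfix, hatt⟩ := h
  refine ⟨mul_mem (mul_mem hN hM) (inv_mem hN), by rwa [slTrace_conj], ?_, hfix.conj hd, ?_⟩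
  · intro K hK n hn
    obtain ⟨h1, h2⟩ := hprim (N⁻¹ * K * N) (mul_mem (mul_mem (inv_mem hN) hK) hN) n hn
    have e : (N⁻¹ * K * N) ^ n = N⁻¹ * K ^ n * N := by
      have := conj_pow (i := n) (a := N⁻¹) (b := K)
      rwa [inv_inv] at this
    rw [e] at h1 h2
    constructor
    · intro h3; apply h1; rw [← h3]; group
    · intro h3; apply h2
      have h4 : M = N⁻¹ * (N * M * N⁻¹) * N := by group
      rw [h4, h3, mul_neg, neg_mul]
  · have h1 := mobDen_inv_mob N hd
    have h2 := mobDen_inv_mob_ne N hd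
    change (1 : ℝ) < |mobDen (N * M * N⁻¹) (mob N x)|
    rw [mobDen_mul _ _ h2, mob_inv_mob _ hd, mobDen_mul _ _ hfix.mobDen_ne, hfix.mob_eq]
    have e : mobDen N x * mobDen M x * mobDen N⁻¹ (mob N x) = mobDen M x := by
      linear_combination mobDen M x * h1
    rw [e]; exact hatt

/-- A generator is ±g^j. Attraction forces j > 0, primitivity j < 2, and the positive trace fixes
the sign. -/
lemma generator_unique_of_periodic (hp : 3 ≤ p) {x : ℝ} (hx : IsPeriodic p x)
    {M M' : SL(2, ℝ)} (h : IsGeneratorAt p x M) (h' : IsGeneratorAt p x M') : M = M' := by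
  obtain ⟨l, hl, hne, hgen, hstab⟩ := exists_generator_of_periodic hp hx
  suffices key : ∀ N, IsGeneratorAt p x N → N = wordProd p l by rw [key M h, key M' h']
  rintro N ⟨hN, htr, hprim, hatt⟩
  obtain ⟨j, hj⟩ := hstab N hN hatt.1
  have h1 := hatt.one_lt
  have hg := hgen.2.2.2
  rw [hj.abs_mobDen, mobDen_zpow_of_fixes hg.1, abs_zpow] at h1
  have hj0 : 0 < j := by
    by_contra! hle
    exact absurd (zpow_le_one_of_nonpos₀ hg.one_lt.le hle) (not_le.mpr h1)
  obtain ⟨n, rfl⟩ := Int.eq_ofNat_of_zero_le hj0.le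
  rw [zpow_natCast] at hj
  have hn : ¬ 2 ≤ n := by
    intro hn
    obtain ⟨h2, h3⟩ := hprim _ (wordProd_mem l) n hn
    exact hj.elim h2 h3
  have : n = 1 := by omega
  rw [this, pow_one] at hj
  exact eq_of_signEq_of_slTrace hj htr hgen.2.1

lemma generator_unique (hp : 3 ≤ p) {x : ℝ} {M M' : SL(2, ℝ)} (h : IsGeneratorAt p x M)
    (h' : IsGeneratorAt p x M') : M = M' := by
  obtain ⟨N, hN, z, hz, rfl⟩ := exists_periodic hp h.isHyperbolicPoint
  have hd := (hz.isHyperbolicPoint hp).mobDen_ne hp hN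
  have h1 := h.conj hp (inv_mem hN)
  have h2 := h'.conj hp (inv_mem hN)
  rw [mob_inv_mob _ hd] at h1 h2
  have := generator_unique_of_periodic hp hz h1 h2
  exact mul_left_cancel (mul_right_cancel this)

/-- Existence is carried over by conjugation from a periodic point. With `generator_unique` the
choice in the definition is immaterial. -/
lemma hyperbolicElt_spec (hp : 3 ≤ p) {x : ℝ} (hx : IsHyperbolicPoint p x) :
    IsGeneratorAt p x (hyperbolicElt p x) := by
  have hex : ∃ M, IsGeneratorAt p x M := by
    obtain ⟨N, hN, z, hz, rfl⟩ := exists_periodic hp hx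
    obtain ⟨l, -, -, hgen, -⟩ := exists_generator_of_periodic hp hz
    exact ⟨_, hgen.conj hp hN⟩
  rw [hyperbolicElt, dif_pos hex]
  exact hex.choose_spec

lemma IsGeneratorAt.eq_hyperbolicElt (hp : 3 ≤ p) {x : ℝ} {M : SL(2, ℝ)}
    (h : IsGeneratorAt p x M) : hyperbolicElt p x = M :=
  generator_unique hp (hyperbolicElt_spec hp h.isHyperbolicPoint) h

lemma hyperbolicElt_mob (hp : 3 ≤ p) {x : ℝ} (hx : IsHyperbolicPoint p x) {N : SL(2, ℝ)}
    (hN : N ∈ heckeGroup p) : hyperbolicElt p (mob N x) = N * hyperbolicElt p x * N⁻¹ :=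
  ((hyperbolicElt_spec hp hx).conj hp hN).eq_hyperbolicElt hp

lemma stabilizer_hyperbolic (hp : 3 ≤ p) {x : ℝ} (hx : IsHyperbolicPoint p x) {N : SL(2, ℝ)}
    (hN : N ∈ heckeGroup p) (hNx : Fixes N x) : ∃ j : ℤ, SignEq N (hyperbolicElt p x ^ j) := by
  obtain ⟨K, hK, z, hz, rfl⟩ := exists_periodic hp hx
  have hzh := hz.isHyperbolicPoint hp
  have hd := hzh.mobDen_ne hp hK
  obtain ⟨l, -, -, hgen, hstab⟩ := exists_generator_of_periodic hp hz
  have h1 := hNx.conj (N := K⁻¹) (mobDen_inv_mob_ne _ hd)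
  rw [mob_inv_mob _ hd, inv_inv] at h1
  obtain ⟨j, hj⟩ := hstab _ (mul_mem (mul_mem (inv_mem hK) hN) hK) h1
  refine ⟨j, ?_⟩
  rw [hyperbolicElt_mob hp hzh hK, hgen.eq_hyperbolicElt hp, conj_zpow]
  have := ((SignEq.refl K).mul hj).mul (SignEq.refl K⁻¹)
  convert this using 1
  group

end

end

noncomputable section

open scoped MatrixGroups

open SLTwo

/-! ### Forms -/

namespace BQF

lemma act_mul (Q : BQF) (M N : SL(2, ℝ)) : Q.act (M * N) = (Q.act M).act N := by
  ext <;> simp only [act, mul_zero_zero, mul_zero_one, mul_one_zero, mul_one_one] <;> ring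

@[simp] lemma act_one (Q : BQF) : Q.act 1 = Q := by
  ext <;> simp [act]

@[simp] lemma act_neg (Q : BQF) (M : SL(2, ℝ)) : Q.act (-M) = Q.act M := by
  ext <;> simp only [act, neg_entry] <;> ring

lemma neg_act (Q : BQF) (M : SL(2, ℝ)) : Q.neg.act M = (Q.act M).neg := by
  ext <;> simp only [act, neg] <;> ring

@[simp] lemma neg_neg (Q : BQF) : Q.neg.neg = Q := by
  ext <;> simp [neg]

lemma act_inv_act (Q : BQF) (M : SL(2, ℝ)) : (Q.act M⁻¹).act M = Q := by
  rw [← act_mul, inv_mul_cancel, act_one]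

lemma ofMatrix_conj (M N : SL(2, ℝ)) :
    ofMatrix (N * M * N⁻¹) = (ofMatrix M).act N⁻¹ := by
  ext <;> simp only [ofMatrix, act, mul_zero_zero, mul_zero_one, mul_one_zero, mul_one_one,
    inv_zero_zero, inv_zero_one, inv_one_zero, inv_one_one] <;> ring

lemma ofMatrix_inv (M : SL(2, ℝ)) : ofMatrix M⁻¹ = (ofMatrix M).neg := by
  ext <;> simp only [ofMatrix, neg, inv_zero_zero, inv_zero_one, inv_one_zero, inv_one_one]
  ring

lemma disc_ofMatrix (M : SL(2, ℝ)) : (ofMatrix M).disc = slTrace M ^ 2 - 4 := by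
  simp only [disc, ofMatrix, slTrace]
  linear_combination -4 * det_eq M

/-- The discriminant tr² - 4 recovers the positive trace, and form and trace together recover all
four entries. -/
lemma ofMatrix_injective {M N : SL(2, ℝ)} (h : ofMatrix M = ofMatrix N) (hM : 2 < slTrace M)
    (hN : 2 < slTrace N) : M = N := by
  have hd : slTrace M ^ 2 = slTrace N ^ 2 := by
    have := congrArg disc h
    rw [disc_ofMatrix, disc_ofMatrix] at this
    linarith
  have ht : slTrace M = slTrace N := by
    rwa [sq_eq_sq₀ (by linarith) (by linarith)] at hd
  have hA := congrArg BQF.A h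
  have hB := congrArg BQF.B h
  have hC := congrArg BQF.C h
  simp only [ofMatrix, slTrace] at hA hB hC ht
  apply ext_entries <;> linarith

end BQF

lemma entry_mem_adjoin {p : ℕ} {M : SL(2, ℝ)} (hM : M ∈ heckeGroup p) :
    M 0 0 ∈ Algebra.adjoin ℤ {heckeLambda p} ∧ M 0 1 ∈ Algebra.adjoin ℤ {heckeLambda p} ∧
      M 1 0 ∈ Algebra.adjoin ℤ {heckeLambda p} ∧ M 1 1 ∈ Algebra.adjoin ℤ {heckeLambda p} := by
  induction hM using Subgroup.closure_induction with
  | mem A hA =>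
    rcases hA with rfl | rfl
    · obtain ⟨a, b, c, d⟩ := heckeS_entries p
      rw [a, b, c, d]
      exact ⟨one_mem _, Algebra.self_mem_adjoin_singleton _ _, zero_mem _, one_mem _⟩
    · obtain ⟨a, b, c, d⟩ := heckeT_entries
      rw [a, b, c, d]
      exact ⟨zero_mem _, neg_mem (one_mem _), one_mem _, zero_mem _⟩
  | one => obtain ⟨a, b, c, d⟩ := one_entries
           rw [a, b, c, d]
           exact ⟨one_mem _, zero_mem _, zero_mem _, one_mem _⟩
  | mul A B _ _ hA hB =>
    obtain ⟨a, b, c, d⟩ := hA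
    obtain ⟨e, f, g, h⟩ := hB
    simp only [mul_zero_zero, mul_zero_one, mul_one_zero, mul_one_one]
    exact ⟨add_mem (mul_mem a e) (mul_mem b g), add_mem (mul_mem a f) (mul_mem b h),
      add_mem (mul_mem c e) (mul_mem d g), add_mem (mul_mem c f) (mul_mem d h)⟩
  | inv A _ hA =>
    obtain ⟨a, b, c, d⟩ := hA
    simp only [inv_zero_zero, inv_zero_one, inv_one_zero, inv_one_one]
    exact ⟨d, neg_mem b, neg_mem c, a⟩

section

variable {p : ℕ}

lemma isLambda_hyperbolicForm (hp : 3 ≤ p) {x : ℝ} (hx : IsHyperbolicPoint p x) :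
    (hyperbolicForm p x).IsLambda p := by
  have hg := hyperbolicElt_spec hp hx
  obtain ⟨a, b, c, d⟩ := entry_mem_adjoin hg.1
  refine ⟨c, sub_mem d a, neg_mem b, ?_⟩
  rw [hyperbolicForm, BQF.disc_ofMatrix]
  nlinarith [hg.2.1]

lemma hyperbolicForm_mob (hp : 3 ≤ p) {x : ℝ} (hx : IsHyperbolicPoint p x) {N : SL(2, ℝ)}
    (hN : N ∈ heckeGroup p) : hyperbolicForm p (mob N x) = (hyperbolicForm p x).act N⁻¹ := by
  rw [hyperbolicForm, hyperbolicElt_mob hp hx hN, BQF.ofMatrix_conj]; rfl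

/-! ### Hecke conjugation -/

/-- The Hecke conjugate of a hyperbolic point. -/
def heckeConj (p : ℕ) (x : ℝ) : ℝ :=
  (hyperbolicElt p x 0 0 - hyperbolicElt p x 1 1) / hyperbolicElt p x 1 0 - x

lemma IsGeneratorAt.lower_ne_zero (hp : 3 ≤ p) {x : ℝ} {M : SL(2, ℝ)}
    (h : IsGeneratorAt p x M) : M 1 0 ≠ 0 :=
  _root_.lower_ne_zero hp h.1 (h.2.1.trans_le (le_abs_self _))

lemma hyperbolicElt_lower_ne_zero (hp : 3 ≤ p) {x : ℝ} (hx : IsHyperbolicPoint p x) :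
    hyperbolicElt p x 1 0 ≠ 0 := (hyperbolicElt_spec hp hx).lower_ne_zero hp

lemma lower_mul_heckeConj (hp : 3 ≤ p) {x : ℝ} (hx : IsHyperbolicPoint p x) :
    hyperbolicElt p x 1 0 * (heckeConj p x + x) =
      hyperbolicElt p x 0 0 - hyperbolicElt p x 1 1 := by
  have := hyperbolicElt_lower_ne_zero hp hx
  rw [heckeConj]; field_simp; ring

lemma fixes_heckeConj (hp : 3 ≤ p) {x : ℝ} (hx : IsHyperbolicPoint p x) :
    Fixes (hyperbolicElt p x) (heckeConj p x) := by
  have h1 := lower_mul_heckeConj hp hx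
  have h2 := (hyperbolicElt_spec hp hx).2.2.2.1
  rw [Fixes] at h2 ⊢
  linear_combination h2 - (heckeConj p x - x) * h1

lemma eq_heckeConj_of_fixes (hp : 3 ≤ p) {x y : ℝ} (hx : IsHyperbolicPoint p x) (hne : y ≠ x)
    (hy : Fixes (hyperbolicElt p x) y) : y = heckeConj p x := by
  have h1 := lower_mul_heckeConj hp hx
  have h2 := (hyperbolicElt_spec hp hx).2.2.2.1
  rw [Fixes] at h2 hy
  have h3 : (y - x) * (hyperbolicElt p x 1 0 * (y - heckeConj p x)) = 0 := by
    linear_combination h2 - hy - (y - x) * h1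
  rw [mul_eq_zero, mul_eq_zero, sub_eq_zero, sub_eq_zero] at h3
  exact (h3.resolve_left hne).resolve_left (hyperbolicElt_lower_ne_zero hp hx)

/-- The attracting fixed point is the one with `c (x - x') > 0`. -/
lemma lower_mul_sub_heckeConj_pos (hp : 3 ≤ p) {x : ℝ} (hx : IsHyperbolicPoint p x) :
    0 < hyperbolicElt p x 1 0 * (x - heckeConj p x) := by
  have h1 := lower_mul_heckeConj hp hx
  have hg := hyperbolicElt_spec hp hx
  have htr := hg.2.1
  have h2 := hg.2.2.2.1
  have h3 := hg.2.2.2.2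
  have hdet := det_eq (hyperbolicElt p x)
  rw [slTrace] at htr
  rw [Fixes] at h2
  set a := hyperbolicElt p x 0 0
  set b := hyperbolicElt p x 0 1
  set c := hyperbolicElt p x 1 0
  set d := hyperbolicElt p x 1 1
  set y := heckeConj p x
  -- cx + d and cx' + d are the eigenvalues of M_x: their sum is the trace and their product is 1.
  -- As the trace is positive, attraction at x means cx + d > 1 > cx' + d.
  have hsum : (c * x + d) + (c * y + d) = a + d := by linear_combination h1
  have hprod : (c * x + d) * (c * y + d) = 1 := by
    linear_combination hdet + (c * x + d) * h1 + c * h2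
  rw [lt_abs] at h3
  have hmu : 1 < c * x + d := by
    rcases h3 with h3 | h3
    · exact h3
    · nlinarith
  nlinarith

lemma heckeConj_ne (hp : 3 ≤ p) {x : ℝ} (hx : IsHyperbolicPoint p x) : heckeConj p x ≠ x := by
  intro h
  have := lower_mul_sub_heckeConj_pos hp hx
  rw [h] at this
  simp at this

/-- Inversion exchanges attracting and repelling points; by Vieta the denominator -cx' + a of M_x⁻¹
at x' is cx + d. This yields Q_{x'} = -Q_x. -/
lemma isGeneratorAt_heckeConj (hp : 3 ≤ p) {x : ℝ} (hx : IsHyperbolicPoint p x) :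
    IsGeneratorAt p (heckeConj p x) (hyperbolicElt p x)⁻¹ := by
  have hg := hyperbolicElt_spec hp hx
  have hfix := fixes_heckeConj hp hx
  refine ⟨inv_mem hg.1, by rw [slTrace_inv]; exact hg.2.1, ?_, (fixer _).inv_mem hfix, ?_⟩
  · intro N hN n hn
    obtain ⟨h1, h2⟩ := hg.2.2.1 N⁻¹ (inv_mem hN) n hn
    rw [inv_pow] at h1 h2
    constructor
    · intro h; apply h1; rw [← h, inv_inv]
    · intro h; apply h2; rw [← inv_neg, ← h, inv_inv]
  · rw [inv_one_zero, inv_one_one]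
    have h1 := lower_mul_heckeConj hp hx
    have e : -hyperbolicElt p x 1 0 * heckeConj p x + hyperbolicElt p x 0 0 =
        hyperbolicElt p x 1 0 * x + hyperbolicElt p x 1 1 := by linear_combination -h1
    rw [e]; exact hg.2.2.2.2

lemma IsHyperbolicPoint.heckeConj (hp : 3 ≤ p) {x : ℝ} (hx : IsHyperbolicPoint p x) :
    IsHyperbolicPoint p (heckeConj p x) := (isGeneratorAt_heckeConj hp hx).isHyperbolicPoint

lemma hyperbolicElt_heckeConj (hp : 3 ≤ p) {x : ℝ} (hx : IsHyperbolicPoint p x) :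
    hyperbolicElt p (heckeConj p x) = (hyperbolicElt p x)⁻¹ :=
  (isGeneratorAt_heckeConj hp hx).eq_hyperbolicElt hp

lemma hyperbolicForm_heckeConj (hp : 3 ≤ p) {x : ℝ} (hx : IsHyperbolicPoint p x) :
    hyperbolicForm p (heckeConj p x) = (hyperbolicForm p x).neg := by
  rw [hyperbolicForm, hyperbolicElt_heckeConj hp hx, BQF.ofMatrix_inv]; rfl

lemma heckeConj_heckeConj (hp : 3 ≤ p) {x : ℝ} (hx : IsHyperbolicPoint p x) :
    heckeConj p (heckeConj p x) = x := by
  symm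
  refine eq_heckeConj_of_fixes hp (hx.heckeConj hp) (heckeConj_ne hp hx).symm ?_
  rw [hyperbolicElt_heckeConj hp hx]
  exact (fixer _).inv_mem (hyperbolicElt_spec hp hx).2.2.2.1

lemma heckeConj_mob (hp : 3 ≤ p) {x : ℝ} (hx : IsHyperbolicPoint p x) {N : SL(2, ℝ)}
    (hN : N ∈ heckeGroup p) : heckeConj p (mob N x) = mob N (heckeConj p x) := by
  symm
  have hd := (hx.heckeConj hp).mobDen_ne hp hN
  refine eq_heckeConj_of_fixes hp (hx.mob hp hN) ?_ ?_
  · intro h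
    exact heckeConj_ne hp hx (mob_injective N hd (hx.mobDen_ne hp hN) h)
  · rw [hyperbolicElt_mob hp hx hN]
    exact (fixes_heckeConj hp hx).conj hd

/-- The stabilizer of x consists of ± powers of M_x, all of which fix x', so the universal
quantifier in `IsHeckeConj` can be tested on M_x alone. -/
lemma isHeckeConj_iff (hp : 3 ≤ p) {x y : ℝ} :
    IsHeckeConj p x y ↔ IsHyperbolicPoint p x ∧ y = heckeConj p x := by
  constructor
  · rintro ⟨hx, hne, h⟩
    have hg := hyperbolicElt_spec hp hx
    exact ⟨hx, eq_heckeConj_of_fixes hp hx hne (h _ hg.1 hg.2.2.2.1)⟩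
  · rintro ⟨hx, rfl⟩
    refine ⟨hx, heckeConj_ne hp hx, fun M hM hMx ↦ ?_⟩
    obtain ⟨j, hj⟩ := stabilizer_hyperbolic hp hx hM hMx
    exact hj.fixes ((fixer _).zpow_mem (fixes_heckeConj hp hx) j)

/-- The form determines the matrix, hence the pair of fixed points, and the sign of c singles out
the attracting one. -/
lemma hyperbolicForm_injective (hp : 3 ≤ p) {x y : ℝ} (hx : IsHyperbolicPoint p x)
    (hy : IsHyperbolicPoint p y) (h : hyperbolicForm p x = hyperbolicForm p y) : x = y := by
  have hM : hyperbolicElt p x = hyperbolicElt p y :=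
    BQF.ofMatrix_injective h (hyperbolicElt_spec hp hx).2.1 (hyperbolicElt_spec hp hy).2.1
  by_contra hne
  have h1 : y = heckeConj p x := eq_heckeConj_of_fixes hp hx (Ne.symm hne)
    (hM ▸ (hyperbolicElt_spec hp hy).2.2.2.1)
  have h2 := lower_mul_sub_heckeConj_pos hp hx
  have h3 := lower_mul_sub_heckeConj_pos hp hy
  rw [← hM, h1, heckeConj_heckeConj hp hx] at h3
  linarith

/-! ### Simple points -/

/-- A hyperbolic point whose form `[A, B, C]` satisfies `A > 0 > C`. -/
def IsSimple (p : ℕ) (x : ℝ) : Prop :=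
  IsHyperbolicPoint p x ∧ 0 < (hyperbolicForm p x).A ∧ (hyperbolicForm p x).C < 0

lemma mem_simpleNumbers {𝒜 : Set BQF} {x : ℝ} :
    x ∈ simpleNumbers p 𝒜 ↔ IsSimple p x ∧ hyperbolicForm p x ∈ 𝒜 := by
  simp only [simpleNumbers, IsSimple, Set.mem_ofPred_eq]; tauto

/-- By Vieta C = -b = c x x', so A > 0 > C means c > 0 > xx'; then c(x - x') > 0 orders the two
roots. -/
lemma isSimple_iff (hp : 3 ≤ p) {x : ℝ} :
    IsSimple p x ↔ IsHyperbolicPoint p x ∧ 0 < x ∧ heckeConj p x < 0 := by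
  refine and_congr_right fun hx ↦ ?_
  have h1 := lower_mul_sub_heckeConj_pos hp hx
  have h2 := lower_mul_heckeConj hp hx
  have h3 := (hyperbolicElt_spec hp hx).2.2.2.1
  rw [Fixes] at h3
  simp only [hyperbolicForm, BQF.ofMatrix]
  have h4 : hyperbolicElt p x 0 1 = -hyperbolicElt p x 1 0 * (x * heckeConj p x) := by
    linear_combination h3 + x * h2
  rw [h4]
  constructor
  · rintro ⟨hc, hb⟩
    have hxy : heckeConj p x < x := by
      have := (pos_iff_pos_of_mul_pos h1).mp hc
      linarith
    have hneg : x * heckeConj p x < 0 := by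
      by_contra! h
      have := mul_nonneg hc.le h
      linarith
    rcases mul_neg_iff.mp hneg with h | h
    · exact h
    · linarith [h.1, h.2]
  · rintro ⟨h5, h6⟩
    have hc : 0 < hyperbolicElt p x 1 0 := (pos_iff_pos_of_mul_pos h1).mpr (by linarith)
    exact ⟨hc, by have := mul_neg_of_pos_of_neg hc (mul_neg_of_pos_of_neg h5 h6); linarith⟩

lemma mob_heckeV_neg_of_append (hp : 3 ≤ p) {l : List ℕ} {t : ℕ}
    (hl : Admissible p (l ++ [t])) {z : ℝ} (h : mob (wordProd p (l ++ [t])) z < 0) :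
    mob (heckeV p t) z < 0 ∧ mobDen (heckeV p t) z ≠ 0 := by
  have hd : mobDen (wordProd p (l ++ [t])) z ≠ 0 := by
    intro h0; simp [mob, h0] at h
  have e : heckeV p t = (wordProd p l)⁻¹ * wordProd p (l ++ [t]) := by
    rw [wordProd_append, inv_mul_cancel_left, wordProd_singleton]
  have h' : mob (heckeV p t) z < 0 := by
    rw [e, mob_mul _ _ hd]
    exact (mob_wordProd_inv_neg hp (admissible_append.mp hl).1 h).2
  exact ⟨h', by intro h0; simp [mob, h0] at h'⟩

/-- At most one letter below p sends a given number to a negative one, so the last letters of both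
words agree and cancel in P₁P₂⁻¹. The argument repeats until one word is used up. -/
lemma wordProd_mul_inv_reduce (hp : 3 ≤ p) {l₁ l₂ : List ℕ} (h₁ : Admissible p l₁)
    (h₂ : Admissible p l₂) {z : ℝ} (hz₁ : mob (wordProd p l₁) z < 0)
    (hz₂ : mob (wordProd p l₂) z < 0) :
    ∃ l, Admissible p l ∧ (wordProd p l₁ * (wordProd p l₂)⁻¹ = wordProd p l ∨
      wordProd p l₁ * (wordProd p l₂)⁻¹ = (wordProd p l)⁻¹) := by
  induction l₁ using List.reverseRecOn generalizing l₂ z with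
  | nil => exact ⟨l₂, h₂, Or.inr (by simp)⟩
  | append_singleton l₁ r ih =>
    rcases List.eq_nil_or_concat l₂ with rfl | ⟨l₂, s, rfl⟩
    · exact ⟨_, h₁, Or.inl (by simp)⟩
    · rw [List.concat_eq_append] at h₂ hz₂ ⊢
      obtain ⟨hr, hdr⟩ := mob_heckeV_neg_of_append hp h₁ hz₁
      obtain ⟨hs, hds⟩ := mob_heckeV_neg_of_append hp h₂ hz₂
      rw [admissible_append, admissible_singleton] at h₁ h₂
      obtain rfl := heckeV_unique_neg hp h₁.2.2 h₂.2.2 hr hs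
      rw [wordProd_append, wordProd_singleton, mob_mul _ _ hdr] at hz₁ hz₂
      rw [wordProd_append, wordProd_append, mul_inv_rev, mul_assoc, mul_inv_cancel_left]
      exact ih h₁.1 h₂.1 hz₁ hz₂

/-- An element of the Hecke group that maps `x > 0 > x'` to `y > 0 > y'` is, up to sign, a word
or the inverse of a word. -/
lemma signEq_wordProd_or_inv (hp : 3 ≤ p) {M : SL(2, ℝ)} (hM : M ∈ heckeGroup p) {x x' : ℝ}
    (hxh : IsHyperbolicPoint p x) (hx : 0 < x) (hx' : x' < 0) (hy : 0 < mob M x)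
    (hy' : mob M x' < 0) :
    ∃ l, Admissible p l ∧ (SignEq M (wordProd p l) ∨ SignEq M (wordProd p l)⁻¹) := by
  obtain ⟨l₁, l₂, z, h₁, h₂, hz, hxz, h⟩ := wordForm_of_mem hp hx.le hM
  have hd₂ := (mobDen_wordProd_pos hp h₂ hz).ne'
  have hval : mob (wordProd p l₁ * (wordProd p l₂)⁻¹) x = mob (wordProd p l₁) z := by
    rw [hxz, mob_mul _ _ (mobDen_inv_mob_ne _ hd₂), mob_inv_mob _ hd₂]
  rcases h with h | h
  swap
  · rw [h.mob_eq, mob_mul, hval, mob_heckeT] at hy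
    · have := div_nonpos_of_nonpos_of_nonneg (by norm_num : (-1 : ℝ) ≤ 0)
        (mob_wordProd_nonneg hp h₁ hz)
      linarith
    · exact hxh.mobDen_ne hp (mul_mem (wordProd_mem _) (inv_mem (wordProd_mem _)))
  obtain ⟨hd, hneg⟩ := mob_wordProd_inv_neg hp h₂ hx'
  rw [h.mob_eq, mob_mul _ _ hd] at hy'
  have hback : mob (wordProd p l₂) (mob (wordProd p l₂)⁻¹ x') = x' := by
    rw [← mob_mul _ _ hd, mul_inv_cancel, mob_one]
  obtain ⟨l, hl, hl'⟩ := wordProd_mul_inv_reduce hp h₁ h₂ hy' (hback.symm ▸ hx')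
  refine ⟨l, hl, ?_⟩
  rcases hl' with hl' | hl' <;> rw [hl'] at h
  · exact Or.inl h
  · exact Or.inr h

lemma IsPeriodic.isSimple (hp : 3 ≤ p) {x : ℝ} (h : IsPeriodic p x) : IsSimple p x := by
  obtain ⟨l, hl, hne, hgen, -⟩ := exists_generator_of_periodic hp h
  obtain ⟨hb, hc⟩ := fixed_wordProd_entries hp hl hne h.1 hgen.2.2.2.1.mob_eq
  refine ⟨h.isHyperbolicPoint hp, ?_⟩
  rw [hyperbolicForm, hgen.eq_hyperbolicElt hp]
  exact ⟨hc, neg_neg_iff_pos.mpr hb⟩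

lemma IsSimple.pos (hp : 3 ≤ p) {x : ℝ} (h : IsSimple p x) : 0 < x := ((isSimple_iff hp).mp h).2.1

lemma IsSimple.heckeConj_neg (hp : 3 ≤ p) {x : ℝ} (h : IsSimple p x) : heckeConj p x < 0 :=
  ((isSimple_iff hp).mp h).2.2

/-- M_x itself maps x > 0 > x' to the same pair, so up to sign and inversion it is a word. -/
lemma IsSimple.isPeriodic (hp : 3 ≤ p) {x : ℝ} (h : IsSimple p x) : IsPeriodic p x := by
  have hg := hyperbolicElt_spec hp h.1
  have hfix := hg.2.2.2.1
  obtain ⟨l, hl, hl'⟩ := signEq_wordProd_or_inv hp hg.1 h.1 (h.pos hp) (h.heckeConj_neg hp)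
    (by rw [hfix.mob_eq]; exact h.pos hp)
    (by rw [(fixes_heckeConj hp h.1).mob_eq]; exact h.heckeConj_neg hp)
  have hWx : Fixes (wordProd p l) x := by
    rcases hl' with h' | h'
    · exact h'.symm.fixes hfix
    · have := (fixer x).inv_mem (h'.symm.fixes hfix)
      rwa [inv_inv] at this
  refine ⟨h.pos hp, l, hl, ?_, hWx.mob_eq⟩
  rintro rfl
  have htr : |slTrace (hyperbolicElt p x)| = |slTrace 1| := by
    rcases hl' with h' | h'
    · rw [h'.abs_slTrace, wordProd_nil]
    · rw [h'.abs_slTrace, wordProd_nil, inv_one]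
  have h2 := hg.2.1.trans_le (le_abs_self _)
  rw [htr] at h2
  norm_num [slTrace] at h2

/-- If instead y = Px, complete P to a power of the period of y, say y = Pr y. Injectivity of P
gives x = r y, so words lead in both directions. -/
lemma IsSimple.exists_word (hp : 3 ≤ p) {x y : ℝ} (hx : IsSimple p x) (hy : IsSimple p y)
    {M : SL(2, ℝ)} (hM : M ∈ heckeGroup p) (hxy : y = mob M x) :
    ∃ l, Admissible p l ∧ x = mob (wordProd p l) y := by
  obtain ⟨l, hl, h⟩ := signEq_wordProd_or_inv hp hM hx.1 (hx.pos hp) (hx.heckeConj_neg hp)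
    (hxy ▸ hy.pos hp) (by rw [← heckeConj_mob hp hx.1 hM, ← hxy]; exact hy.heckeConj_neg hp)
  rcases h with h | h
  · rw [h.mob_eq] at hxy
    obtain ⟨hy0, g, hg, hne, hfix⟩ := hy.isPeriodic hp
    have hgy : Fixes (wordProd p g) y := (isAttracting_wordProd hp hg hne hy0 hfix).1
    obtain ⟨r, hr, -, hxr⟩ := wordProd_prefix hp hl (admissible_replicate hg l.length)
      (hx.pos hp) hy0 (by rw [wordProd_replicate, (mob_pow_of_fixed hgy _).mob_eq, hxy]) (by
        have : 1 ≤ g.length := List.length_pos_iff.mpr hne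
        simp only [List.length_flatten, List.map_replicate, List.sum_replicate, smul_eq_mul]
        exact Nat.le_mul_of_pos_right _ this)
    exact ⟨r, hr, hxr⟩
  · refine ⟨l, hl, ?_⟩
    rw [hxy, h.mob_eq, ← mob_mul _ _ (hx.1.mobDen_ne hp (inv_mem (wordProd_mem l))),
      mul_inv_cancel, mob_one]

/-- Moving the last letter of a period of x to the front gives a period of V_t x. -/
lemma IsSimple.exists_next (hp : 3 ≤ p) {x : ℝ} (hx : IsSimple p x) :
    ∃ t, (1 ≤ t ∧ t < p) ∧ IsSimple p (mob (heckeV p t) x) := by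
  obtain ⟨h0, l, hl, hne, hfix⟩ := hx.isPeriodic hp
  rcases List.eq_nil_or_concat l with rfl | ⟨l, t, rfl⟩
  · exact absurd rfl hne
  rw [List.concat_eq_append] at hl hfix
  have hl' := admissible_append.mp hl
  have ht := admissible_singleton.mp hl'.2
  have hpos := mob_wordProd_pos hp hl'.2 h0
  rw [mob_wordProd_append hp hl'.2 h0.le] at hfix
  rw [wordProd_singleton] at hpos hfix
  refine ⟨t, ht, IsPeriodic.isSimple hp ⟨hpos, t :: l, admissible_cons.mpr ⟨ht, hl'.1⟩,
    by simp, ?_⟩⟩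
  rw [mob_wordProd_cons hp hl'.1 hpos.le, hfix]

/-! ### Classes -/

lemma IsFormClass.act_mem {𝒜 : Set BQF} (h : IsFormClass p 𝒜) {Q : BQF} (hQ : Q ∈ 𝒜)
    {M : SL(2, ℝ)} (hM : M ∈ heckeGroup p) : Q.act M ∈ 𝒜 := by
  obtain ⟨Q₀, -, rfl⟩ := h
  obtain ⟨N, hN, rfl⟩ := hQ
  exact ⟨N * M, mul_mem hN hM, (BQF.act_mul _ _ _).symm⟩

lemma IsFormClass.exists_act {𝒜 : Set BQF} (h : IsFormClass p 𝒜) {Q R : BQF} (hQ : Q ∈ 𝒜)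
    (hR : R ∈ 𝒜) : ∃ M ∈ heckeGroup p, R = Q.act M := by
  obtain ⟨Q₀, -, rfl⟩ := h
  obtain ⟨N, hN, rfl⟩ := hQ
  obtain ⟨K, hK, rfl⟩ := hR
  exact ⟨N⁻¹ * K, mul_mem (inv_mem hN) hK, by rw [← BQF.act_mul, mul_inv_cancel_left]⟩

lemma IsFormClass.eq_of_mem {𝒜 ℬ : Set BQF} (h : IsFormClass p 𝒜) (h' : IsFormClass p ℬ) {Q : BQF}
    (hQ : Q ∈ 𝒜) (hQ' : Q ∈ ℬ) : 𝒜 = ℬ := by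
  ext R
  constructor
  · intro hR
    obtain ⟨M, hM, rfl⟩ := h.exists_act hQ hR
    exact h'.act_mem hQ' hM
  · intro hR
    obtain ⟨M, hM, rfl⟩ := h'.exists_act hQ' hR
    exact h.act_mem hQ hM

lemma neg_mem_negClass {𝒜 : Set BQF} {Q : BQF} : Q.neg ∈ negClass 𝒜 ↔ Q ∈ 𝒜 := by
  constructor
  · rintro ⟨R, hR, h⟩
    rwa [← BQF.neg_neg Q, ← h, BQF.neg_neg]
  · exact fun h ↦ ⟨Q, h, rfl⟩

lemma negClass_negClass (𝒜 : Set BQF) : negClass (negClass 𝒜) = 𝒜 := by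
  ext Q
  rw [← BQF.neg_neg Q, neg_mem_negClass, neg_mem_negClass, BQF.neg_neg]

lemma IsFormClass.negClass {𝒜 : Set BQF} (h : IsFormClass p 𝒜) : IsFormClass p (negClass 𝒜) := by
  obtain ⟨Q, ⟨hA, hB, hC, hD⟩, rfl⟩ := h
  refine ⟨Q.neg, ⟨neg_mem hA, neg_mem hB, neg_mem hC, ?_⟩, ?_⟩
  · simp only [BQF.disc, BQF.neg] at hD ⊢; linarith
  · ext R
    rw [← BQF.neg_neg R, neg_mem_negClass]
    refine exists_congr fun M ↦ and_congr_right fun _ ↦ ?_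
    rw [BQF.neg_act]
    exact ⟨fun h ↦ by rw [h], fun h ↦ by rw [← BQF.neg_neg R.neg, h, BQF.neg_neg]⟩

lemma IsHyperbolicClass.negClass (hp : 3 ≤ p) {𝒜 : Set BQF} (h : IsHyperbolicClass p 𝒜) :
    IsHyperbolicClass p (negClass 𝒜) := by
  obtain ⟨h1, x, hx, hx'⟩ := h
  refine ⟨h1.negClass, heckeConj p x, hx.heckeConj hp, ?_⟩
  rwa [hyperbolicForm_heckeConj hp hx, neg_mem_negClass]

/-- The class of the form of a hyperbolic point. -/
def formClass (p : ℕ) (x : ℝ) : Set BQF :=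
  {R | ∃ M ∈ heckeGroup p, R = (hyperbolicForm p x).act M}

lemma hyperbolicForm_mem_formClass (x : ℝ) : hyperbolicForm p x ∈ formClass p x :=
  ⟨1, one_mem _, by simp⟩

lemma isHyperbolicClass_formClass (hp : 3 ≤ p) {x : ℝ} (hx : IsHyperbolicPoint p x) :
    IsHyperbolicClass p (formClass p x) :=
  ⟨⟨_, isLambda_hyperbolicForm hp hx, rfl⟩, x, hx, hyperbolicForm_mem_formClass x⟩

lemma exists_mob_of_mem_class (hp : 3 ≤ p) {𝒜 : Set BQF} (h : IsFormClass p 𝒜) {x y : ℝ}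
    (hx : IsHyperbolicPoint p x) (hy : IsHyperbolicPoint p y) (hx' : hyperbolicForm p x ∈ 𝒜)
    (hy' : hyperbolicForm p y ∈ 𝒜) : ∃ M ∈ heckeGroup p, y = mob M x := by
  obtain ⟨M, hM, h⟩ := h.exists_act hx' hy'
  refine ⟨M⁻¹, inv_mem hM, hyperbolicForm_injective hp hy (hx.mob hp (inv_mem hM)) ?_⟩
  rw [hyperbolicForm_mob hp hx (inv_mem hM), inv_inv, h]

lemma hyperbolicForm_mob_mem (hp : 3 ≤ p) {𝒜 : Set BQF} (h : IsFormClass p 𝒜) {x : ℝ}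
    (hx : IsHyperbolicPoint p x) (hx' : hyperbolicForm p x ∈ 𝒜) {M : SL(2, ℝ)}
    (hM : M ∈ heckeGroup p) : hyperbolicForm p (mob M x) ∈ 𝒜 := by
  rw [hyperbolicForm_mob hp hx hM]; exact h.act_mem hx' (inv_mem hM)

lemma simpleNumbers_nonempty (hp : 3 ≤ p) {𝒜 : Set BQF} (h : IsHyperbolicClass p 𝒜) :
    ∃ x, x ∈ simpleNumbers p 𝒜 := by
  obtain ⟨h1, x, hx, hx'⟩ := h
  obtain ⟨N, hN, z, hz, rfl⟩ := exists_periodic hp hx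
  have hzh := hz.isHyperbolicPoint hp
  have := hyperbolicForm_mob_mem hp h1 hx hx' (inv_mem hN)
  rw [mob_inv_mob _ (hzh.mobDen_ne hp hN)] at this
  exact ⟨z, mem_simpleNumbers.mpr ⟨hz.isSimple hp, this⟩⟩

lemma exists_word_of_mem_class (hp : 3 ≤ p) {𝒜 : Set BQF} (h : IsFormClass p 𝒜) {x y : ℝ}
    (hx : x ∈ simpleNumbers p 𝒜) (hy : y ∈ simpleNumbers p 𝒜) :
    ∃ l, Admissible p l ∧ x = mob (wordProd p l) y := by
  rw [mem_simpleNumbers] at hx hy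
  obtain ⟨M, hM, hxy⟩ := exists_mob_of_mem_class hp h hx.1.1 hy.1.1 hx.2 hy.2
  exact hx.1.exists_word hp hy.1 hM hxy

/-- While the word is at least as long as the period g of x, it begins with g, and deleting that
copy changes neither endpoint. -/
lemma exists_prefix_of_word (hp : 3 ≤ p) {x y : ℝ} (hx : 0 < x) (hy : 0 < y) {g : List ℕ}
    (hg : Admissible p g) (hne : g ≠ []) (hfix : mob (wordProd p g) x = x) {l : List ℕ}
    (hl : Admissible p l) (hxy : x = mob (wordProd p l) y) :
    ∃ l', Admissible p l' ∧ l' <+: g ∧ x = mob (wordProd p l') y := by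
  induction hn : l.length using Nat.strong_induction_on generalizing l with
  | _ n ih =>
    rcases le_total l.length g.length with hle | hle
    · obtain ⟨r, -, hr, -⟩ := wordProd_prefix hp hl hg hy hx (hxy.symm.trans hfix.symm) hle
      exact ⟨l, hl, ⟨r, hr.symm⟩, hxy⟩
    · obtain ⟨r, hr, rfl, hxr⟩ := wordProd_prefix hp hg hl hx hy (hfix.trans hxy) hle
      have hgl : 0 < g.length := List.length_pos_iff.mpr hne
      rw [List.length_append] at hn
      exact ih r.length (by omega) hr hxr rfl

/-- All points of the class are P⁻¹x with P among the finitely many prefixes of one period of x. -/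
lemma simpleNumbers_finite (hp : 3 ≤ p) {𝒜 : Set BQF} (h : IsFormClass p 𝒜) :
    (simpleNumbers p 𝒜).Finite := by
  rcases (simpleNumbers p 𝒜).eq_empty_or_nonempty with h0 | ⟨x, hx⟩
  · rw [h0]; exact Set.finite_empty
  obtain ⟨hx0, g, hg, hne, hfix⟩ := (mem_simpleNumbers.mp hx).1.isPeriodic hp
  refine ((List.finite_toSet g.inits).image fun l ↦ mob (wordProd p l)⁻¹ x).subset ?_
  intro y hy
  obtain ⟨l, hl, hxy⟩ := exists_word_of_mem_class hp h hx hy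
  have hy0 := (mem_simpleNumbers.mp hy).1.pos hp
  obtain ⟨l', hl', hpre, hxy'⟩ := exists_prefix_of_word hp hx0 hy0 hg hne hfix hl hxy
  refine ⟨l', (List.mem_inits _ _).mpr hpre, ?_⟩
  change mob (wordProd p l')⁻¹ x = y
  rw [hxy', mob_inv_mob _ (mobDen_wordProd_pos hp hl' hy0.le).ne']

/-! ### The involution `x ↦ T x'` on simple points -/

/-- `T x'`. -/
def heckeStar (p : ℕ) (x : ℝ) : ℝ := -1 / heckeConj p x

lemma heckeStar_eq_mob (x : ℝ) : heckeStar p x = mob heckeT (heckeConj p x) := by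
  rw [mob_heckeT]; rfl

lemma heckeConj_heckeStar (hp : 3 ≤ p) {x : ℝ} (hx : IsHyperbolicPoint p x) :
    heckeConj p (heckeStar p x) = -1 / x := by
  rw [heckeStar_eq_mob, heckeConj_mob hp (hx.heckeConj hp) heckeT_mem,
    heckeConj_heckeConj hp hx, mob_heckeT]

lemma IsSimple.heckeStar (hp : 3 ≤ p) {x : ℝ} (hx : IsSimple p x) :
    IsSimple p (heckeStar p x) := by
  rw [isSimple_iff hp]
  refine ⟨?_, div_pos_of_neg_of_neg (by norm_num) (hx.heckeConj_neg hp), ?_⟩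
  · rw [heckeStar_eq_mob]; exact (hx.1.heckeConj hp).mob hp heckeT_mem
  · rw [heckeConj_heckeStar hp hx.1]
    exact div_neg_of_neg_of_pos (by norm_num) (hx.pos hp)

lemma heckeStar_heckeStar (hp : 3 ≤ p) {x : ℝ} (hx : IsHyperbolicPoint p x) :
    heckeStar p (heckeStar p x) = x := by
  rw [heckeStar, heckeConj_heckeStar hp hx, neg_one_div_neg_one_div]

lemma heckeConj_eq_neg_one_div_heckeStar (x : ℝ) : heckeConj p x = -1 / heckeStar p x := by
  rw [heckeStar, neg_one_div_neg_one_div]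

/-- This minus sign is the reason for odd k: it turns the involution x ↦ Tx' into the relation q|T =
-q for sums of Q_x^(-k). -/
lemma hyperbolicForm_act_heckeT (hp : 3 ≤ p) {x : ℝ} (hx : IsHyperbolicPoint p x) :
    (hyperbolicForm p x).act heckeT = (hyperbolicForm p (heckeStar p x)).neg := by
  rw [heckeStar_eq_mob, hyperbolicForm_mob hp (hx.heckeConj hp) heckeT_mem,
    hyperbolicForm_heckeConj hp hx, heckeT_inv, BQF.act_neg, BQF.neg_act, BQF.neg_neg]

lemma heckeStar_mem_negClass (hp : 3 ≤ p) {𝒜 : Set BQF} (h : IsFormClass p 𝒜) {x : ℝ}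
    (hx : x ∈ simpleNumbers p 𝒜) : heckeStar p x ∈ simpleNumbers p (negClass 𝒜) := by
  rw [mem_simpleNumbers] at hx ⊢
  refine ⟨hx.1.heckeStar hp, ?_⟩
  rw [← BQF.neg_neg (hyperbolicForm p (heckeStar p x)), neg_mem_negClass,
    ← hyperbolicForm_act_heckeT hp hx.1.1]
  exact h.act_mem hx.2 heckeT_mem

lemma mem_simpleNumbers_next (hp : 3 ≤ p) {𝒜 : Set BQF} (h : IsFormClass p 𝒜) {x : ℝ}
    (hx : x ∈ simpleNumbers p 𝒜) :
    ∃ t, (1 ≤ t ∧ t < p) ∧ mob (heckeV p t) x ∈ simpleNumbers p 𝒜 := by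
  rw [mem_simpleNumbers] at hx
  obtain ⟨t, ht, hs⟩ := hx.1.exists_next hp
  exact ⟨t, ht, mem_simpleNumbers.mpr
    ⟨hs, hyperbolicForm_mob_mem hp h hx.1.1 hx.2 (heckeV_mem t)⟩⟩

/-! ### Hecke-symmetric sets -/

/-- A set of the points `x` and `T x`, `x ∈ Z`, is Hecke-symmetric if `Z` consists of simple
points and is stable under `x ↦ T x'`. -/
lemma heckeSymmetric_of_star (hp : 3 ≤ p) {Z : Set ℝ} (hZ : ∀ x ∈ Z, IsSimple p x)
    (hstar : ∀ x ∈ Z, heckeStar p x ∈ Z) :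
    HeckeSymmetric p {w | ∃ x ∈ Z, w = (x : ℂ) ∨ w = ((-1 / x : ℝ) : ℂ)} := by
  have hneg : ∀ x ∈ Z, IsHyperbolicPoint p (-1 / x) := fun x hx ↦ by
    rw [← mob_heckeT]; exact (hZ x hx).1.mob hp heckeT_mem
  have hconjneg : ∀ x ∈ Z, heckeConj p (-1 / x) = heckeStar p x := fun x hx ↦ by
    rw [heckeStar_eq_mob, ← heckeConj_mob hp (hZ x hx).1 heckeT_mem, mob_heckeT]
  refine ⟨?_, ?_⟩
  · rintro w ⟨x, hx, rfl | rfl⟩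
    · exact ⟨x, (hZ x hx).1, rfl⟩
    · exact ⟨_, hneg x hx, rfl⟩
  · ext w
    constructor
    · rintro ⟨x, hx, rfl | rfl⟩
      · refine ⟨-1 / heckeStar p x, x, ⟨_, hstar x hx, Or.inr rfl⟩, ?_, rfl⟩
        rw [isHeckeConj_iff hp]
        exact ⟨hneg _ (hstar x hx), by
          rw [hconjneg _ (hstar x hx), heckeStar_heckeStar hp (hZ x hx).1]⟩
      · refine ⟨heckeStar p x, -1 / x, ⟨_, hstar x hx, Or.inl rfl⟩, ?_, rfl⟩
        rw [isHeckeConj_iff hp]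
        exact ⟨(hZ _ (hstar x hx)).1, (heckeConj_heckeStar hp (hZ x hx).1).symm⟩
    · rintro ⟨u, v, ⟨x, hx, hu | hu⟩, huv, rfl⟩ <;> rw [isHeckeConj_iff hp] at huv <;>
        rw [Complex.ofReal_inj] at hu <;> rw [huv.2, hu]
      · exact ⟨heckeStar p x, hstar x hx, Or.inr (by rw [← heckeConj_eq_neg_one_div_heckeStar])⟩
      · exact ⟨heckeStar p x, hstar x hx, Or.inl (by rw [hconjneg x hx])⟩

/-- A Hecke-symmetric irreducible system of poles belongs to a class with `-𝒜 = 𝒜`. -/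
lemma negClass_eq_of_heckeSymmetric (hp : 3 ≤ p) {𝒜 : Set BQF} (h : IsHyperbolicClass p 𝒜)
    (hs : HeckeSymmetric p (poleSystem p 𝒜)) : negClass 𝒜 = 𝒜 := by
  obtain ⟨x, hx⟩ := simpleNumbers_nonempty hp h
  have hx' := mem_simpleNumbers.mp hx
  have hmem : ((heckeConj p x : ℝ) : ℂ) ∈ poleSystem p 𝒜 := by
    rw [hs.2]
    exact ⟨x, _, ⟨x, hx, Or.inl rfl⟩, (isHeckeConj_iff hp).mpr ⟨hx'.1.1, rfl⟩, rfl⟩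
  -- Since x' is negative, it can only be one of the points -1/y of the system, so Tx' = y lies in
  -- Z_𝒜. It also lies in Z_{-𝒜}, and two classes with a common form coincide.
  have hstar : heckeStar p x ∈ simpleNumbers p 𝒜 := by
    obtain ⟨y, hy, h1 | h1⟩ := hmem <;> rw [Complex.ofReal_inj] at h1
    · have h2 := (mem_simpleNumbers.mp hy).1.pos hp
      have h3 := hx'.1.heckeConj_neg hp
      linarith
    · rwa [heckeStar, h1, neg_one_div_neg_one_div]
  exact h.1.negClass.eq_of_mem h.1
    (mem_simpleNumbers.mp (heckeStar_mem_negClass hp h.1 hx)).2 (mem_simpleNumbers.mp hstar).2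

end

end

noncomputable section

open scoped MatrixGroups

open SLTwo

/-! ### Values of rational functions -/

/-- The rational function `f` is regular at `w` with value `v`. -/
def HasValueAt (w : ℂ) (f : RatFunc ℂ) (v : ℂ) : Prop :=
  ∃ P Q : Polynomial ℂ, Q.eval w ≠ 0 ∧
    f = algebraMap (Polynomial ℂ) (RatFunc ℂ) P / algebraMap (Polynomial ℂ) (RatFunc ℂ) Q ∧
    v = P.eval w / Q.eval w

/-- The rational function `f` is regular at `w`. -/
def RegularAt (w : ℂ) (f : RatFunc ℂ) : Prop := ∃ v, HasValueAt w f v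

lemma ratFunc_algebraMap_ne_zero {Q : Polynomial ℂ} {w : ℂ} (h : Q.eval w ≠ 0) :
    algebraMap (Polynomial ℂ) (RatFunc ℂ) Q ≠ 0 := by
  refine RatFunc.algebraMap_ne_zero ?_
  rintro rfl
  simp at h

namespace HasValueAt

variable {w v v' : ℂ} {f g : RatFunc ℂ}

lemma unique (h : HasValueAt w f v) (h' : HasValueAt w f v') : v = v' := by
  obtain ⟨P, Q, hQ, rfl, rfl⟩ := h
  obtain ⟨P', Q', hQ', h, rfl⟩ := h'
  rw [div_eq_div_iff (ratFunc_algebraMap_ne_zero hQ) (ratFunc_algebraMap_ne_zero hQ'),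
    ← map_mul, ← map_mul] at h
  have := congrArg (Polynomial.eval w) (RatFunc.algebraMap_injective ℂ h)
  rw [Polynomial.eval_mul, Polynomial.eval_mul] at this
  rw [div_eq_div_iff hQ hQ', this]

lemma of_polynomial (w : ℂ) (P : Polynomial ℂ) :
    HasValueAt w (algebraMap (Polynomial ℂ) (RatFunc ℂ) P) (P.eval w) :=
  ⟨P, 1, by simp, by simp, by simp⟩

lemma const (w c : ℂ) : HasValueAt w (RatFunc.C c) c := by
  simpa using of_polynomial w (Polynomial.C c)

lemma X (w : ℂ) : HasValueAt w RatFunc.X w := by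
  simpa using of_polynomial w Polynomial.X

lemma zero (w : ℂ) : HasValueAt w 0 0 := by simpa using const w 0

lemma one (w : ℂ) : HasValueAt w 1 1 := by simpa using const w 1

lemma add (h : HasValueAt w f v) (h' : HasValueAt w g v') : HasValueAt w (f + g) (v + v') := by
  obtain ⟨P, Q, hQ, rfl, rfl⟩ := h
  obtain ⟨P', Q', hQ', rfl, rfl⟩ := h'
  refine ⟨P * Q' + Q * P', Q * Q', by simp [hQ, hQ'], ?_, ?_⟩
  · rw [div_add_div _ _ (ratFunc_algebraMap_ne_zero hQ) (ratFunc_algebraMap_ne_zero hQ')]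
    simp only [map_add, map_mul]
  · rw [div_add_div _ _ hQ hQ']; simp

lemma mul (h : HasValueAt w f v) (h' : HasValueAt w g v') : HasValueAt w (f * g) (v * v') := by
  obtain ⟨P, Q, hQ, rfl, rfl⟩ := h
  obtain ⟨P', Q', hQ', rfl, rfl⟩ := h'
  refine ⟨P * P', Q * Q', by simp [hQ, hQ'], ?_, ?_⟩
  · rw [div_mul_div_comm]; simp only [map_mul]
  · rw [div_mul_div_comm]; simp

lemma neg (h : HasValueAt w f v) : HasValueAt w (-f) (-v) := by
  simpa using (const w (-1)).mul h

lemma sub (h : HasValueAt w f v) (h' : HasValueAt w g v') : HasValueAt w (f - g) (v - v') := by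
  simpa only [sub_eq_add_neg] using h.add h'.neg

lemma inv (h : HasValueAt w f v) (hv : v ≠ 0) : HasValueAt w f⁻¹ v⁻¹ := by
  obtain ⟨P, Q, hQ, rfl, rfl⟩ := h
  refine ⟨Q, P, ?_, ?_, ?_⟩
  · intro h0; simp [h0] at hv
  · rw [inv_div]
  · rw [inv_div]

lemma div (h : HasValueAt w f v) (h' : HasValueAt w g v') (hv : v' ≠ 0) :
    HasValueAt w (f / g) (v / v') := by
  simpa only [div_eq_mul_inv] using h.mul (h'.inv hv)

lemma pow (h : HasValueAt w f v) (n : ℕ) : HasValueAt w (f ^ n) (v ^ n) := by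
  induction n with
  | zero => simpa using one w
  | succ n ih => simpa only [pow_succ] using ih.mul h

lemma eval₂ (h : HasValueAt w f v) (P : Polynomial ℂ) :
    HasValueAt w (P.eval₂ RatFunc.C f) (P.eval v) := by
  induction P using Polynomial.induction_on' with
  | add P Q hP hQ => rw [Polynomial.eval₂_add, Polynomial.eval_add]; exact hP.add hQ
  | monomial n a =>
    rw [Polynomial.eval₂_monomial, Polynomial.eval_monomial]; exact (const w a).mul (h.pow n)

end HasValueAt

/-- The reduced denominator divides the denominator of every representation. -/
lemma regularAt_iff {w : ℂ} {f : RatFunc ℂ} : RegularAt w f ↔ ¬ f.denom.IsRoot w := by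
  constructor
  · rintro ⟨v, P, Q, hQ, rfl, rfl⟩ h
    obtain ⟨R, hR⟩ := RatFunc.denom_div_dvd P Q
    rw [Polynomial.IsRoot] at h
    exact hQ (by rw [hR, Polynomial.eval_mul, h, zero_mul])
  · exact fun h ↦ ⟨_, f.num, f.denom, h, (RatFunc.num_div_denom f).symm, rfl⟩

lemma mem_nonzeroPoles {w : ℂ} {q : RatFunc ℂ} :
    w ∈ nonzeroPoles q ↔ w ≠ 0 ∧ ¬ RegularAt w q := by
  rw [regularAt_iff, not_not]; rfl

lemma nonzeroPoles_finite (q : RatFunc ℂ) : (nonzeroPoles q).Finite :=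
  (Polynomial.finite_setOfPred_isRoot (RatFunc.denom_ne_zero q)).subset fun _ h ↦ h.2

namespace RegularAt

variable {w : ℂ} {f g : RatFunc ℂ}

lemma zero (w : ℂ) : RegularAt w 0 := ⟨_, .zero w⟩
lemma const (w c : ℂ) : RegularAt w (RatFunc.C c) := ⟨_, .const w c⟩
lemma add (h : RegularAt w f) (h' : RegularAt w g) : RegularAt w (f + g) :=
  ⟨_, h.choose_spec.add h'.choose_spec⟩
lemma sub (h : RegularAt w f) (h' : RegularAt w g) : RegularAt w (f - g) :=
  ⟨_, h.choose_spec.sub h'.choose_spec⟩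
lemma mul (h : RegularAt w f) (h' : RegularAt w g) : RegularAt w (f * g) :=
  ⟨_, h.choose_spec.mul h'.choose_spec⟩
lemma neg (h : RegularAt w f) : RegularAt w (-f) := ⟨_, h.choose_spec.neg⟩

lemma sum {ι : Type*} (s : Finset ι) {F : ι → RatFunc ℂ} (h : ∀ i ∈ s, RegularAt w (F i)) :
    RegularAt w (∑ i ∈ s, F i) := by
  classical
  induction s using Finset.induction_on with
  | empty => simpa using zero w
  | insert a s ha ih =>
    rw [Finset.sum_insert ha]
    exact (h a (Finset.mem_insert_self a s)).add
      (ih fun i hi ↦ h i (Finset.mem_insert_of_mem hi))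

end RegularAt

/-! ### Composition with Möbius transformations and the slash operator -/

/-- `a X + b`. -/
def linNum (M : SL(2, ℝ)) : RatFunc ℂ :=
  RatFunc.C ((M 0 0 : ℝ) : ℂ) * RatFunc.X + RatFunc.C ((M 0 1 : ℝ) : ℂ)

/-- `c X + d`. -/
def linDen (M : SL(2, ℝ)) : RatFunc ℂ :=
  RatFunc.C ((M 1 0 : ℝ) : ℂ) * RatFunc.X + RatFunc.C ((M 1 1 : ℝ) : ℂ)

lemma hasValueAt_linNum (M : SL(2, ℝ)) (w : ℂ) : HasValueAt w (linNum M) (mobNum M w) :=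
  ((HasValueAt.const _ _).mul (HasValueAt.X w)).add (HasValueAt.const _ _)

lemma hasValueAt_linDen (M : SL(2, ℝ)) (w : ℂ) : HasValueAt w (linDen M) (mobDen M w) :=
  ((HasValueAt.const _ _).mul (HasValueAt.X w)).add (HasValueAt.const _ _)

lemma hasValueAt_mob (M : SL(2, ℝ)) {w : ℂ} (h : mobDen M w ≠ 0) :
    HasValueAt w (linNum M / linDen M) (mob M w) :=
  (hasValueAt_linNum M w).div (hasValueAt_linDen M w) h

lemma finite_mobDen_eq_zero (M : SL(2, ℝ)) : {w : ℂ | mobDen M w = 0}.Finite := by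
  refine Set.Subsingleton.finite fun w hw v hv ↦ ?_
  simp only [mobDen, Set.mem_ofPred_eq] at hw hv
  have hdet := algebraMap_det (K := ℂ) M
  by_cases hc : algebraMap ℝ ℂ (M 1 0) = 0
  · rw [hc] at hw hdet
    simp only [zero_mul, zero_add] at hw
    rw [hw] at hdet
    simp at hdet
  · exact mul_left_cancel₀ hc (by linear_combination hw - hv)

lemma linDen_ne_zero (M : SL(2, ℝ)) : linDen M ≠ 0 := by
  intro h
  obtain ⟨w, hw⟩ := (finite_mobDen_eq_zero M).infinite_compl.nonempty
  have := hasValueAt_linDen M w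
  rw [h] at this
  exact hw (this.unique (.zero w))

/-- If P ∘ M = 0, then every v outside a finite set is a root of P, being M(M⁻¹v). Injectivity lets
the substitution extend to the fraction field. -/
lemma eval₂_mob_injective (M : SL(2, ℝ)) :
    Function.Injective (Polynomial.eval₂RingHom RatFunc.C (linNum M / linDen M)) := by
  rw [injective_iff_map_eq_zero]
  intro P hP
  rw [Polynomial.coe_eval₂RingHom] at hP
  refine Polynomial.eq_zero_of_infinite_isRoot P
    ((finite_mobDen_eq_zero M⁻¹).infinite_compl.mono fun v hv ↦ ?_)
  have hv' : mobDen M⁻¹ v ≠ 0 := hv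
  have h1 := mobDen_inv_mob_ne M⁻¹ hv'
  have h2 := mob_inv_mob M⁻¹ hv'
  rw [inv_inv] at h1 h2
  have h3 := (hasValueAt_mob M h1).eval₂ P
  rw [hP, h2] at h3
  exact h3.unique (.zero _)

/-- The substitution `X ↦ (a X + b) / (c X + d)`. -/
def mobComp (M : SL(2, ℝ)) : RatFunc ℂ →+* RatFunc ℂ :=
  RatFunc.liftRingHom (Polynomial.eval₂RingHom RatFunc.C (linNum M / linDen M))
    (nonZeroDivisors_le_comap_nonZeroDivisors_of_injective _ (eval₂_mob_injective M))

lemma mobComp_algebraMap (M : SL(2, ℝ)) (P : Polynomial ℂ) :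
    mobComp M (algebraMap (Polynomial ℂ) (RatFunc ℂ) P) =
      P.eval₂ RatFunc.C (linNum M / linDen M) := by
  rw [mobComp, RatFunc.liftRingHom_algebraMap]; rfl

@[simp] lemma mobComp_C (M : SL(2, ℝ)) (c : ℂ) : mobComp M (RatFunc.C c) = RatFunc.C c := by
  rw [← RatFunc.algebraMap_C, mobComp_algebraMap, Polynomial.eval₂_C, RatFunc.algebraMap_C]

@[simp] lemma mobComp_X (M : SL(2, ℝ)) : mobComp M RatFunc.X = linNum M / linDen M := by
  rw [← RatFunc.algebraMap_X, mobComp_algebraMap, Polynomial.eval₂_X]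

/-- `RatFunc.eval` is not a ring homomorphism in general, because denominators may vanish. For
Möbius arguments it agrees with `mobComp`, which makes slashing additive and multiplicative in the
expected way. -/
lemma slash_eq (k : ℕ) (q : RatFunc ℂ) (M : SL(2, ℝ)) :
    slash k q M = (linDen M ^ (2 * k))⁻¹ * mobComp M q := by
  conv_rhs => rw [← RatFunc.num_div_denom q, map_div₀, mobComp_algebraMap, mobComp_algebraMap]
  rfl

lemma ratFunc_ringHom_ext {φ ψ : RatFunc ℂ →+* RatFunc ℂ}
    (hC : ∀ c, φ (RatFunc.C c) = ψ (RatFunc.C c)) (hX : φ RatFunc.X = ψ RatFunc.X) : φ = ψ := by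
  refine IsLocalization.ringHom_ext (nonZeroDivisors (Polynomial ℂ)) ?_
  refine Polynomial.ringHom_ext (fun c ↦ ?_) ?_
  · simpa using hC c
  · simpa using hX

lemma mobComp_linNum (M N : SL(2, ℝ)) : mobComp N (linNum M) = linNum (M * N) / linDen N := by
  have := linDen_ne_zero N
  conv_lhs => rw [linNum]
  rw [map_add, map_mul, mobComp_C, mobComp_C, mobComp_X, eq_div_iff this, add_mul, mul_assoc,
    div_mul_cancel₀ _ this]
  simp only [linNum, linDen, mul_zero_zero, mul_zero_one, Complex.ofReal_add, Complex.ofReal_mul,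
    map_add, map_mul]
  ring

lemma mobComp_linDen (M N : SL(2, ℝ)) : mobComp N (linDen M) = linDen (M * N) / linDen N := by
  have := linDen_ne_zero N
  conv_lhs => rw [linDen]
  rw [map_add, map_mul, mobComp_C, mobComp_C, mobComp_X, eq_div_iff this, add_mul, mul_assoc,
    div_mul_cancel₀ _ this]
  simp only [linNum, linDen, mul_one_zero, mul_one_one, Complex.ofReal_add, Complex.ofReal_mul,
    map_add, map_mul]
  ring

lemma mobComp_mobComp (M N : SL(2, ℝ)) (q : RatFunc ℂ) :
    mobComp N (mobComp M q) = mobComp (M * N) q := by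
  have : (mobComp N).comp (mobComp M) = mobComp (M * N) := by
    refine ratFunc_ringHom_ext (fun c ↦ by simp) ?_
    rw [RingHom.comp_apply, mobComp_X, mobComp_X, map_div₀, mobComp_linNum, mobComp_linDen,
      div_div_div_cancel_right₀ (linDen_ne_zero N)]
  exact RingHom.congr_fun this q

lemma slash_slash (k : ℕ) (q : RatFunc ℂ) (M N : SL(2, ℝ)) :
    slash k (slash k q M) N = slash k q (M * N) := by
  have h1 := linDen_ne_zero N
  have h2 := linDen_ne_zero (M * N)
  simp only [slash_eq, map_mul, map_inv₀, map_pow, mobComp_mobComp, mobComp_linDen, div_pow]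
  field_simp

lemma slash_add (k : ℕ) (q r : RatFunc ℂ) (M : SL(2, ℝ)) :
    slash k (q + r) M = slash k q M + slash k r M := by
  simp only [slash_eq, map_add, mul_add]

lemma slash_sub (k : ℕ) (q r : RatFunc ℂ) (M : SL(2, ℝ)) :
    slash k (q - r) M = slash k q M - slash k r M := by
  simp only [slash_eq, map_sub, mul_sub]

lemma slash_neg (k : ℕ) (q : RatFunc ℂ) (M : SL(2, ℝ)) :
    slash k (-q) M = -slash k q M := by
  simp only [slash_eq, map_neg, mul_neg]

@[simp] lemma slash_zero (k : ℕ) (M : SL(2, ℝ)) : slash k 0 M = 0 := by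
  simp only [slash_eq, map_zero, mul_zero]

lemma slash_C_mul (k : ℕ) (c : ℂ) (q : RatFunc ℂ) (M : SL(2, ℝ)) :
    slash k (RatFunc.C c * q) M = RatFunc.C c * slash k q M := by
  simp only [slash_eq, map_mul, mobComp_C]; ring

lemma slash_sum (k : ℕ) {ι : Type*} (s : Finset ι) (F : ι → RatFunc ℂ) (M : SL(2, ℝ)) :
    slash k (∑ i ∈ s, F i) M = ∑ i ∈ s, slash k (F i) M := by
  simp only [slash_eq, map_sum, Finset.mul_sum]

lemma linDen_neg (M : SL(2, ℝ)) : linDen (-M) = -linDen M := by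
  simp only [linDen, neg_entry, Complex.ofReal_neg, map_neg]; ring

lemma linNum_neg (M : SL(2, ℝ)) : linNum (-M) = -linNum M := by
  simp only [linNum, neg_entry, Complex.ofReal_neg, map_neg]; ring

/-- The weight is even, so the action descends to the quotient by ±I. -/
lemma slash_neg_matrix (k : ℕ) (q : RatFunc ℂ) (M : SL(2, ℝ)) :
    slash k q (-M) = slash k q M := by
  have : mobComp (-M) = mobComp M :=
    ratFunc_ringHom_ext (fun c ↦ by simp) (by
      rw [mobComp_X, mobComp_X, linNum_neg, linDen_neg]
      exact neg_div_neg_eq _ _)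
  rw [slash_eq, slash_eq, this, linDen_neg, (even_two_mul k).neg_pow]

lemma linDen_one : linDen 1 = 1 := by simp [linDen]
lemma linNum_one : linNum 1 = RatFunc.X := by simp [linNum]

@[simp] lemma slash_one (k : ℕ) (q : RatFunc ℂ) : slash k q 1 = q := by
  have : mobComp 1 = RingHom.id _ :=
    ratFunc_ringHom_ext (fun c ↦ by simp) (by
      rw [mobComp_X, linNum_one, linDen_one, div_one, RingHom.id_apply])
  rw [slash_eq, this, linDen_one]; simp

lemma HasValueAt.mobComp {M : SL(2, ℝ)} {w v : ℂ} {f : RatFunc ℂ} (hd : mobDen M w ≠ 0)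
    (h : HasValueAt (mob M w) f v) : HasValueAt w (mobComp M f) v := by
  obtain ⟨P, Q, hQ, rfl, rfl⟩ := h
  rw [map_div₀, mobComp_algebraMap, mobComp_algebraMap]
  exact ((hasValueAt_mob M hd).eval₂ P).div ((hasValueAt_mob M hd).eval₂ Q) hQ

lemma RegularAt.slash {M : SL(2, ℝ)} {w : ℂ} {f : RatFunc ℂ} (k : ℕ) (hd : mobDen M w ≠ 0)
    (h : RegularAt (mob M w) f) : RegularAt w (slash k f M) := by
  obtain ⟨v, h⟩ := h
  rw [slash_eq]
  exact ⟨_, (((hasValueAt_linDen M w).pow (2 * k)).inv (pow_ne_zero _ hd)).mul (h.mobComp hd)⟩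

/-! ### Powers of forms -/

lemma mobComp_toRatFunc (Q : BQF) (M : SL(2, ℝ)) :
    mobComp M Q.toRatFunc = (Q.act M).toRatFunc / linDen M ^ 2 := by
  have h := linDen_ne_zero M
  rw [eq_div_iff (pow_ne_zero 2 h)]
  simp only [BQF.toRatFunc, map_add, map_mul, map_pow, mobComp_C, mobComp_X]
  have e1 : (RatFunc.C (Q.A : ℂ) * (linNum M / linDen M) ^ 2 +
      RatFunc.C (Q.B : ℂ) * (linNum M / linDen M) + RatFunc.C (Q.C : ℂ)) * linDen M ^ 2 =
      RatFunc.C (Q.A : ℂ) * linNum M ^ 2 + RatFunc.C (Q.B : ℂ) * (linNum M * linDen M) +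
        RatFunc.C (Q.C : ℂ) * linDen M ^ 2 := by
    field_simp
  rw [e1]
  simp only [linNum, linDen, BQF.act, Complex.ofReal_add, Complex.ofReal_mul, Complex.ofReal_pow,
    map_add, map_mul, map_pow, Complex.ofReal_ofNat, map_ofNat]
  ring

lemma slash_toRatFunc (k : ℕ) (Q : BQF) (M : SL(2, ℝ)) :
    slash k (Q.toRatFunc ^ k)⁻¹ M = ((Q.act M).toRatFunc ^ k)⁻¹ := by
  have h := linDen_ne_zero M
  rw [slash_eq, map_inv₀, map_pow, mobComp_toRatFunc, div_pow, inv_div, ← pow_mul,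
    div_eq_mul_inv, inv_mul_cancel_left₀ (pow_ne_zero _ h)]

lemma toRatFunc_neg (Q : BQF) : Q.neg.toRatFunc = -Q.toRatFunc := by
  simp only [BQF.toRatFunc, BQF.neg, Complex.ofReal_neg, map_neg]; ring

lemma inv_pow_toRatFunc_neg {k : ℕ} (hk : Odd k) (Q : BQF) :
    (Q.neg.toRatFunc ^ k)⁻¹ = -(Q.toRatFunc ^ k)⁻¹ := by
  rw [toRatFunc_neg, hk.neg_pow, inv_neg]

end

noncomputable section

open scoped MatrixGroups

open SLTwo

/-! ### Poles of rational period functions -/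

section

variable {p k : ℕ} {q : RatFunc ℂ}

lemma IsRPF.slash_heckeT (h : IsRPF p k q) : slash k q heckeT = -q :=
  (neg_eq_of_add_eq_zero_right h.1).symm

lemma sum_slash_heckeV (hp : 3 ≤ p) (q : RatFunc ℂ) :
    slash k (∑ t ∈ Finset.range p, slash k q (heckeU p ^ t)) heckeT⁻¹ =
      slash k q heckeT + ∑ t ∈ Finset.Ico 1 p, slash k q (heckeV p t) := by
  rw [slash_sum, Finset.range_eq_Ico, Finset.sum_eq_sum_Ico_succ_bot (by omega)]
  congr 1
  · rw [pow_zero, slash_one, heckeT_inv, slash_neg_matrix]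
  · exact Finset.sum_congr rfl fun t _ ↦ slash_slash _ _ _ _

/-- Slash the second relation by T⁻¹: the term t = 0 becomes q|T = -q and the others become q|V_t.
All letters now preserve the right half plane, and the equation can be iterated. -/
lemma IsRPF.eq_sum_heckeV (hp : 3 ≤ p) (h : IsRPF p k q) :
    q = ∑ t ∈ Finset.Ico 1 p, slash k q (heckeV p t) := by
  have h1 := sum_slash_heckeV (k := k) hp q
  rw [h.2, slash_zero, h.slash_heckeT] at h1
  rw [eq_comm, neg_add_eq_zero] at h1
  exact h1

lemma IsRPF.neg_one_div_mem (h : IsRPF p k q) {w : ℂ} (hw : w ∈ nonzeroPoles q) :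
    -1 / w ∈ nonzeroPoles q := by
  rw [mem_nonzeroPoles] at hw ⊢
  refine ⟨div_ne_zero (by norm_num) hw.1, fun hr ↦ hw.2 ?_⟩
  rw [← mob_heckeT] at hr
  have := (hr.slash k (by rw [mobDen_heckeT]; exact hw.1)).neg
  rwa [h.slash_heckeT, neg_neg] at this

lemma IsRPF.exists_next_pole (hp : 3 ≤ p) (h : IsRPF p k q) {w : ℂ} (hw : w ∈ nonzeroPoles q)
    (hr : RightHalf w) : ∃ t, (1 ≤ t ∧ t < p) ∧ mob (heckeV p t) w ∈ nonzeroPoles q := by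
  by_contra! hcon
  rw [mem_nonzeroPoles] at hw
  apply hw.2
  rw [h.eq_sum_heckeV hp]
  refine RegularAt.sum _ fun t ht ↦ ?_
  rw [Finset.mem_Ico] at ht
  have h1 := hcon t ht
  rw [mem_nonzeroPoles, not_and, not_not] at h1
  exact (h1 (hr.mob_heckeV hp ht).2).slash k (mobDen_heckeV_ne hp ht hr.1)

lemma exists_iterate_eq {α : Type*} [Finite α] {σ : α → α} (hσ : Function.Injective σ) (x : α) :
    ∃ n, 0 < n ∧ σ^[n] x = x := by
  obtain ⟨m, n, hmn, h⟩ := Finite.exists_ne_map_eq_of_infinite fun n : ℕ ↦ σ^[n] x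
  wlog hlt : m < n generalizing m n
  · exact this n m hmn.symm h.symm (lt_of_le_of_ne (not_lt.mp hlt) hmn.symm)
  obtain ⟨j, rfl⟩ := Nat.exists_eq_add_of_lt hlt
  refine ⟨j + 1, Nat.succ_pos j, ?_⟩
  have h' : σ^[m] x = σ^[m + (j + 1)] x := h
  rw [Function.iterate_add_apply] at h'
  exact (hσ.iterate m h').symm

/-- The nonzero poles of `q` in the closed right half plane. -/
abbrev RightPole (q : RatFunc ℂ) : Type := {w : ℂ // w ∈ nonzeroPoles q ∧ RightHalf w}

lemma rightPole_finite (q : RatFunc ℂ) : Finite (RightPole q) :=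
  ((nonzeroPoles_finite q).subset fun _ hw ↦ hw.1 :
    {w | w ∈ nonzeroPoles q ∧ RightHalf w}.Finite)

/-- The poles in the closed right half plane are permuted by a map which is `V_t` at each pole,
and modulo regular functions `q` is invariant under this map. -/
lemma IsRPF.exists_shift (hp : 3 ≤ p) (h : IsRPF p k q) :
    ∃ (σ : RightPole q → RightPole q)
      (τ : RightPole q → ℕ), Function.Injective σ ∧
      Function.Surjective σ ∧ (∀ x, (1 ≤ τ x ∧ τ x < p) ∧ (σ x : ℂ) = mob (heckeV p (τ x)) (x : ℂ)) ∧
      ∀ x : RightPole q, RegularAt (x : ℂ) (q - slash k q (heckeV p (τ x))) := by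
  have hfin := rightPole_finite q
  have hex : ∀ x : RightPole q,
      ∃ t, (1 ≤ t ∧ t < p) ∧ mob (heckeV p t) (x : ℂ) ∈ nonzeroPoles q :=
    fun x ↦ h.exists_next_pole hp x.2.1 x.2.2
  choose τ hτ hτ' using hex
  set σ : RightPole q → RightPole q :=
    fun x ↦ ⟨mob (heckeV p (τ x)) (x : ℂ), hτ' x, x.2.2.mob_heckeV hp (hτ x)⟩ with hσ
  have hinj : Function.Injective σ := by
    intro x y hxy
    exact Subtype.ext
      (heckeV_unique hp (hτ x) (hτ y) x.2.2 y.2.2 (congrArg Subtype.val hxy)).2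
  have hsurj : Function.Surjective σ := Finite.injective_iff_surjective.mp hinj
  refine ⟨σ, τ, hinj, hsurj, fun x ↦ ⟨hτ x, rfl⟩, fun x ↦ ?_⟩
  have hsum := h.eq_sum_heckeV hp
  rw [← Finset.add_sum_erase _ _ (Finset.mem_Ico.mpr (hτ x))] at hsum
  -- The difference is the sum over t ≠ τ(x). A singular term would make V_t x a pole; by
  -- surjectivity it is σ(y), and disjointness of the images gives y = x and t = τ(x).
  rw [sub_eq_of_eq_add' hsum]
  refine RegularAt.sum _ fun t ht ↦ ?_
  rw [Finset.mem_erase, Finset.mem_Ico] at ht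
  by_contra hreg
  have hmem : mob (heckeV p t) (x : ℂ) ∈ nonzeroPoles q := by
    by_contra h1
    rw [mem_nonzeroPoles, not_and, not_not] at h1
    exact hreg ((h1 (x.2.2.mob_heckeV hp ht.2).2).slash k (mobDen_heckeV_ne hp ht.2 x.2.2.1))
  obtain ⟨y, hy⟩ := hsurj ⟨_, hmem, x.2.2.mob_heckeV hp ht.2⟩
  obtain ⟨h2, h3⟩ := heckeV_unique hp (hτ y) ht.2 y.2.2 x.2.2 (congrArg Subtype.val hy)
  obtain rfl := Subtype.ext h3
  exact ht.1 h2.symm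

/-- Follow the permutation until it returns to w and record the letters; the regular differences q -
q|V_t telescope along the orbit. -/
lemma IsRPF.exists_word_fixing_pole (hp : 3 ≤ p) (h : IsRPF p k q) {w : ℂ}
    (hw : w ∈ nonzeroPoles q) (hr : RightHalf w) :
    ∃ l, Admissible p l ∧ l ≠ [] ∧ mob (wordProd p l) w = w ∧
      RegularAt w (q - slash k q (wordProd p l)) := by
  obtain ⟨σ, τ, hinj, -, hστ, hreg⟩ := h.exists_shift hp
  have := rightPole_finite q
  have hiter : ∀ (n : ℕ) (x : RightPole q), ∃ l, Admissible p l ∧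
      l.length = n ∧ (σ^[n] x : ℂ) = mob (wordProd p l) (x : ℂ) ∧
      RegularAt (x : ℂ) (q - slash k q (wordProd p l)) := by
    intro n
    induction n with
    | zero => exact fun x ↦ ⟨[], admissible_nil, rfl, by simp, by simpa using RegularAt.zero _⟩
    | succ n ih =>
      intro x
      obtain ⟨l, hl, hlen, hval, hregl⟩ := ih x
      have hd := mobDen_wordProd_ne hp hl x.2.2.1
      refine ⟨τ (σ^[n] x) :: l, admissible_cons.mpr ⟨(hστ _).1, hl⟩, by simp [hlen], ?_, ?_⟩
      · rw [Function.iterate_succ_apply', (hστ _).2, hval, wordProd_cons, mob_mul _ _ hd]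
      · have h1 := hreg (σ^[n] x)
        rw [hval] at h1
        have h2 := hregl.add (h1.slash k hd)
        rwa [slash_sub, slash_slash, ← wordProd_cons, sub_add_sub_cancel] at h2
  obtain ⟨n, hn, hper⟩ := exists_iterate_eq hinj ⟨w, hw, hr⟩
  obtain ⟨l, hl, hlen, hval, hregl⟩ := hiter n ⟨w, hw, hr⟩
  refine ⟨l, hl, ?_, ?_, hregl⟩
  · rintro rfl
    simp at hlen
    omega
  · rw [← hval, hper]

/-- Surjectivity of the permutation propagates poles backwards along the letters. -/
lemma IsRPF.mem_of_heckeV_mem (hp : 3 ≤ p) (h : IsRPF p k q) {w : ℂ} (hr : RightHalf w) {t : ℕ}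
    (ht : 1 ≤ t ∧ t < p) (hw : mob (heckeV p t) w ∈ nonzeroPoles q) : w ∈ nonzeroPoles q := by
  obtain ⟨σ, τ, -, hsurj, hστ, -⟩ := h.exists_shift hp
  obtain ⟨y, hy⟩ := hsurj ⟨_, hw, hr.mob_heckeV hp ht⟩
  have hy' := congrArg Subtype.val hy
  rw [(hστ y).2] at hy'
  obtain ⟨-, rfl⟩ := heckeV_unique hp (hστ y).1 ht y.2.2 hr hy'
  exact y.2.1

lemma IsRPF.mem_of_wordProd_mem (hp : 3 ≤ p) (h : IsRPF p k q) {x : ℝ} (hx : 0 < x)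
    {l : List ℕ} (hl : Admissible p l)
    (hw : ((mob (wordProd p l) x : ℝ) : ℂ) ∈ nonzeroPoles q) : (x : ℂ) ∈ nonzeroPoles q := by
  induction l with
  | nil => simpa using hw
  | cons t l ih =>
    rw [admissible_cons] at hl
    rw [mob_wordProd_cons hp hl.2 hx.le, ← mob_ofReal] at hw
    exact ih hl.2 (h.mem_of_heckeV_mem hp
      (rightHalf_ofReal.mpr (mob_wordProd_pos hp hl.2 hx)) hl.1 hw)

lemma IsRPF.pole_of_rightHalf (hp : 3 ≤ p) (h : IsRPF p k q) {w : ℂ} (hw : w ∈ nonzeroPoles q)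
    (hr : RightHalf w) : ∃ x : ℝ, IsSimple p x ∧ w = x := by
  obtain ⟨l, hl, hne, hfix, -⟩ := h.exists_word_fixing_pole hp hw hr
  obtain ⟨-, -, x, hx, rfl⟩ := fixed_wordProd_real hp hl hne hr hfix
  rw [mob_ofReal, Complex.ofReal_inj] at hfix
  exact ⟨x, IsPeriodic.isSimple hp ⟨hx, l, hl, hne, hfix⟩, rfl⟩

/-- The nonzero poles of a rational period function are the numbers `x` and `-1 / x` for certain
simple points `x`. -/
lemma IsRPF.exists_simple_pole (hp : 3 ≤ p) (h : IsRPF p k q) {w : ℂ}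
    (hw : w ∈ nonzeroPoles q) :
    ∃ x : ℝ, IsSimple p x ∧ (x : ℂ) ∈ nonzeroPoles q ∧ (w = x ∨ w = ((-1 / x : ℝ) : ℂ)) := by
  have hw0 : w ≠ 0 := (mem_nonzeroPoles.mp hw).1
  rcases le_total 0 w.re with hre | hre
  · obtain ⟨x, hx, rfl⟩ := h.pole_of_rightHalf hp hw ⟨hre, hw0⟩
    exact ⟨x, hx, hw, Or.inl rfl⟩
  · have h1 := h.neg_one_div_mem hw
    obtain ⟨x, hx, hwx⟩ := h.pole_of_rightHalf hp h1 ⟨by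
      rw [Complex.div_re]
      have := Complex.normSq_nonneg w
      have := div_nonneg (neg_nonneg.mpr hre) this
      simpa using this, (mem_nonzeroPoles.mp h1).1⟩
    refine ⟨x, hx, hwx ▸ h1, Or.inr ?_⟩
    push_cast
    rw [← hwx]
    field_simp

/-- Each y in Z_𝒜 satisfies x = Py for a word P, so the pole at x propagates back to y; T then
supplies -1/y. -/
lemma IsRPF.poleSystem_subset (hp : 3 ≤ p) (h : IsRPF p k q) {𝒜 : Set BQF}
    (h𝒜 : IsFormClass p 𝒜) {x : ℝ} (hx : x ∈ simpleNumbers p 𝒜)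
    (hmem : (x : ℂ) ∈ nonzeroPoles q) : poleSystem p 𝒜 ⊆ nonzeroPoles q := by
  rintro w ⟨y, hy, hw⟩
  obtain ⟨l, hl, rfl⟩ := exists_word_of_mem_class hp h𝒜 hx hy
  have hy' := h.mem_of_wordProd_mem hp ((mem_simpleNumbers.mp hy).1.pos hp) hl hmem
  rcases hw with rfl | rfl
  · exact hy'
  · have := h.neg_one_div_mem hy'
    push_cast
    exact this

/-! ### The principal part at a pole -/

lemma hasValueAt_X_sub (w a : ℂ) : HasValueAt w (RatFunc.X - RatFunc.C a) (w - a) :=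
  (HasValueAt.X w).sub (HasValueAt.const w a)

lemma X_sub_C_ne_zero (a : ℂ) : (RatFunc.X - RatFunc.C a : RatFunc ℂ) ≠ 0 := by
  intro h
  have := hasValueAt_X_sub (a + 1) a
  rw [h] at this
  simpa using this.unique (.zero _)

lemma HasValueAt.exists_eq_X_sub_mul {w : ℂ} {f : RatFunc ℂ} (h : HasValueAt w f 0) :
    ∃ g, RegularAt w g ∧ f = (RatFunc.X - RatFunc.C w) * g := by
  obtain ⟨P, Q, hQ, rfl, h0⟩ := h
  have hP : P.IsRoot w := by
    rcases div_eq_zero_iff.mp h0.symm with h | h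
    · exact h
    · exact absurd h hQ
  obtain ⟨R, rfl⟩ := Polynomial.dvd_iff_isRoot.mpr hP
  refine ⟨algebraMap (Polynomial ℂ) (RatFunc ℂ) R / algebraMap (Polynomial ℂ) (RatFunc ℂ) Q, ⟨_, R, Q, hQ, rfl, rfl⟩, ?_⟩
  rw [map_mul, mul_div_assoc]
  simp

lemma RegularAt.hasValueAt_X_sub_pow_mul {w : ℂ} {f : RatFunc ℂ} (h : RegularAt w f) {n : ℕ}
    (hn : n ≠ 0) : HasValueAt w ((RatFunc.X - RatFunc.C w) ^ n * f) 0 := by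
  obtain ⟨v, hv⟩ := h
  simpa [hn] using ((hasValueAt_X_sub w w).pow n).mul hv

lemma exists_regularAt_X_sub_pow_mul (w : ℂ) (f : RatFunc ℂ) :
    ∃ n : ℕ, RegularAt w ((RatFunc.X - RatFunc.C w) ^ n * f) := by
  obtain ⟨R, hR, hnd⟩ := Polynomial.exists_eq_pow_rootMultiplicity_mul_and_not_dvd f.denom
    (RatFunc.denom_ne_zero f) w
  refine ⟨f.denom.rootMultiplicity w, _, f.num, R, ?_, ?_, rfl⟩
  · rwa [Polynomial.dvd_iff_isRoot] at hnd
  · have h1 : algebraMap (Polynomial ℂ) (RatFunc ℂ) R ≠ 0 := by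
      refine RatFunc.algebraMap_ne_zero ?_
      rintro rfl
      simp at hnd
    have h2 := pow_ne_zero (f.denom.rootMultiplicity w) (X_sub_C_ne_zero w)
    have h4 := RatFunc.num_div_denom f
    have h3 : algebraMap (Polynomial ℂ) (RatFunc ℂ) f.denom =
        (RatFunc.X - RatFunc.C w) ^ f.denom.rootMultiplicity w * algebraMap _ _ R := by
      conv_lhs => rw [hR]
      simp
    rw [h3] at h4
    rw [div_eq_iff (mul_ne_zero h2 h1)] at h4
    rw [eq_div_iff h1, h4]
    ring

/-- The identity Mz - Mx = (z - x)/((cx + d)(cz + d)) with Mx = x. -/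
lemma mobComp_X_sub_C {M : SL(2, ℝ)} {x : ℝ} (h : Fixes M x) :
    mobComp M (RatFunc.X - RatFunc.C (x : ℂ)) =
      (RatFunc.X - RatFunc.C (x : ℂ)) / (RatFunc.C ((mobDen M x : ℝ) : ℂ) * linDen M) := by
  have hd : RatFunc.C ((mobDen M x : ℝ) : ℂ) ≠ 0 := by
    rw [Ne, map_eq_zero, Complex.ofReal_eq_zero]; exact h.mobDen_ne
  have hL := linDen_ne_zero M
  rw [map_sub, mobComp_X, mobComp_C, eq_div_iff (mul_ne_zero hd hL), sub_mul,
    mul_comm (RatFunc.C ((mobDen M x : ℝ) : ℂ)), ← mul_assoc, div_mul_cancel₀ _ hL]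
  have hdet := congrArg (fun r : ℝ ↦ RatFunc.C (r : ℂ)) (det_eq M)
  rw [Fixes] at h
  have hfix := congrArg (fun r : ℝ ↦ RatFunc.C (r : ℂ)) h
  simp only [Complex.ofReal_add, Complex.ofReal_sub, Complex.ofReal_mul, map_add, map_sub, map_mul,
    Complex.ofReal_one, map_one] at hdet hfix
  simp only [linNum, linDen, mobDen_real, Complex.ofReal_add, Complex.ofReal_mul, map_add, map_mul]
  linear_combination (RatFunc.X - RatFunc.C (x : ℂ)) * hdet +
    (RatFunc.C ((M 1 0 : ℝ) : ℂ) * RatFunc.X + RatFunc.C ((M 1 1 : ℝ) : ℂ)) * hfix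

/-- If the polar part of `f` at a fixed point `x` of a hyperbolic element `M` is invariant under
`M`, then it is a multiple of the polar part of any invariant function `e` with a pole of
order `k` at `x`. -/
lemma polar_part_of_invariant {M : SL(2, ℝ)} {x : ℝ} (hM : IsAttracting M x) {e : RatFunc ℂ}
    (he : slash k e M = e) {u : ℂ} (hu : u ≠ 0)
    (heu : HasValueAt (x : ℂ) ((RatFunc.X - RatFunc.C (x : ℂ)) ^ k * e) u) (n : ℕ)
    {f : RatFunc ℂ} (hn : RegularAt (x : ℂ) ((RatFunc.X - RatFunc.C (x : ℂ)) ^ n * f))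
    (hf : RegularAt (x : ℂ) (slash k f M - f)) :
    ∃ c : ℂ, RegularAt (x : ℂ) (f - RatFunc.C c * e) := by
  induction n generalizing f with
  | zero => exact ⟨0, by simpa using hn⟩
  | succ n ih =>
    obtain ⟨v, hv⟩ := hn
    have hX := X_sub_C_ne_zero (x : ℂ)
    have reduce : ∀ g : RatFunc ℂ,
        HasValueAt (x : ℂ) ((RatFunc.X - RatFunc.C (x : ℂ)) ^ (n + 1) * g) 0 →
        RegularAt (x : ℂ) ((RatFunc.X - RatFunc.C (x : ℂ)) ^ n * g) := by
      intro g hg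
      obtain ⟨r, hr, hgr⟩ := hg.exists_eq_X_sub_mul
      rw [pow_succ', mul_assoc] at hgr
      rwa [mul_left_cancel₀ hX hgr]
    by_cases hnk : n + 1 = k
    · subst hnk
      have h1 : HasValueAt (x : ℂ) ((RatFunc.X - RatFunc.C (x : ℂ)) ^ (n + 1) *
          (f - RatFunc.C (v / u) * e)) 0 := by
        have := hv.sub ((HasValueAt.const _ (v / u)).mul heu)
        rw [div_mul_cancel₀ _ hu, sub_self] at this
        convert this using 1
        ring
      obtain ⟨c, hc⟩ := ih (reduce _ h1) (by
        rw [slash_sub, slash_C_mul, he]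
        convert hf using 1
        ring)
      refine ⟨v / u + c, ?_⟩
      convert hc using 1
      rw [map_add]
      ring
    -- With μ = cx + d, the leading coefficient v of order n + 1 satisfies v μ^(2(n+1) - 2k) = v. As
    -- |μ| > 1, v = 0 unless n + 1 = k.
    · refine ih (reduce _ ?_) hf
      suffices hv0 : v = 0 by rwa [hv0] at hv
      have hfx := hM.1
      have hd : mobDen M (x : ℂ) ≠ 0 := by
        rw [mobDen_ofReal, Ne, Complex.ofReal_eq_zero]; exact hfx.mobDen_ne
      have hL := linDen_ne_zero M
      have hmuC : RatFunc.C ((mobDen M x : ℝ) : ℂ) ≠ 0 := by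
        rw [Ne, map_eq_zero, Complex.ofReal_eq_zero]; exact hfx.mobDen_ne
      have h1 : HasValueAt (x : ℂ)
          (mobComp M ((RatFunc.X - RatFunc.C (x : ℂ)) ^ (n + 1) * f)) v := by
        refine HasValueAt.mobComp hd ?_
        rwa [mob_ofReal, hfx.mob_eq]
      have h2 : (RatFunc.X - RatFunc.C (x : ℂ)) ^ (n + 1) * slash k f M =
          (linDen M ^ (2 * k))⁻¹ * (RatFunc.C ((mobDen M x : ℝ) : ℂ) * linDen M) ^ (n + 1) *
            mobComp M ((RatFunc.X - RatFunc.C (x : ℂ)) ^ (n + 1) * f) := by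
        rw [map_mul, map_pow, mobComp_X_sub_C hfx, slash_eq, div_pow]
        field_simp
      have h3 := (((((hasValueAt_linDen M (x : ℂ)).pow (2 * k)).inv (pow_ne_zero _ hd)).mul
        (((HasValueAt.const (x : ℂ) ((mobDen M x : ℝ) : ℂ)).mul
          (hasValueAt_linDen M (x : ℂ))).pow (n + 1))).mul h1).sub hv
      rw [← h2, ← mul_sub] at h3
      have h4 := h3.unique (hf.hasValueAt_X_sub_pow_mul n.succ_ne_zero)
      rw [mobDen_ofReal] at h4
      by_contra hv0
      have hm := hfx.mobDen_ne
      have h5 : (((mobDen M x : ℝ) : ℂ) ^ (2 * k))⁻¹ *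
          (((mobDen M x : ℝ) : ℂ) * ((mobDen M x : ℝ) : ℂ)) ^ (n + 1) = 1 := by
        apply mul_right_cancel₀ hv0
        linear_combination h4
      rw [inv_mul_eq_one₀ (pow_ne_zero _ (by exact_mod_cast hm)), ← pow_two, ← pow_mul] at h5
      have h6 : mobDen M x ^ (2 * k) = mobDen M x ^ (2 * (n + 1)) := by exact_mod_cast h5
      have h7 := congrArg abs h6
      rw [abs_pow, abs_pow] at h7
      have := pow_right_injective₀ (zero_lt_one.trans hM.one_lt) hM.one_lt.ne' h7
      omega

end

end

noncomputable section

open scoped MatrixGroups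

open SLTwo

section

variable {p k : ℕ}

/-! ### Linear combinations of rational period functions -/

namespace IsRPF

variable {q r : RatFunc ℂ}

lemma zero : IsRPF p k 0 := by simp [IsRPF]

lemma add (hq : IsRPF p k q) (hr : IsRPF p k r) : IsRPF p k (q + r) := by
  refine ⟨?_, ?_⟩
  · rw [slash_add, add_add_add_comm, hq.1, hr.1, add_zero]
  · simp only [slash_add, Finset.sum_add_distrib, hq.2, hr.2, add_zero]

lemma C_mul (c : ℂ) (hq : IsRPF p k q) : IsRPF p k (RatFunc.C c * q) := by
  refine ⟨?_, ?_⟩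
  · rw [slash_C_mul, ← mul_add, hq.1, mul_zero]
  · simp only [slash_C_mul, ← Finset.mul_sum, hq.2, mul_zero]

lemma sub (hq : IsRPF p k q) (hr : IsRPF p k r) : IsRPF p k (q - r) := by
  have := hq.add (hr.C_mul (-1))
  rwa [map_neg, map_one, neg_one_mul, ← sub_eq_add_neg] at this

lemma sum {ι : Type*} (s : Finset ι) {F : ι → RatFunc ℂ} (h : ∀ i ∈ s, IsRPF p k (F i)) :
    IsRPF p k (∑ i ∈ s, F i) := by
  classical
  induction s using Finset.induction_on with
  | empty => simpa using zero
  | insert a s ha ih =>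
    rw [Finset.sum_insert ha]
    exact (h a (Finset.mem_insert_self a s)).add
      (ih fun i hi ↦ h i (Finset.mem_insert_of_mem hi))

end IsRPF

/-! ### Poles of the powers of a form -/

lemma toRatFunc_hyperbolicForm (hp : 3 ≤ p) {x : ℝ} (hx : IsHyperbolicPoint p x) :
    (hyperbolicForm p x).toRatFunc = RatFunc.C ((hyperbolicElt p x 1 0 : ℝ) : ℂ) *
      ((RatFunc.X - RatFunc.C (x : ℂ)) * (RatFunc.X - RatFunc.C ((heckeConj p x : ℝ) : ℂ))) := by
  have h1 := lower_mul_heckeConj hp hx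
  have h2 := (hyperbolicElt_spec hp hx).2.2.2.1
  rw [Fixes] at h2
  have hB : (hyperbolicForm p x).B = -(hyperbolicElt p x 1 0 * (heckeConj p x + x)) := by
    rw [h1]; simp only [hyperbolicForm, BQF.ofMatrix]; ring
  have hC : (hyperbolicForm p x).C = hyperbolicElt p x 1 0 * (x * heckeConj p x) := by
    simp only [hyperbolicForm, BQF.ofMatrix]; linear_combination -h2 - x * h1
  have hA : (hyperbolicForm p x).A = hyperbolicElt p x 1 0 := rfl
  rw [BQF.toRatFunc, hA, hB, hC]
  simp only [Complex.ofReal_neg, Complex.ofReal_mul, Complex.ofReal_add, map_neg, map_mul, map_add]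
  ring

lemma regularAt_inv_form (hp : 3 ≤ p) {x : ℝ} (hx : IsHyperbolicPoint p x) {w : ℂ}
    (h1 : w ≠ x) (h2 : w ≠ (heckeConj p x : ℝ)) :
    RegularAt w ((hyperbolicForm p x).toRatFunc ^ k)⁻¹ := by
  rw [toRatFunc_hyperbolicForm hp hx]
  have hc : ((hyperbolicElt p x 1 0 : ℝ) : ℂ) ≠ 0 := by
    exact_mod_cast hyperbolicElt_lower_ne_zero hp hx
  exact ⟨_, (((HasValueAt.const _ _).mul ((hasValueAt_X_sub w _).mul
    (hasValueAt_X_sub w _))).pow k).inv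
    (pow_ne_zero _ (mul_ne_zero hc (mul_ne_zero (sub_ne_zero.mpr h1) (sub_ne_zero.mpr h2))))⟩

lemma hasValueAt_inv_form (hp : 3 ≤ p) (k : ℕ) {x : ℝ} (hx : IsHyperbolicPoint p x) :
    ∃ u : ℂ, u ≠ 0 ∧ HasValueAt (x : ℂ) ((RatFunc.X - RatFunc.C (x : ℂ)) ^ k *
      ((hyperbolicForm p x).toRatFunc ^ k)⁻¹) u := by
  have hc : ((hyperbolicElt p x 1 0 : ℝ) : ℂ) ≠ 0 := by
    exact_mod_cast hyperbolicElt_lower_ne_zero hp hx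
  have hne : (x : ℂ) - (heckeConj p x : ℝ) ≠ 0 := by
    rw [sub_ne_zero]; exact_mod_cast (heckeConj_ne hp hx).symm
  have hX := X_sub_C_ne_zero (x : ℂ)
  have h0 := pow_ne_zero k (mul_ne_zero hc hne)
  refine ⟨_, inv_ne_zero h0, ?_⟩
  have := (((HasValueAt.const (x : ℂ) ((hyperbolicElt p x 1 0 : ℝ) : ℂ)).mul
    (hasValueAt_X_sub (x : ℂ) ((heckeConj p x : ℝ) : ℂ))).pow k).inv h0
  convert this using 1
  rw [toRatFunc_hyperbolicForm hp hx, mul_left_comm, mul_pow, mul_inv,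
    mul_inv_cancel_left₀ (pow_ne_zero k hX)]

lemma not_regularAt_inv_form (hp : 3 ≤ p) (hk : k ≠ 0) {x : ℝ} (hx : IsHyperbolicPoint p x) :
    ¬ RegularAt (x : ℂ) ((hyperbolicForm p x).toRatFunc ^ k)⁻¹ := by
  intro h
  obtain ⟨u, hu, hval⟩ := hasValueAt_inv_form hp k hx
  exact hu (hval.unique (h.hasValueAt_X_sub_pow_mul hk))

/-! ### Sums over sets of simple points -/

/-- `∑_{x ∈ Z} Q_x(z, 1)^(-k)`. -/
def formSum (p k : ℕ) (Z : Finset ℝ) : RatFunc ℂ :=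
  ∑ x ∈ Z, ((hyperbolicForm p x).toRatFunc ^ k)⁻¹

lemma sum_range_shift {A : Type*} [AddCommGroup A] {g : ℕ → A} {p : ℕ}
    (hg : ∀ t, g (t + p) = g t) (r : ℕ) :
    ∑ t ∈ Finset.range p, g (t + r) = ∑ t ∈ Finset.range p, g t := by
  induction r with
  | zero => rfl
  | succ r ih =>
    rw [← ih]
    have h1 := Finset.sum_range_succ' (fun t ↦ g (t + r)) p
    rw [Finset.sum_range_succ] at h1
    have h2 : g (p + r) = g (0 + r) := by rw [add_comm p, hg, zero_add]
    rw [h2, add_left_inj] at h1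
    rw [h1]
    exact Finset.sum_congr rfl fun t _ ↦ by congr 1; omega

/-- Both relations hold by sign-reversing reindexing: of Z under x ↦ Tx' for the first, and of Z
under a further permutation y for the second. -/
lemma isRPF_formSum (hp : 3 ≤ p) (hk : Odd k) {Z : Finset ℝ} (hZ : ∀ x ∈ Z, IsSimple p x)
    (hnext : ∀ x ∈ Z, ∃ t, (1 ≤ t ∧ t < p) ∧ mob (heckeV p t) x ∈ Z)
    (hstar : ∀ x ∈ Z, heckeStar p x ∈ Z) : IsRPF p k (formSum p k Z) := by
  have hss : ∀ x ∈ Z, heckeStar p (heckeStar p x) = x :=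
    fun x hx ↦ heckeStar_heckeStar hp (hZ x hx).1
  refine ⟨?_, ?_⟩
  · rw [formSum, slash_sum]
    have h1 : ∑ x ∈ Z, slash k ((hyperbolicForm p x).toRatFunc ^ k)⁻¹ heckeT =
        ∑ x ∈ Z, -((hyperbolicForm p x).toRatFunc ^ k)⁻¹ := by
      refine Finset.sum_nbij' (heckeStar p) (heckeStar p) hstar hstar hss hss fun x hx ↦ ?_
      rw [slash_toRatFunc, hyperbolicForm_act_heckeT hp (hZ x hx).1, inv_pow_toRatFunc_neg hk]
    rw [h1, Finset.sum_neg_distrib, add_neg_cancel]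
  · choose! τ hτ hτ' using hnext
    set G : ℝ → ℕ → RatFunc ℂ := fun x t ↦
      (((hyperbolicForm p x).act (heckeU p ^ t)).toRatFunc ^ k)⁻¹ with hG
    have hper : ∀ x t, G x (t + p) = G x t := by
      intro x t
      simp only [hG, pow_add, heckeU_pow_self hp, mul_neg_one, BQF.act_neg]
    -- With x* = Tx' and y = V_τ x*, one gets Q_y ∘ U^τ = Q_{x*} ∘ T = -Q_x. Because U^p = -1, the
    -- shift by τ disappears in a sum over a full period of exponents, so the x-part of the total is
    -- minus its y-part. Since y permutes Z, the total equals its own negative.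
    set y : ℝ → ℝ := fun x ↦ mob (heckeV p (τ (heckeStar p x))) (heckeStar p x) with hy
    have hymem : ∀ x ∈ Z, y x ∈ Z := fun x hx ↦ hτ' _ (hstar x hx)
    have hyinj : Set.InjOn y Z := by
      intro a ha b hb hab
      have := (heckeV_unique_real hp (hτ _ (hstar a ha)) (hτ _ (hstar b hb))
        ((hZ _ (hstar a ha)).pos hp) ((hZ _ (hstar b hb)).pos hp) hab).2
      rw [← hss a ha, this, hss b hb]
    have hG1 : ∀ x ∈ Z, ∀ t, G x t = -G (y x) (t + τ (heckeStar p x)) := by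
      intro x hx t
      have h1 := hyperbolicForm_mob hp (hZ _ (hstar x hx)).1
        (heckeV_mem (p := p) (τ (heckeStar p x)))
      have h2 : (hyperbolicForm p (y x)).act (heckeU p ^ τ (heckeStar p x)) =
          (hyperbolicForm p x).neg := by
        have h3 := congrArg (fun Q : BQF ↦ Q.act (heckeV p (τ (heckeStar p x)))) h1
        simp only [BQF.act_inv_act] at h3
        rw [heckeV, BQF.act_mul] at h3
        have h4 := congrArg (fun Q : BQF ↦ Q.act heckeT) h3
        simp only [BQF.act_inv_act] at h4
        rw [← heckeV] at h4
        rw [hy]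
        simp only
        rw [h4, hyperbolicForm_act_heckeT hp (hZ _ (hstar x hx)).1, hss x hx]
      simp only [hG]
      rw [add_comm t, pow_add, BQF.act_mul, h2, BQF.neg_act, inv_pow_toRatFunc_neg hk, neg_neg]
    have hH : ∀ x ∈ Z, ∑ t ∈ Finset.range p, G x t = -∑ t ∈ Finset.range p, G (y x) t := by
      intro x hx
      rw [← sum_range_shift (hper (y x)) (τ (heckeStar p x)), ← Finset.sum_neg_distrib]
      exact Finset.sum_congr rfl fun t _ ↦ hG1 x hx t
    have hbij : ∑ x ∈ Z, ∑ t ∈ Finset.range p, G (y x) t = ∑ x ∈ Z, ∑ t ∈ Finset.range p, G x t :=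
      Finset.sum_nbij y hymem hyinj
        (Finset.surjOn_of_injOn_of_card_le y hymem hyinj le_rfl) fun _ _ ↦ rfl
    have hsum : ∑ x ∈ Z, ∑ t ∈ Finset.range p, G x t = 0 := by
      have h1 : ∑ x ∈ Z, ∑ t ∈ Finset.range p, G x t =
          -∑ x ∈ Z, ∑ t ∈ Finset.range p, G x t := by
        conv_rhs => rw [← hbij, ← Finset.sum_neg_distrib]
        exact Finset.sum_congr rfl hH
      exact self_eq_neg.mp h1
    rw [← hsum, Finset.sum_comm]
    refine Finset.sum_congr rfl fun t _ ↦ ?_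
    rw [formSum, slash_sum]
    exact Finset.sum_congr rfl fun x _ ↦ slash_toRatFunc _ _ _

lemma regularAt_formSum (hp : 3 ≤ p) {Z : Finset ℝ} (hZ : ∀ x ∈ Z, IsSimple p x) {w : ℂ}
    (h : ∀ x ∈ Z, w ≠ x ∧ w ≠ (heckeConj p x : ℝ)) : RegularAt w (formSum p k Z) :=
  RegularAt.sum _ fun x hx ↦ regularAt_inv_form hp (hZ x hx).1 (h x hx).1 (h x hx).2

/-- At a point `x ∈ Z` the only singular term of the sum is the one belonging to `x`. -/
lemma regularAt_formSum_sub (hp : 3 ≤ p) {Z : Finset ℝ} (hZ : ∀ x ∈ Z, IsSimple p x) {x : ℝ}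
    (hx : x ∈ Z) :
    RegularAt (x : ℂ) (formSum p k Z - ((hyperbolicForm p x).toRatFunc ^ k)⁻¹) := by
  rw [formSum, ← Finset.add_sum_erase _ _ hx, add_sub_cancel_left]
  refine RegularAt.sum _ fun y hy ↦ ?_
  rw [Finset.mem_erase] at hy
  refine regularAt_inv_form hp (hZ y hy.2).1 ?_ ?_
  · exact_mod_cast hy.1.symm
  · have h1 := (hZ x hx).pos hp
    have h2 := (hZ y hy.2).heckeConj_neg hp
    exact_mod_cast (h2.trans h1).ne'

lemma mem_nonzeroPoles_formSum (hp : 3 ≤ p) (hk : k ≠ 0) {Z : Finset ℝ}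
    (hZ : ∀ x ∈ Z, IsSimple p x) {x : ℝ} (hx : x ∈ Z) :
    (x : ℂ) ∈ nonzeroPoles (formSum p k Z) := by
  rw [mem_nonzeroPoles]
  refine ⟨by exact_mod_cast ((hZ x hx).pos hp).ne', fun h ↦ ?_⟩
  have := h.sub (regularAt_formSum_sub (k := k) hp hZ hx)
  rw [sub_sub_cancel] at this
  exact not_regularAt_inv_form hp hk (hZ x hx).1 this

/-! ### Rational period functions without nonzero poles -/

lemma slash_const_one (k : ℕ) (M : SL(2, ℝ)) : slash k 1 M = (linDen M ^ (2 * k))⁻¹ := by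
  rw [slash_eq, map_one, mul_one]

lemma linDen_heckeT : linDen heckeT = RatFunc.X := by
  obtain ⟨a, b, c, d⟩ := heckeT_entries
  simp [linDen, c, d]

lemma linNum_heckeT : linNum heckeT = -1 := by
  obtain ⟨a, b, c, d⟩ := heckeT_entries
  simp [linNum, a, b]

/-- As 1|S = 1, the function is 1 - 1|U, a coboundary for U; its sum over powers of U telescopes to
1 - 1|U^p = 0. -/
lemma isRPF_one_sub (hp : 3 ≤ p) (k : ℕ) : IsRPF p k (1 - (RatFunc.X ^ (2 * k))⁻¹) := by
  have e : (RatFunc.X ^ (2 * k) : RatFunc ℂ)⁻¹ = slash k 1 heckeT := by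
    rw [slash_const_one, linDen_heckeT]
  have hU : slash k 1 heckeT = slash k 1 (heckeU p) := by
    obtain ⟨a, b, c, d⟩ := heckeS_entries p
    have hS : slash k 1 (heckeS p) = 1 := by
      rw [slash_const_one, linDen, c, d]; simp
    rw [heckeU, ← slash_slash, hS]
  refine ⟨?_, ?_⟩
  · rw [e, slash_sub, slash_slash, heckeT_mul_self, slash_neg_matrix, slash_one]
    ring
  · rw [e, hU]
    simp only [slash_sub, slash_slash, ← pow_succ']
    rw [Finset.sum_range_sub' (fun t ↦ slash k 1 (heckeU p ^ t)), heckeU_pow_self hp,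
      slash_neg_matrix, pow_zero, sub_self]

/-- The numerator of U^t is the denominator of U^(t+1), so each summand is the reciprocal of a
product of consecutive denominators. The determinant identity splits it into a difference of
consecutive terms, and `sinRatio` vanishes at both 0 and p. -/
lemma isRPF_inv_X (hp : 3 ≤ p) : IsRPF p 1 RatFunc.X⁻¹ := by
  have hform : ∀ M : SL(2, ℝ), slash 1 RatFunc.X⁻¹ M = (linDen M * linNum M)⁻¹ := by
    intro M
    have := linDen_ne_zero M
    rw [slash_eq, map_inv₀, mobComp_X]
    field_simp
  refine ⟨?_, ?_⟩
  · rw [hform, linDen_heckeT, linNum_heckeT, mul_neg_one, inv_neg, add_neg_cancel]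
  · have hnum : ∀ t : ℕ, linNum (heckeU p ^ t) = linDen (heckeU p ^ (t + 1)) := by
      intro t
      obtain ⟨a, b, -, -⟩ := heckeU_pow_entries hp t
      obtain ⟨-, -, c, d⟩ := heckeU_pow_entries hp (t + 1)
      rw [linNum, linDen, a, b, c, d]
      push_cast
      rw [add_sub_cancel_right]
    set F : ℕ → RatFunc ℂ := fun t ↦
      RatFunc.C ((sinRatio p t : ℝ) : ℂ) / linDen (heckeU p ^ t) with hF
    have hterm : ∀ t : ℕ, slash 1 RatFunc.X⁻¹ (heckeU p ^ t) = F (t + 1) - F t := by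
      intro t
      have h1 := linDen_ne_zero (heckeU p ^ t)
      have h2 := linDen_ne_zero (heckeU p ^ (t + 1))
      rw [hform, hnum, hF]
      simp only
      rw [div_sub_div _ _ h2 h1, inv_eq_one_div, mul_comm (linDen (heckeU p ^ t))]
      congr 1
      obtain ⟨-, -, a, b⟩ := heckeU_pow_entries hp t
      obtain ⟨-, -, c, d⟩ := heckeU_pow_entries hp (t + 1)
      rw [linDen, linDen, a, b, c, d]
      have hdet := congrArg (fun r : ℝ ↦ RatFunc.C (r : ℂ)) (sinRatio_det hp t)
      push_cast at hdet ⊢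
      rw [add_sub_cancel_right]
      simp only [map_sub, map_mul, map_one, map_neg] at hdet ⊢
      linear_combination -hdet
    rw [Finset.sum_congr rfl fun t _ ↦ hterm t, Finset.sum_range_sub]
    simp [hF, sinRatio_self hp]

lemma IsZeroPoleRPF.isRPF (hp : 3 ≤ p) {r : RatFunc ℂ} (h : IsZeroPoleRPF k r) :
    IsRPF p k r := by
  obtain ⟨a₀, b₁, rfl⟩ := h
  refine ((isRPF_one_sub hp k).C_mul a₀).add ?_
  split_ifs with hk
  · subst hk; exact (isRPF_inv_X hp).C_mul b₁
  · exact IsRPF.zero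

lemma regularAt_one_sub {w : ℂ} (hw : w ≠ 0) (k : ℕ) :
    RegularAt w (1 - (RatFunc.X ^ (2 * k))⁻¹) :=
  ⟨_, (HasValueAt.one w).sub (((HasValueAt.X w).pow _).inv (pow_ne_zero _ hw))⟩

lemma IsZeroPoleRPF.regularAt {r : RatFunc ℂ} (h : IsZeroPoleRPF k r) {w : ℂ} (hw : w ≠ 0) :
    RegularAt w r := by
  obtain ⟨a₀, b₁, rfl⟩ := h
  refine ((RegularAt.const w a₀).mul (regularAt_one_sub hw k)).add ?_
  split_ifs with hk
  · exact ⟨_, (HasValueAt.const w b₁).mul ((HasValueAt.X w).inv hw)⟩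
  · exact RegularAt.zero w

end

end

noncomputable section

open scoped MatrixGroups

open SLTwo

section

variable {p k : ℕ}

/-! ### Classification of rational period functions whose only finite pole is 0. -/

lemma exists_polynomial_of_regularAt {f : RatFunc ℂ} (h : ∀ w, RegularAt w f) :
    ∃ P : Polynomial ℂ, f = algebraMap (Polynomial ℂ) (RatFunc ℂ) P := by
  have hdeg : f.denom.degree = 0 := by
    by_contra hd
    obtain ⟨w, hw⟩ := IsAlgClosed.exists_root f.denom hd
    exact regularAt_iff.mp (h w) hw
  have h1 : f.denom = 1 := by
    rw [Polynomial.eq_C_of_degree_eq_zero hdeg]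
    have := RatFunc.monic_denom f
    rw [Polynomial.eq_C_of_degree_eq_zero hdeg, Polynomial.Monic, Polynomial.leadingCoeff_C] at this
    rw [this, map_one]
  refine ⟨f.num, ?_⟩
  conv_lhs => rw [← RatFunc.num_div_denom f, h1, map_one, div_one]

/-- A rational function regular outside `0` is `P / X^n` with `n` the order of the pole at `0`. -/
lemma exists_eq_div_X_pow {r : RatFunc ℂ} (h : nonzeroPoles r = ∅) :
    ∃ (n : ℕ) (P : Polynomial ℂ),
      r = algebraMap (Polynomial ℂ) (RatFunc ℂ) P / RatFunc.X ^ n ∧ (n = 0 ∨ P.eval 0 ≠ 0) ∧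
      ∀ m, RegularAt 0 (RatFunc.X ^ m * r) → n ≤ m := by
  classical
  have hex : ∃ n : ℕ, RegularAt 0 (RatFunc.X ^ n * r) := by
    simpa using exists_regularAt_X_sub_pow_mul 0 r
  have hn := Nat.find_spec hex
  have hmin : ∀ m, RegularAt 0 (RatFunc.X ^ m * r) → Nat.find hex ≤ m :=
    fun m hm ↦ Nat.find_min' hex hm
  generalize Nat.find hex = n at hn hmin
  have hX : (RatFunc.X : RatFunc ℂ) ≠ 0 := RatFunc.X_ne_zero
  obtain ⟨P, hP⟩ := exists_polynomial_of_regularAt (f := RatFunc.X ^ n * r) fun w ↦ by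
    rcases eq_or_ne w 0 with rfl | hw
    · exact hn
    · have : w ∉ nonzeroPoles r := by simp [h]
      rw [mem_nonzeroPoles, not_and, not_not] at this
      exact RegularAt.mul ⟨_, (HasValueAt.X w).pow n⟩ (this hw)
  refine ⟨n, P, ?_, ?_, hmin⟩
  · rw [← hP, mul_div_cancel_left₀ _ (pow_ne_zero n hX)]
  · rcases n with _ | n
    · exact Or.inl rfl
    · right
      intro h0
      have hv := HasValueAt.of_polynomial 0 P
      rw [← hP, h0] at hv
      obtain ⟨g, hg, hgr⟩ := hv.exists_eq_X_sub_mul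
      rw [map_zero, sub_zero, pow_succ', mul_assoc] at hgr
      have := hmin n (mul_left_cancel₀ hX hgr ▸ hg)
      omega

/-- As w → ∞ the left side tends to P(0), so X^j P stays bounded along the positive integers and has
degree at most 0. -/
lemma eq_const_of_eval_neg_inv {P : Polynomial ℂ} {j : ℕ} {c : ℂ} (hc : c ≠ 0)
    (h : ∀ w : ℂ, w ≠ 0 → P.eval (-1 / w) = c * w ^ j * P.eval w) :
    P = 0 ∨ (j = 0 ∧ ∃ a, P = Polynomial.C a) := by
  by_cases hP : P = 0
  · exact Or.inl hP
  right
  have hdeg : (Polynomial.X ^ j * P).degree ≤ 0 := by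
    by_contra! hpos
    have h1 : Filter.Tendsto (fun n : ℕ ↦ ‖((n : ℝ) : ℂ)‖) Filter.atTop Filter.atTop := by
      simpa using tendsto_natCast_atTop_atTop (R := ℝ)
    have h2 := (Polynomial.X ^ j * P).tendsto_norm_atTop hpos h1
    have h3 : Filter.Tendsto (fun n : ℕ ↦ ‖c⁻¹ * P.eval (-1 / ((n : ℝ) : ℂ))‖) Filter.atTop
        (nhds ‖c⁻¹ * P.eval 0‖) := by
      refine (tendsto_const_nhds.mul ((P.continuous.tendsto 0).comp ?_)).norm
      have h4 : Filter.Tendsto (fun n : ℕ ↦ -1 / (n : ℂ)) Filter.atTop (nhds 0) :=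
        tendsto_const_div_atTop_nhds_zero_nat (-1 : ℂ)
      simpa using h4
    refine not_tendsto_nhds_of_tendsto_atTop h2 _ (h3.congr' ?_)
    filter_upwards [Filter.eventually_gt_atTop 0] with n hn
    have hn' : ((n : ℝ) : ℂ) ≠ 0 := by exact_mod_cast hn.ne'
    rw [h _ hn', Polynomial.eval_mul, Polynomial.eval_pow, Polynomial.eval_X]
    congr 1
    field_simp
  have hnd : (Polynomial.X ^ j * P).natDegree = 0 :=
    Polynomial.natDegree_eq_zero_iff_degree_le_zero.mpr hdeg
  rw [Polynomial.natDegree_mul (pow_ne_zero _ Polynomial.X_ne_zero) hP,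
    Polynomial.natDegree_X_pow] at hnd
  exact ⟨by omega, P.coeff 0, Polynomial.eq_C_of_natDegree_eq_zero (by omega)⟩

lemma IsRPF.eval_neg_inv {n : ℕ} {P : Polynomial ℂ} (h : IsRPF p k
    (algebraMap (Polynomial ℂ) (RatFunc ℂ) P / RatFunc.X ^ n)) (hn : n ≤ k) (w : ℂ)
    (hw : w ≠ 0) : P.eval (-1 / w) = -(-1) ^ n * w ^ (2 * k - 2 * n) * P.eval w := by
  have hd : mobDen heckeT w ≠ 0 := by rw [mobDen_heckeT]; exact hw
  have hm : mob heckeT w ≠ 0 := by rw [mob_heckeT]; exact div_ne_zero (by norm_num) hw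
  have h1 := (((hasValueAt_linDen heckeT w).pow (2 * k)).inv (pow_ne_zero _ hd)).mul
    (HasValueAt.mobComp hd ((HasValueAt.of_polynomial _ P).div ((HasValueAt.X _).pow n)
      (pow_ne_zero n hm)))
  rw [← slash_eq, h.slash_heckeT] at h1
  have h2 := ((HasValueAt.of_polynomial w P).div ((HasValueAt.X w).pow n)
      (pow_ne_zero n hw)).neg
  have h3 := h1.unique h2
  rw [mobDen_heckeT, mob_heckeT] at h3
  obtain ⟨j, rfl⟩ := Nat.exists_eq_add_of_le hn
  have e : 2 * (n + j) - 2 * n = 2 * j := by omega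
  rw [e]
  have hs : (-1 : ℂ) ^ n * (-1) ^ n = 1 := by rw [← mul_pow]; simp
  have hs0 : (-1 : ℂ) ^ n ≠ 0 := pow_ne_zero _ (by norm_num)
  have hwn := pow_ne_zero n hw
  have hwj := pow_ne_zero (2 * j) hw
  have e2 : w ^ (2 * (n + j)) = w ^ n * w ^ n * w ^ (2 * j) := by ring
  rw [div_pow, e2] at h3
  generalize P.eval (-1 / w) = a at *
  generalize P.eval w = b at *
  generalize (-1 : ℂ) ^ n = s at *
  generalize w ^ n = u at *
  generalize w ^ (2 * j) = v at *
  field_simp at h3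
  linear_combination h3

/-- Only the terms t = 0, 1 of the second relation can be singular at 0, since U^t 0 is finite and
nonzero for 2 ≤ t < p. Hence r - r|(TU) is regular there. As TU is the parabolic map z ↦ z/(1 - λz),
the z^(-n) terms cancel, and the coefficient of z^(1-n), namely P(0)(n - 2k)λ, must vanish because n
≥ 2. -/
lemma IsRPF.order_at_zero (hp : 3 ≤ p) {n : ℕ} {P : Polynomial ℂ} (h : IsRPF p k
    (algebraMap (Polynomial ℂ) (RatFunc ℂ) P / RatFunc.X ^ n)) (hn : 2 ≤ n)
    (hP : P.eval 0 ≠ 0) : n = 2 * k := by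
  set r := algebraMap (Polynomial ℂ) (RatFunc ℂ) P / RatFunc.X ^ n with hr
  have hX : (RatFunc.X : RatFunc ℂ) ≠ 0 := RatFunc.X_ne_zero
  have hlam := heckeLambda_pos hp
  -- `r - r ∣ (T U)` is regular at `0`
  have hreg : RegularAt 0 (r - slash k r (heckeT * heckeU p)) := by
    rw [← slash_slash, h.slash_heckeT, slash_neg, sub_neg_eq_add]
    have hsum := h.2
    rw [Finset.range_eq_Ico, Finset.sum_eq_sum_Ico_succ_bot (by omega),
      Finset.sum_eq_sum_Ico_succ_bot (by omega), pow_zero, slash_one, zero_add, pow_one,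
      ← add_assoc] at hsum
    rw [eq_neg_of_add_eq_zero_left hsum]
    refine (RegularAt.sum _ fun t ht ↦ ?_).neg
    rw [Finset.mem_Ico] at ht
    obtain ⟨a, b, c, d⟩ := heckeU_pow_entries hp t
    have ht1 : (2 : ℝ) ≤ t := by exact_mod_cast ht.1
    have ht2 : (t : ℝ) < p := by exact_mod_cast ht.2
    have h1 : (sinRatio p (t - 1) : ℂ) ≠ 0 := by
      exact_mod_cast (sinRatio_pos hp (t := t - 1) (by linarith) (by linarith)).ne'
    have h2 : (sinRatio p t : ℂ) ≠ 0 := by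
      exact_mod_cast (sinRatio_pos hp (t := t) (by linarith) (by linarith)).ne'
    have hd : mobDen (heckeU p ^ t) (0 : ℂ) ≠ 0 := by
      simpa [mobDen, d] using h1
    have hm : mob (heckeU p ^ t) (0 : ℂ) ≠ 0 := by
      refine div_ne_zero ?_ hd
      simpa [mobNum, b] using h2
    exact RegularAt.slash k hd ⟨_, (HasValueAt.of_polynomial _ P).div ((HasValueAt.X _).pow n)
      (pow_ne_zero n hm)⟩
  have hNent : (heckeT * heckeU p) 0 0 = -1 ∧ (heckeT * heckeU p) 0 1 = 0 ∧
      (heckeT * heckeU p) 1 0 = heckeLambda p ∧ (heckeT * heckeU p) 1 1 = -1 := by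
    obtain ⟨a, b, c, d⟩ := heckeT_entries
    obtain ⟨e, f, g, h⟩ := heckeU_entries p
    simp only [mul_zero_zero, mul_zero_one, mul_one_zero, mul_one_one, a, b, c, d, e, f, g, h]
    norm_num
  generalize heckeT * heckeU p = N at hreg hNent
  obtain ⟨a, b, c, d⟩ := hNent
  set D : RatFunc ℂ := linDen N with hD
  have hD0 : D ≠ 0 := linDen_ne_zero N
  have hDval : HasValueAt 0 D (-1) := by
    simpa [mobDen, c, d] using hasValueAt_linDen N 0
  -- The expansion (1 - λX)^m = 1 - mλX + O(X²), needed for m = 2k and m = n.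
  have hDpow : ∀ m : ℕ, ∃ g, RegularAt 0 g ∧
      (-D) ^ m = 1 - RatFunc.C (m * heckeLambda p : ℂ) * RatFunc.X + RatFunc.X ^ 2 * g := by
    have hDeq : -D = 1 - RatFunc.C (heckeLambda p : ℂ) * RatFunc.X := by
      rw [hD, linDen, c, d]; simp; ring
    intro m
    induction m with
    | zero => exact ⟨0, .zero 0, by simp⟩
    | succ m ih =>
      obtain ⟨g, hg, hm⟩ := ih
      refine ⟨g - RatFunc.C (heckeLambda p : ℂ) * RatFunc.X * g +
        RatFunc.C (m * heckeLambda p : ℂ) * RatFunc.C (heckeLambda p : ℂ),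
        (hg.sub (((RegularAt.const _ _).mul ⟨_, .X 0⟩).mul hg)).add
          ((RegularAt.const _ _).mul (RegularAt.const _ _)), ?_⟩
      rw [pow_succ, hm, hDeq]
      push_cast
      simp only [map_add, map_mul, map_one]
      ring
  obtain ⟨g₁, hg₁, e₁⟩ := hDpow (2 * k)
  obtain ⟨g₂, hg₂, e₂⟩ := hDpow n
  obtain ⟨P₁, hP₁⟩ : ∃ P₁ : Polynomial ℂ, P = Polynomial.C (P.eval 0) + Polynomial.X * P₁ :=
    ⟨P.divX, by rw [add_comm, ← Polynomial.coeff_zero_eq_eval_zero, Polynomial.X_mul_divX_add]⟩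
  have hmobX : mobComp N RatFunc.X = RatFunc.X / (-D) := by
    rw [mobComp_X, linNum, a, b]
    simp [neg_div, hD]
    exact (div_neg _).symm
  have hPP : algebraMap (Polynomial ℂ) (RatFunc ℂ) P =
      RatFunc.C (P.eval 0) + RatFunc.X * algebraMap (Polynomial ℂ) (RatFunc ℂ) P₁ := by
    conv_lhs => rw [hP₁]
    simp
  set A := algebraMap (Polynomial ℂ) (RatFunc ℂ) P₁ with hA
  have hDn : (-D) ≠ 0 := neg_ne_zero.mpr hD0
  have key : (-D) ^ (2 * k) * (RatFunc.X ^ (n - 1) * (r - slash k r N)) =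
      RatFunc.C (P.eval 0) * (RatFunc.C ((n - 2 * k) * heckeLambda p : ℂ) +
        RatFunc.X * (g₁ - g₂)) + ((-D) ^ (2 * k) * A - (-D) ^ n / (-D) * mobComp N A) := by
    have hs : slash k r N = ((-D) ^ (2 * k))⁻¹ * ((RatFunc.C (P.eval 0) +
        RatFunc.X / (-D) * mobComp N A) / (RatFunc.X / (-D)) ^ n) := by
      rw [slash_eq, hr, map_div₀, map_pow, hmobX, hPP, map_add, map_mul, mobComp_C, hmobX,
        ← hD, (even_two_mul k).neg_pow]
    have hX1 : (RatFunc.X : RatFunc ℂ) ^ n = RatFunc.X * RatFunc.X ^ (n - 1) := by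
      rw [← pow_succ', Nat.sub_add_cancel (by omega)]
    have hXn := pow_ne_zero (n - 1) hX
    apply mul_left_cancel₀ hX
    have l1 : RatFunc.X * ((-D) ^ (2 * k) * (RatFunc.X ^ (n - 1) * (r - slash k r N))) =
        (-D) ^ (2 * k) * (RatFunc.X ^ n * r) - (-D) ^ (2 * k) * (RatFunc.X ^ n * slash k r N) := by
      rw [hX1]; ring
    have l2 : RatFunc.X ^ n * r = RatFunc.C (P.eval 0) + RatFunc.X * A := by
      rw [hr, hPP, mul_div_cancel₀]
      exact pow_ne_zero n hX
    have l3 : (-D) ^ (2 * k) * (RatFunc.X ^ n * slash k r N) =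
        (-D) ^ n * (RatFunc.C (P.eval 0) + RatFunc.X / (-D) * mobComp N A) := by
      rw [hs, div_pow]
      have := pow_ne_zero n hX
      generalize RatFunc.X / (-D) * mobComp N A = B
      field_simp
    rw [l1, l2, l3]
    have l4 : (-D) ^ n * (RatFunc.C (P.eval 0) + RatFunc.X / (-D) * mobComp N A) =
        (-D) ^ n * RatFunc.C (P.eval 0) + RatFunc.X * ((-D) ^ n / (-D) * mobComp N A) := by
      ring
    have l5 : (-D) ^ (2 * k) - (-D) ^ n = RatFunc.X *
        (RatFunc.C ((n - 2 * k) * heckeLambda p : ℂ) + RatFunc.X * (g₁ - g₂)) := by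
      rw [e₁, e₂]
      push_cast
      simp only [map_mul, map_sub, map_natCast, map_ofNat]
      ring
    rw [l4]
    linear_combination RatFunc.C (P.eval 0) * l5
  have hN0 : mobDen N (0 : ℂ) ≠ 0 := by simp [mobDen, d]
  have hmob0 : mob N (0 : ℂ) = 0 := by simp [mob, mobNum, b]
  obtain ⟨v₁, hv₁⟩ := hg₁.sub hg₂
  have hDv : HasValueAt 0 (-D) 1 := by simpa using hDval.neg
  have hright := ((HasValueAt.const 0 (P.eval 0)).mul
    ((HasValueAt.const 0 ((n - 2 * k) * heckeLambda p : ℂ)).add ((HasValueAt.X 0).mul hv₁))).add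
    (((hDv.pow (2 * k)).mul (HasValueAt.of_polynomial 0 P₁)).sub
      (((hDv.pow n).div hDv one_ne_zero).mul
        (HasValueAt.mobComp hN0 (HasValueAt.of_polynomial (mob N 0) P₁))))
  rw [← hA, ← key] at hright
  have hleft := (hDv.pow (2 * k)).mul
    (hreg.hasValueAt_X_sub_pow_mul (n := n - 1) (by omega))
  rw [map_zero, sub_zero] at hleft
  have hfin := hright.unique hleft
  rw [hmob0] at hfin
  simp [hP, hlam.ne'] at hfin
  have : (n : ℂ) = ((2 * k : ℕ) : ℂ) := by push_cast; linear_combination hfin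
  exact_mod_cast this

/-- Here the relation under T suffices: it is a functional equation for P with exponent 2k - 2n, so
P is zero unless n = k, that is n = k = 1, where P is constant. -/
lemma IsRPF.isZeroPoleRPF_of_order_le_one (hk : k ≠ 0) {n : ℕ} {P : Polynomial ℂ}
    (h : IsRPF p k (algebraMap (Polynomial ℂ) (RatFunc ℂ) P / RatFunc.X ^ n)) (hn : n ≤ 1) :
    ∃ b : ℂ, algebraMap (Polynomial ℂ) (RatFunc ℂ) P / RatFunc.X ^ n =
      if k = 1 then RatFunc.C b * RatFunc.X⁻¹ else 0 := by
  rcases eq_const_of_eval_neg_inv (by simp) (h.eval_neg_inv (by omega)) with rfl | ⟨hj, a, rfl⟩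
  · exact ⟨0, by simp⟩
  · obtain ⟨rfl, rfl⟩ : n = 1 ∧ k = 1 := by omega
    exact ⟨a, by simp [div_eq_mul_inv]⟩

/-- A rational period function without nonzero poles is one of the functions `q_{k,0}`. -/
lemma IsRPF.isZeroPoleRPF (hp : 3 ≤ p) (hk : k ≠ 0) {r : RatFunc ℂ} (h : IsRPF p k r)
    (h0 : nonzeroPoles r = ∅) : IsZeroPoleRPF k r := by
  obtain ⟨n, P, rfl, hP, -⟩ := exists_eq_div_X_pow h0
  by_cases hn : n ≤ 1
  · obtain ⟨b, hb⟩ := h.isZeroPoleRPF_of_order_le_one hk hn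
    exact ⟨0, b, by rw [hb]; simp⟩
  have hP0 : P.eval 0 ≠ 0 := hP.resolve_left (by omega)
  have hn2 := h.order_at_zero hp (by omega) hP0
  have hX : (RatFunc.X : RatFunc ℂ) ≠ 0 := RatFunc.X_ne_zero
  -- This cancels the term P(0) z^(-2k). The order at 0 falls below 2k, and since orders at least 2
  -- must equal 2k, it is at most 1.
  have h1 := h.add ((isRPF_one_sub hp k).C_mul (P.eval 0))
  have h10 : nonzeroPoles (algebraMap (Polynomial ℂ) (RatFunc ℂ) P / RatFunc.X ^ n +
      RatFunc.C (P.eval 0) * (1 - (RatFunc.X ^ (2 * k))⁻¹)) = ∅ := by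
    rw [Set.eq_empty_iff_forall_notMem]
    intro w hw
    rw [mem_nonzeroPoles] at hw
    refine hw.2 (RegularAt.add ?_ ((RegularAt.const _ _).mul (regularAt_one_sub hw.1 k)))
    exact ⟨_, (HasValueAt.of_polynomial w P).div ((HasValueAt.X w).pow n) (pow_ne_zero n hw.1)⟩
  obtain ⟨m, R, hR, hR0, hmin⟩ := exists_eq_div_X_pow h10
  have hm : m ≤ n - 1 := by
    refine hmin _ ?_
    have hval : HasValueAt 0 (RatFunc.X ^ n *
        (algebraMap (Polynomial ℂ) (RatFunc ℂ) P / RatFunc.X ^ n +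
          RatFunc.C (P.eval 0) * (1 - (RatFunc.X ^ (2 * k))⁻¹))) 0 := by
      have h2 := (HasValueAt.of_polynomial 0 P).add ((HasValueAt.const 0 (P.eval 0)).mul
        (((HasValueAt.X 0).pow n).sub (HasValueAt.one 0)))
      have h3 : P.eval 0 + P.eval 0 * (0 ^ n - 1) = 0 := by
        rw [zero_pow (by omega)]; ring
      rw [h3] at h2
      convert h2 using 1
      rw [hn2]
      field_simp
    obtain ⟨g, hg, hgr⟩ := hval.exists_eq_X_sub_mul
    rw [map_zero, sub_zero] at hgr
    have hpow : (RatFunc.X : RatFunc ℂ) ^ n = RatFunc.X * RatFunc.X ^ (n - 1) := by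
      rw [← pow_succ', Nat.sub_add_cancel (by omega)]
    rw [hpow, mul_assoc, ← hpow] at hgr
    rwa [mul_left_cancel₀ hX hgr]
  have hRPF := h1
  rw [hR] at hRPF
  by_cases hm1 : m ≤ 1
  · obtain ⟨b, hb⟩ := hRPF.isZeroPoleRPF_of_order_le_one hk hm1
    refine ⟨-P.eval 0, b, ?_⟩
    rw [← hb, ← hR, map_neg]
    ring
  · have := hRPF.order_at_zero hp (by omega) (hR0.resolve_left (by omega))
    omega

end

end

noncomputable section

open scoped MatrixGroups

open SLTwo

section

variable {p k : ℕ}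

/-! ### Sums over classes -/

lemma classSum_eq_formSum (hp : 3 ≤ p) {𝒜 : Set BQF} (h : IsFormClass p 𝒜) :
    classSum p k 𝒜 = formSum p k (simpleNumbers_finite hp h).toFinset :=
  finsum_mem_eq_finite_toFinset_sum _ _

lemma isRPF_classSum (hp : 3 ≤ p) (hk : Odd k) {𝒜 : Set BQF} (h : IsFormClass p 𝒜)
    (hneg : negClass 𝒜 = 𝒜) : IsRPF p k (classSum p k 𝒜) := by
  rw [classSum_eq_formSum hp h]
  refine isRPF_formSum hp hk (fun x hx ↦ ?_) (fun x hx ↦ ?_) (fun x hx ↦ ?_)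
  · exact (mem_simpleNumbers.mp ((Set.Finite.mem_toFinset _).mp hx)).1
  · simp only [Set.Finite.mem_toFinset] at hx ⊢
    exact mem_simpleNumbers_next hp h hx
  · simp only [Set.Finite.mem_toFinset] at hx ⊢
    have := heckeStar_mem_negClass hp h hx
    rwa [hneg] at this

/-- The summand of x may also be singular at x' = T(Tx'). This point belongs to P_𝒜 because Tx' ∈
Z_{-𝒜} = Z_𝒜. -/
lemma regularAt_classSum (hp : 3 ≤ p) {𝒜 : Set BQF} (h : IsFormClass p 𝒜)
    (hneg : negClass 𝒜 = 𝒜) {w : ℂ} (hw : w ∉ poleSystem p 𝒜) :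
    RegularAt w (classSum p k 𝒜) := by
  rw [classSum_eq_formSum hp h]
  refine regularAt_formSum hp (fun x hx ↦ ?_) (fun x hx ↦ ⟨?_, ?_⟩)
  · exact (mem_simpleNumbers.mp ((Set.Finite.mem_toFinset _).mp hx)).1
  · rintro rfl
    exact hw ⟨x, (Set.Finite.mem_toFinset _).mp hx, Or.inl rfl⟩
  · rintro rfl
    have := heckeStar_mem_negClass hp h ((Set.Finite.mem_toFinset _).mp hx)
    rw [hneg] at this
    exact hw ⟨_, this, Or.inr (by rw [heckeConj_eq_neg_one_div_heckeStar])⟩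

lemma HasSymmetricForm.add_classSum {q : RatFunc ℂ} (hq : HasSymmetricForm p k q) (c : ℂ)
    {𝒜 : Set BQF} (h : IsHyperbolicClass p 𝒜) (hneg : negClass 𝒜 = 𝒜) :
    HasSymmetricForm p k (q + RatFunc.C c * classSum p k 𝒜) := by
  obtain ⟨L, d, ℬ, c₀, r, hℬ, hr, rfl⟩ := hq
  refine ⟨L + 1, Fin.cons c d, Fin.cons 𝒜 ℬ, c₀, r, ?_, hr, ?_⟩
  · intro l
    refine Fin.cases ?_ (fun i ↦ ?_) l
    · simpa using ⟨h, hneg⟩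
    · simpa using hℬ i
  · rw [Fin.sum_univ_succ]
    simp only [Fin.cons_zero, Fin.cons_succ]
    ring

/-! ### Hecke-symmetric irreducible systems of poles -/

/-- At a simple pole `x` the polar part of a rational period function is a multiple of that
of `Q_x(z, 1)^(-k)`. -/
lemma IsRPF.exists_polar_part (hp : 3 ≤ p) {q : RatFunc ℂ} (h : IsRPF p k q) {x : ℝ}
    (hx : IsSimple p x) (hmem : (x : ℂ) ∈ nonzeroPoles q) :
    ∃ c : ℂ, RegularAt (x : ℂ)
      (q - RatFunc.C c * ((hyperbolicForm p x).toRatFunc ^ k)⁻¹) := by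
  have hpos := hx.pos hp
  obtain ⟨l, hl, hne, hfix, hreg⟩ :=
    h.exists_word_fixing_pole hp hmem (rightHalf_ofReal.mpr hpos)
  rw [mob_ofReal, Complex.ofReal_inj] at hfix
  have hact : (hyperbolicForm p x).act (wordProd p l) = hyperbolicForm p x := by
    have h1 := hyperbolicForm_mob hp hx.1 (wordProd_mem (p := p) l)
    rw [hfix] at h1
    conv_lhs => rw [h1, BQF.act_inv_act]
  obtain ⟨u, hu, hval⟩ := hasValueAt_inv_form hp k hx.1
  obtain ⟨n, hn⟩ := exists_regularAt_X_sub_pow_mul (x : ℂ) q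
  refine polar_part_of_invariant (isAttracting_wordProd hp hl hne hpos hfix)
    (by rw [slash_toRatFunc, hact]) hu hval n hn ?_
  simpa using hreg.neg

/-- Induction on the number of nonzero poles. Subtracting c times the class sum of a simple pole x
removes the pole at x and creates none, because P_𝒜 already consists of poles of q. Pole systems of
the difference are therefore pole systems of q, so the hypothesis survives. -/
lemma IsRPF.hasSymmetricForm (hp : 3 ≤ p) (hk : Odd k) {q : RatFunc ℂ} (h : IsRPF p k q)
    (hs : ∀ P, IsISPOf p q P → HeckeSymmetric p P) : HasSymmetricForm p k q := by
  induction hn : (nonzeroPoles q).ncard using Nat.strong_induction_on generalizing q with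
  | _ n ih =>
    rcases (nonzeroPoles q).eq_empty_or_nonempty with h0 | ⟨w, hw⟩
    · exact ⟨0, Fin.elim0, Fin.elim0, 1, q, fun l ↦ l.elim0,
        h.isZeroPoleRPF hp hk.pos.ne' h0, by simp⟩
    obtain ⟨x, hx, hmem, -⟩ := h.exists_simple_pole hp hw
    have h𝒜 := isHyperbolicClass_formClass hp hx.1
    have hxZ : x ∈ simpleNumbers p (formClass p x) :=
      mem_simpleNumbers.mpr ⟨hx, hyperbolicForm_mem_formClass x⟩
    have hsub := h.poleSystem_subset hp h𝒜.1 hxZ hmem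
    have hneg := negClass_eq_of_heckeSymmetric hp h𝒜 (hs _ ⟨_, h𝒜, rfl, hsub⟩)
    obtain ⟨c, hc⟩ := h.exists_polar_part hp hx hmem
    set f := classSum p k (formClass p x) with hf
    have h₁ : IsRPF p k (q - RatFunc.C c * f) :=
      h.sub ((isRPF_classSum hp hk h𝒜.1 hneg).C_mul c)
    have hpoles : nonzeroPoles (q - RatFunc.C c * f) ⊆ nonzeroPoles q := by
      intro v hv
      by_contra hv'
      rw [mem_nonzeroPoles] at hv hv'
      refine hv.2 (RegularAt.sub (not_not.mp fun hr ↦ hv' ⟨hv.1, hr⟩)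
        ((RegularAt.const v c).mul (regularAt_classSum hp h𝒜.1 hneg fun hvP ↦ ?_)))
      exact hv' (mem_nonzeroPoles.mp (hsub hvP))
    have hxreg : RegularAt (x : ℂ) (q - RatFunc.C c * f) := by
      have h2 := regularAt_formSum_sub (k := k) (x := x) hp
        (Z := (simpleNumbers_finite hp h𝒜.1).toFinset)
        (fun y hy ↦ (mem_simpleNumbers.mp ((Set.Finite.mem_toFinset _).mp hy)).1)
        ((Set.Finite.mem_toFinset _).mpr hxZ)
      rw [← classSum_eq_formSum hp h𝒜.1, ← hf] at h2
      convert hc.sub ((RegularAt.const (x : ℂ) c).mul h2) using 1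
      ring
    have hlt : (nonzeroPoles (q - RatFunc.C c * f)).ncard < n := by
      rw [← hn]
      refine Set.ncard_lt_ncard ⟨hpoles, fun hle ↦ ?_⟩ (nonzeroPoles_finite q)
      exact (mem_nonzeroPoles.mp (hle hmem)).2 hxreg
    have := (ih _ hlt h₁ (fun P hP ↦ hs P ?_) rfl).add_classSum c h𝒜 hneg
    · rwa [← hf, sub_add_cancel] at this
    · obtain ⟨ℬ, h1, h2, h3⟩ := hP
      exact ⟨ℬ, h1, h2, h3.trans hpoles⟩

/-! ### The converse -/

lemma IsRPF.heckeSymmetric_nonzeroPoles (hp : 3 ≤ p) {q : RatFunc ℂ} (h : IsRPF p k q)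
    (hstar : ∀ x, IsSimple p x → (x : ℂ) ∈ nonzeroPoles q →
      ((heckeStar p x : ℝ) : ℂ) ∈ nonzeroPoles q) : HeckeSymmetric p (nonzeroPoles q) := by
  have e : nonzeroPoles q = {w | ∃ x ∈ {x : ℝ | IsSimple p x ∧ (x : ℂ) ∈ nonzeroPoles q},
      w = (x : ℂ) ∨ w = ((-1 / x : ℝ) : ℂ)} := by
    ext w
    constructor
    · intro hw
      obtain ⟨x, h1, h2, h3⟩ := h.exists_simple_pole hp hw
      exact ⟨x, ⟨h1, h2⟩, h3⟩
    · rintro ⟨x, ⟨-, h2⟩, rfl | rfl⟩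
      · exact h2
      · simpa using h.neg_one_div_mem h2
  rw [e]
  exact heckeSymmetric_of_star hp (fun x hx ↦ hx.1)
    fun x hx ↦ ⟨hx.1.heckeStar hp, hstar x hx.1 hx.2⟩

lemma mem_simpleNumbers_of_mem_poleSystem (hp : 3 ≤ p) {𝒜 : Set BQF} {x : ℝ} (hx : 0 < x)
    (h : (x : ℂ) ∈ poleSystem p 𝒜) : x ∈ simpleNumbers p 𝒜 := by
  obtain ⟨y, hy, h | h⟩ := h <;> rw [Complex.ofReal_inj] at h
  · rwa [h]
  · have : -1 / y < 0 :=
      div_neg_of_neg_of_pos (by norm_num) ((mem_simpleNumbers.mp hy).1.pos hp)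
    linarith

lemma HasSymmetricForm.isRPF (hp : 3 ≤ p) (hk : Odd k) {q : RatFunc ℂ}
    (h : HasSymmetricForm p k q) : IsRPF p k q := by
  obtain ⟨L, d, 𝒜, c₀, r, h𝒜, hr, rfl⟩ := h
  exact (IsRPF.sum _ fun l _ ↦ (isRPF_classSum hp hk (h𝒜 l).1.1 (h𝒜 l).2).C_mul (d l)).add
    ((hr.isRPF hp).C_mul c₀)

/-- Cancellation between the class sums need not be analysed: a pole x lies in some P_{𝒜_ℓ}, which
also contains Tx', and `poleSystem_subset` makes every point of that system a pole. -/
lemma HasSymmetricForm.heckeSymmetric (hp : 3 ≤ p) (hk : Odd k) {q : RatFunc ℂ}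
    (h : HasSymmetricForm p k q) : HeckeSymmetric p (nonzeroPoles q) := by
  have hq := h.isRPF hp hk
  refine hq.heckeSymmetric_nonzeroPoles hp fun x hx hmem ↦ ?_
  obtain ⟨L, d, 𝒜, c₀, r, h𝒜, hr, rfl⟩ := h
  obtain ⟨l, hl⟩ : ∃ l, (x : ℂ) ∈ poleSystem p (𝒜 l) := by
    by_contra! hcon
    rw [mem_nonzeroPoles] at hmem
    exact hmem.2 ((RegularAt.sum _ fun l _ ↦ (RegularAt.const _ (d l)).mul
      (regularAt_classSum hp (h𝒜 l).1.1 (h𝒜 l).2 (hcon l))).add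
      ((RegularAt.const _ c₀).mul (hr.regularAt hmem.1)))
  have hxZ := mem_simpleNumbers_of_mem_poleSystem hp (hx.pos hp) hl
  have hstar := heckeStar_mem_negClass hp (h𝒜 l).1.1 hxZ
  rw [(h𝒜 l).2] at hstar
  exact hq.poleSystem_subset hp (h𝒜 l).1.1 hxZ hmem ⟨_, hstar, Or.inl rfl⟩

/-! ### Classes that are not symmetric -/

section

variable {𝒜 : Set BQF}

open Classical in
/-- The points of `Z_𝒜` and of `Z_{-𝒜}`. -/
def symmetricPoints (hp : 3 ≤ p) (h : IsFormClass p 𝒜) : Finset ℝ :=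
  (simpleNumbers_finite hp h).toFinset ∪ (simpleNumbers_finite hp h.negClass).toFinset

lemma mem_symmetricPoints (hp : 3 ≤ p) (h : IsFormClass p 𝒜) {x : ℝ} :
    x ∈ symmetricPoints hp h ↔ x ∈ simpleNumbers p 𝒜 ∨ x ∈ simpleNumbers p (negClass 𝒜) := by
  simp [symmetricPoints]

lemma isSimple_of_mem_symmetricPoints (hp : 3 ≤ p) (h : IsFormClass p 𝒜) {x : ℝ}
    (hx : x ∈ symmetricPoints hp h) : IsSimple p x := by
  rcases (mem_symmetricPoints hp h).mp hx with hx | hx <;> exact (mem_simpleNumbers.mp hx).1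

lemma heckeStar_mem_symmetricPoints (hp : 3 ≤ p) (h : IsFormClass p 𝒜) {x : ℝ}
    (hx : x ∈ symmetricPoints hp h) : heckeStar p x ∈ symmetricPoints hp h := by
  rw [mem_symmetricPoints] at hx ⊢
  rcases hx with hx | hx
  · exact Or.inr (heckeStar_mem_negClass hp h hx)
  · have := heckeStar_mem_negClass hp h.negClass hx
    rw [negClass_negClass] at this
    exact Or.inl this

/-- Since the classes are distinct, Z_𝒜 and Z_{-𝒜} are disjoint, so no form is counted twice. -/
lemma classSum_add_classSum_negClass (hp : 3 ≤ p) (h : IsFormClass p 𝒜) (hneg : negClass 𝒜 ≠ 𝒜) :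
    classSum p k 𝒜 + classSum p k (negClass 𝒜) = formSum p k (symmetricPoints hp h) := by
  classical
  rw [classSum_eq_formSum hp h, classSum_eq_formSum hp h.negClass, formSum, formSum, formSum,
    symmetricPoints, ← Finset.sum_union]
  rw [Finset.disjoint_left]
  intro x hx hx'
  rw [Set.Finite.mem_toFinset, mem_simpleNumbers] at hx hx'
  exact hneg (h.negClass.eq_of_mem h hx'.2 hx.2)

lemma isRPF_classSum_add (hp : 3 ≤ p) (hk : Odd k) (h : IsFormClass p 𝒜)
    (hneg : negClass 𝒜 ≠ 𝒜) : IsRPF p k (classSum p k 𝒜 + classSum p k (negClass 𝒜)) := by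
  rw [classSum_add_classSum_negClass hp h hneg]
  refine isRPF_formSum hp hk (fun x ↦ isSimple_of_mem_symmetricPoints hp h) (fun x hx ↦ ?_)
    (fun x ↦ heckeStar_mem_symmetricPoints hp h)
  simp only [mem_symmetricPoints] at hx ⊢
  rcases hx with hx | hx
  · obtain ⟨t, ht, hx⟩ := mem_simpleNumbers_next hp h hx
    exact ⟨t, ht, Or.inl hx⟩
  · obtain ⟨t, ht, hx⟩ := mem_simpleNumbers_next hp h.negClass hx
    exact ⟨t, ht, Or.inr hx⟩

lemma heckeSymmetric_classSum_add (hp : 3 ≤ p) (hk : Odd k) (h : IsFormClass p 𝒜)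
    (hneg : negClass 𝒜 ≠ 𝒜) :
    HeckeSymmetric p (nonzeroPoles (classSum p k 𝒜 + classSum p k (negClass 𝒜))) := by
  refine (isRPF_classSum_add hp hk h hneg).heckeSymmetric_nonzeroPoles hp fun x hx hmem ↦ ?_
  rw [classSum_add_classSum_negClass hp h hneg] at hmem ⊢
  have hZ : ∀ x ∈ symmetricPoints hp h, IsSimple p x :=
    fun x ↦ isSimple_of_mem_symmetricPoints hp h
  refine mem_nonzeroPoles_formSum hp hk.pos.ne' hZ (heckeStar_mem_symmetricPoints hp h ?_)
  by_contra hx'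
  refine (mem_nonzeroPoles.mp hmem).2 (regularAt_formSum hp hZ fun y hy ↦ ⟨?_, ?_⟩)
  · rintro hxy
    rw [Complex.ofReal_inj] at hxy
    exact hx' (hxy ▸ hy)
  · intro hxy
    rw [Complex.ofReal_inj] at hxy
    linarith [hx.pos hp, (hZ y hy).heckeConj_neg hp]

lemma poleSystem_isISPOf_classSum_add (hp : 3 ≤ p) (hk : Odd k) (h : IsHyperbolicClass p 𝒜)
    (hneg : negClass 𝒜 ≠ 𝒜) :
    IsISPOf p (classSum p k 𝒜 + classSum p k (negClass 𝒜)) (poleSystem p 𝒜) := by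
  obtain ⟨x, hx⟩ := simpleNumbers_nonempty hp h
  refine ⟨𝒜, h, rfl, (isRPF_classSum_add hp hk h.1 hneg).poleSystem_subset hp h.1 hx ?_⟩
  rw [classSum_add_classSum_negClass hp h.1 hneg]
  exact mem_nonzeroPoles_formSum hp hk.pos.ne' (fun x ↦ isSimple_of_mem_symmetricPoints hp h.1)
    ((mem_symmetricPoints hp h.1).mpr (Or.inl hx))

end

/-! ### The form `x² - 3 y²` on the modular group -/

lemma heckeLambda_three : heckeLambda 3 = 1 := by
  have : (Real.pi / (3 : ℕ)) = Real.pi / 3 := by norm_num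
  rw [heckeLambda, this, Real.cos_pi_div_three]; norm_num

lemma exists_int_of_mem_adjoin {x : ℝ} (h : x ∈ Algebra.adjoin ℤ {heckeLambda 3}) :
    ∃ n : ℤ, x = n := by
  have h1 : Algebra.adjoin ℤ {heckeLambda 3} = ⊥ := by
    rw [heckeLambda_three, Algebra.adjoin_singleton_one]
  rw [h1, Algebra.mem_bot] at h
  obtain ⟨n, rfl⟩ := h
  exact ⟨n, by simp⟩

/-- The automorph (2 3; 1 2) of x² - 3y², coming from the unit 2 + √3. -/
lemma wordProd_three_entries : wordProd 3 [1, 2, 1] 0 0 = 2 ∧ wordProd 3 [1, 2, 1] 0 1 = 3 ∧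
    wordProd 3 [1, 2, 1] 1 0 = 1 ∧ wordProd 3 [1, 2, 1] 1 1 = 2 := by
  obtain ⟨a, b, c, d⟩ := heckeV_entries le_rfl 1
  obtain ⟨e, f, g, h⟩ := heckeV_entries le_rfl 2
  have s2 : sinRatio 3 2 = 1 := by
    have := sinRatio_sub_one (p := 3) le_rfl
    norm_num at this; exact this
  have s3 : sinRatio 3 3 = 0 := by
    have := sinRatio_self (p := 3) le_rfl
    norm_num at this; exact this
  have s1 := sinRatio_one (p := 3) le_rfl
  norm_num [s1, s2, s3] at a b c d e f g h
  simp only [wordProd_cons, wordProd_nil, mul_one, mul_zero_zero, mul_zero_one, mul_one_zero,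
    mul_one_one, a, b, c, d, e, f, g, h]
  norm_num

lemma fixes_wordProd_three {x : ℝ} : Fixes (wordProd 3 [1, 2, 1]) x ↔ x ^ 2 = 3 := by
  obtain ⟨a, b, c, d⟩ := wordProd_three_entries
  rw [Fixes, a, b, c, d]
  constructor <;> intro h <;> linarith

lemma isSimple_sqrt_three : IsSimple 3 (Real.sqrt 3) :=
  IsPeriodic.isSimple le_rfl ⟨by positivity, [1, 2, 1], by simp [Admissible], by simp,
    (fixes_wordProd_three.mpr (Real.sq_sqrt (by norm_num))).mob_eq⟩

lemma heckeConj_sqrt_three : heckeConj 3 (Real.sqrt 3) = -Real.sqrt 3 := by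
  have hs := isSimple_sqrt_three
  have hsq : Real.sqrt 3 ^ 2 = 3 := Real.sq_sqrt (by norm_num)
  have hconj := (isHeckeConj_iff (p := 3) le_rfl).mpr ⟨hs.1, rfl⟩
  have h1 := fixes_wordProd_three.mp
    (hconj.2.2 _ (wordProd_mem [1, 2, 1]) (fixes_wordProd_three.mpr hsq))
  rcases sq_eq_sq_iff_eq_or_eq_neg.mp (h1.trans hsq.symm) with h | h
  · exact absurd h hconj.2.1
  · exact h

/-- Knowing the roots ±√3 fixes the form up to a factor, which is enough: M_√3 itself need not be
identified. -/
lemma hyperbolicForm_sqrt_three : ∃ c : ℝ, c ≠ 0 ∧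
    hyperbolicForm 3 (Real.sqrt 3) = ⟨c, 0, -(3 * c)⟩ := by
  have hs := isSimple_sqrt_three
  have hsq : Real.sqrt 3 ^ 2 = 3 := Real.sq_sqrt (by norm_num)
  have h1 := lower_mul_heckeConj (p := 3) le_rfl hs.1
  have h2 := (hyperbolicElt_spec (p := 3) le_rfl hs.1).2.2.2.1
  rw [heckeConj_sqrt_three, neg_add_cancel, mul_zero] at h1
  rw [Fixes] at h2
  refine ⟨_, hyperbolicElt_lower_ne_zero (p := 3) le_rfl hs.1, ?_⟩
  rw [hyperbolicForm, BQF.ofMatrix]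
  congr 1
  · linarith
  · rw [neg_inj]
    linear_combination h2 + Real.sqrt 3 * h1 + hyperbolicElt 3 (Real.sqrt 3) 1 0 * hsq

/-- Modulo 4 the left side is m² + n², which is never 3. -/
lemma int_sq_sub_three_mul_sq_ne (m n : ℤ) : m ^ 2 - 3 * n ^ 2 ≠ -1 := by
  intro h
  have h4 : ((m : ZMod 4)) ^ 2 - 3 * (n : ZMod 4) ^ 2 = -1 := by exact_mod_cast congrArg _ h
  generalize (m : ZMod 4) = a at h4
  generalize (n : ZMod 4) = b at h4
  revert a b
  decide

/-- Since λ_3 = 1, group elements have integer entries. The leading coefficient of -Q = Q ∘ M then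
reads m² - 3n² = -1, with (m, n) the first column of M. -/
lemma negClass_formClass_sqrt_three :
    negClass (formClass 3 (Real.sqrt 3)) ≠ formClass 3 (Real.sqrt 3) := by
  intro h
  have h1 : (hyperbolicForm 3 (Real.sqrt 3)).neg ∈ formClass 3 (Real.sqrt 3) := by
    rw [← h, neg_mem_negClass]; exact hyperbolicForm_mem_formClass _
  obtain ⟨M, hM, h2⟩ := h1
  obtain ⟨c, hc, hQ⟩ := hyperbolicForm_sqrt_three
  obtain ⟨ha, -, hc', -⟩ := entry_mem_adjoin hM
  obtain ⟨m, hm⟩ := exists_int_of_mem_adjoin ha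
  obtain ⟨n, hn⟩ := exists_int_of_mem_adjoin hc'
  have h3 := congrArg BQF.A h2
  simp only [hQ, BQF.neg, BQF.act, hm, hn] at h3
  refine int_sq_sub_three_mul_sq_ne m n ?_
  have h4 : c * ((m : ℝ) ^ 2 - 3 * (n : ℝ) ^ 2 + 1) = 0 := by linear_combination -h3
  have h5 := (mul_eq_zero.mp h4).resolve_left hc
  have h6 : (m : ℝ) ^ 2 - 3 * (n : ℝ) ^ 2 = -1 := by linarith
  exact_mod_cast h6

end

end

theorem theorem2 (k : ℕ) (hk : Odd k) :
    (∀ p : ℕ, 3 ≤ p →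
      -- the sums over `Z_𝒜` are finite sums
      (∀ 𝒜 : Set BQF, IsHyperbolicClass p 𝒜 → (simpleNumbers p 𝒜).Finite) ∧
      -- Hecke-symmetric irreducible systems of poles force the special form
      (∀ q : RatFunc ℂ, IsRPF p k q → (∀ P : Set ℂ, IsISPOf p q P → HeckeSymmetric p P) →
        HasSymmetricForm p k q) ∧
      -- the converse
      (∀ q : RatFunc ℂ, HasSymmetricForm p k q →
        IsRPF p k q ∧ HeckeSymmetric p (nonzeroPoles q))) ∧
    -- a Hecke-symmetric set of nonzero poles does not force Hecke-symmetric irreducible systems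
    (∃ p : ℕ, 3 ≤ p ∧ ∃ 𝒜 : Set BQF, IsHyperbolicClass p 𝒜 ∧ IsHyperbolicClass p (negClass 𝒜) ∧
      ∃ q : RatFunc ℂ, q = classSum p k 𝒜 + classSum p k (negClass 𝒜) ∧
        IsRPF p k q ∧ HeckeSymmetric p (nonzeroPoles q) ∧
        ∃ P : Set ℂ, IsISPOf p q P ∧ ¬ HeckeSymmetric p P) := by
  refine ⟨fun p hp ↦ ⟨fun 𝒜 h ↦ simpleNumbers_finite hp h.1,
    fun q hq hs ↦ hq.hasSymmetricForm hp hk hs,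
    fun q hq ↦ ⟨hq.isRPF hp hk, hq.heckeSymmetric hp hk⟩⟩, 3, le_rfl, ?_⟩
  have h := isHyperbolicClass_formClass le_rfl isSimple_sqrt_three.1
  have hneg := negClass_formClass_sqrt_three
  exact ⟨_, h, h.negClass le_rfl, _, rfl, isRPF_classSum_add le_rfl hk h.1 hneg,
    heckeSymmetric_classSum_add le_rfl hk h.1 hneg, _,
    poleSystem_isISPOf_classSum_add le_rfl hk h hneg,
    fun hs ↦ hneg (negClass_eq_of_heckeSymmetric le_rfl h hs)⟩
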